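/- Let $p>3$ be a prime, let $C_p$ be the cyclic group of order $p$, and let \[M_1=\langle \rho,\sigma,\tau \mid \rho^p=\sigma^p=\tau^p=1,\ \sigma\rho=\rho\sigma,\ \tau\rho=\rho\tau,\ \tau\sigma=\rho\sigma\tau\rangle\] be the Heisenberg group of order $p^3$. A skew brace $(B,\oplus,\odot)$ is a set with two group structures such that $a\odot(b\oplus c)=(a\odot b)\ominus a\oplus(a\odot c)$ for all $a,b,c$; it is a $G$-skew brace of type $N$ if $(B,\odot)\cong G$ and $(B,\oplus)\cong N$. Isomorphisms of skew braces are the bijections that respect both operations, and $\mathrm{Aut}_{\mathcal{B}r}(B)$ is the group of automorphisms. Write $|\Theta(B)|$ for the number of distinct maps $\lambda_a\in\mathrm{Aut}(B,\oplus)$, $\lambda_a(b)=\ominus a\oplus(a\odot b)$, $a\in B$. For a group $N$ let $\mathrm{Hol}(N)=N\rtimes\mathrm{Aut}(N)$ act on $N$ by $(\eta\alpha)(x)=\eta\,\alpha(x)$. A subgroup $H$ of $\mathrm{Hol}(N)$ which acts regularly on $N$ is regarded as a skew brace of type $N$ with $(H,\odot)=H$ and with $\oplus$ transported from $N$ along $H\to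 N$, $g\mapsto g(1)$; along this bijection $\mathrm{Aut}_{\mathcal{B}r}(H)$ is identified with a subgroup of $\mathrm{Aut}(N)$. Let $\alpha_1,\alpha_2,\alpha_3\in\mathrm{Aut}(M_1)$ be given by $\alpha_1:\sigma\mapsto\rho\sigma,\ \tau\mapsto\tau$; $\alpha_2:\sigma\mapsto\sigma\tau,\ \tau\mapsto\tau$; $\alpha_3:\sigma\mapsto\sigma,\ \tau\mapsto\rho\tau$. A matrix $\begin{pmatrix}a&b\\c&d\end{pmatrix}\in\mathrm{GL}_2(\mathbb{F}_p)$ also denotes the automorphism $\sigma\mapsto\rho^{ac/2}\sigma^{a}\tau^{c}$, $\tau\mapsto\rho^{bd/2}\sigma^{b}\tau^{d}$ of $M_1$. Automorphisms are composed as maps acting on the left. (1) Up to isomorphism there are exactly $2(p-1)$ $M_1$-skew braces $B$ of type $M_1$ with $|\Theta(B)|=p$, and exactly two $C_p^3$-skew braces $B$ of type $M_1$ with $|\Theta(B)|=p$. (2) For all integers $a,b,c\ge 0$ the subgroup $\langle\rho,\tau,\sigma\alpha_1^a\alpha_2^b\alpha_3^c\rangle$ of $\mathrm{Hol}(M_1)$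 is regular. Every skew brace $B$ of type $M_1$ with $|\Theta(B)|=p$ is isomorphic to exactly one of \[\langle\rho,\tau,\sigma\alpha_3\rangle,\ \langle\rho,\tau,\sigma\alpha_2\alpha_3\rangle\ (\cong C_p^3);\] \[\langle\rho,\tau,\sigma\alpha_1\rangle,\ \langle\rho,\tau,\sigma\alpha_2\rangle,\ \langle\rho,\tau,\sigma\alpha_3^c\rangle,\ \langle\rho,\tau,\sigma\alpha_2\alpha_3^c\rangle\ (\cong M_1),\quad c=2,\dots,p-1,\] all of which are skew braces of type $M_1$ with $|\Theta|=p$ and with multiplicative group as indicated. (3) As subgroups of $\mathrm{Aut}(M_1)$, with the parameters $r_1,r_3,b_1,b_3,b_4$ ranging over the elements of $\mathbb{F}_p$ for which the matrix is invertible, \[\mathrm{Aut}_{\mathcal{B}r}(\langle\rho,\tau,\sigma\alpha_1\rangle)=\Big\{\alpha_1^{r_1}\alpha_3^{r_3}\begin{pmatrix}b_1&0\\b_3&b_1\end{pmatrix}\Big\},\qquad \mathrm{Aut}_{\mathcal{B}r}(\langle\rho,\tau,\sigma\alpha_2\rangle)=\Big\{\alpha_1^{r_1}\alpha_3^{\frac12(b_1-1)}\begin{pmatrix}b_1&0\\b_3&b_1^2\end{pmatrix}\Big\},\]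 and, for $c=1,\dots,p-1$, \[\mathrm{Aut}_{\mathcal{B}r}(\langle\rho,\tau,\sigma\alpha_3^c\rangle)=\Big\{\alpha_1^{r_1}\alpha_3^{r_3}\begin{pmatrix}b_1&0\\0&b_4\end{pmatrix}\Big\},\qquad \mathrm{Aut}_{\mathcal{B}r}(\langle\rho,\tau,\sigma\alpha_2\alpha_3^c\rangle)=\Big\{\alpha_1^{r_1}\alpha_3^{cb_1^{-1}b_3+\frac12(b_1-1)(c+1)}\begin{pmatrix}b_1&0\\b_3&b_1^2\end{pmatrix}\Big\}.\] (4) Let $L/K$ be a finite Galois extension of fields with Galois group $G$. A Hopf-Galois structure on $L/K$ is a finite-dimensional cocommutative $K$-Hopf algebra $H$ with an action on $L$ which makes $L$ an $H$-module algebra and for which $j:L\otimes_K H\to\mathrm{End}_K(L)$, $j(x\otimes h)(z)=x\,h(z)$, is bijective; such structures are counted up to isomorphisms of Hopf algebras that respect the actions. It is of type $M_1$ if it is of the form $L[N]^G$ with $N\cong M_1$, where $N$ is a regular subgroup of $\mathrm{Perm}(G)$ normalised by the left translations, $G$ acts on $L$ by automorphisms and on $N$ by conjugation with left translations, and $\sum_{n}c_n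 n\in L[N]^G$ acts on $L$ by $x\mapsto\sum_n c_n\,(n^{-1}(1_G))(x)$. Its skew brace is $B=G$ with $(B,\odot)=G$ and with $\oplus$ transported from $N$ along $n\mapsto n(1_G)$. If $G\cong M_1$, then there are exactly \[(p^3-p^2-1)(p+1)\] Hopf-Galois structures on $L/K$ of type $M_1$ with $|\Theta(B)|=p$. If $G\cong C_p^3$, then there are exactly \[(p^3-1)(p+1)p^2\] Hopf-Galois structures on $L/K$ of type $M_1$ with $|\Theta(B)|=p$. -/

import Mathlib

open scoped TensorProduct

universe u v w

/-! ### Skew braces -/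

/-- A skew (left) brace: a set with two group structures, here written `+` (not assumed
commutative) and `*`, such that `a * (b + c) = a * b - a + a * c`. -/
class SkewBrace (B : Type u) extends AddGroup B, Group B where
  brace_property : ∀ a b c : B, a * (b + c) = a * b + -a + a * c

namespace SkewBrace

variable {B : Type u} [SkewBrace B]

theorem mul_zero_eq (a : B) : a * (0 : B) = a := by
  have h := brace_property a 0 0
  rw [add_zero, add_assoc] at h
  have h2 : -a + a * 0 = 0 := left_eq_add.mp h
  exact (neg_add_eq_zero.mp h2).symm

theorem mul_neg_eq (a b : B) : a * (-b) = a + -(a * b) + a := by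
  have h := brace_property a b (-b)
  rw [add_neg_cancel, mul_zero_eq] at h
  have h2 : a * (-b) = -(a * b + -a) + a :=
    (neg_add_eq_iff_eq_add.mpr h).symm
  rw [h2, neg_add_rev, neg_neg]

theorem lam_mul_aux (a b c : B) :
    -(a * b) + a * b * c = -a + a * (-b + b * c) := by
  rw [brace_property, mul_neg_eq, mul_assoc]
  simp [add_assoc]

theorem lam_one_aux (c : B) : -(1 : B) + 1 * c = c := by
  have h := mul_zero_eq (1 : B)
  rw [one_mul] at h
  rw [one_mul, ← h, neg_zero, zero_add]

/-- `lam a b = -a + a * b`, an automorphism of the additive group. -/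
def lam (a : B) : B ≃+ B where
  toFun b := -a + a * b
  invFun b := -a⁻¹ + a⁻¹ * b
  left_inv b := by
    change -a⁻¹ + a⁻¹ * (-a + a * b) = b
    rw [← lam_mul_aux, inv_mul_cancel, lam_one_aux]
  right_inv b := by
    change -a + a * (-a⁻¹ + a⁻¹ * b) = b
    rw [← lam_mul_aux, mul_inv_cancel, lam_one_aux]
  map_add' b c := by
    rw [brace_property]
    simp [add_assoc]

variable (B) in
/-- The size of the image of the multiplicative group in the automorphism group of the additive
group, that is of the image under the projection `Θ : Hol(B,+) → Aut(B,+)` of the group of maps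
`b ↦ a * b`. -/
noncomputable def thetaCard : ℕ := Nat.card (Set.range (lam : B → (B ≃+ B)))

end SkewBrace

/-- Isomorphisms of skew braces: bijections that are homomorphisms for both group structures. -/
structure SkewBraceIso (B : Type u) (C : Type v) [SkewBrace B] [SkewBrace C] extends
    B ≃ C where
  map_add' : ∀ x y, toFun (x + y) = toFun x + toFun y
  map_mul' : ∀ x y, toFun (x * y) = toFun x * toFun y

namespace SkewBraceIso

variable {B C D : Type*} [SkewBrace B] [SkewBrace C] [SkewBrace D]

theorem toEquiv_injective :
    Function.Injective (SkewBraceIso.toEquiv : SkewBraceIso B C → (B ≃ C)) := by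
  rintro ⟨f, _, _⟩ ⟨g, _, _⟩ h
  cases h
  rfl

variable (B) in
/-- The identity isomorphism. -/
def refl : SkewBraceIso B B where
  toEquiv := Equiv.refl B
  map_add' _ _ := rfl
  map_mul' _ _ := rfl

/-- The inverse isomorphism. -/
def symm (f : SkewBraceIso B C) : SkewBraceIso C B where
  toEquiv := f.toEquiv.symm
  map_add' x y := f.toEquiv.injective (by
    have h := f.map_add' (f.toEquiv.symm x) (f.toEquiv.symm y)
    simpa using h.symm)
  map_mul' x y := f.toEquiv.injective (by
    have h := f.map_mul' (f.toEquiv.symm x) (f.toEquiv.symm y)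
    simpa using h.symm)

/-- Composition of isomorphisms: first `f`, then `g`. -/
def trans (f : SkewBraceIso B C) (g : SkewBraceIso C D) : SkewBraceIso B D where
  toEquiv := f.toEquiv.trans g.toEquiv
  map_add' x y := by
    have h1 := f.map_add' x y
    have h2 := g.map_add' (f.toEquiv x) (f.toEquiv y)
    exact (congrArg g.toEquiv h1).trans h2
  map_mul' x y := by
    have h1 := f.map_mul' x y
    have h2 := g.map_mul' (f.toEquiv x) (f.toEquiv y)
    exact (congrArg g.toEquiv h1).trans h2

/-- The automorphism group of a skew brace; the product is composition of maps. -/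
instance : Group (SkewBraceIso B B) where
  mul f g := g.trans f
  one := refl B
  inv f := f.symm
  mul_assoc _ _ _ := rfl
  one_mul _ := rfl
  mul_one _ := rfl
  inv_mul_cancel f := toEquiv_injective (Equiv.self_trans_symm f.toEquiv)

end SkewBraceIso

/-- A skew brace together with its underlying type. -/
structure BundledSkewBrace : Type (w + 1) where
  carrier : Type w
  [inst : SkewBrace carrier]

attribute [instance] BundledSkewBrace.inst

/-- The relation of being isomorphic skew braces. -/
instance BundledSkewBrace.setoid : Setoid BundledSkewBrace.{w} where
  r B C := Nonempty (SkewBraceIso B.carrier C.carrier)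
  iseqv := ⟨fun B => ⟨SkewBraceIso.refl B.carrier⟩, fun ⟨f⟩ => ⟨f.symm⟩,
    fun ⟨f⟩ ⟨g⟩ => ⟨f.trans g⟩⟩

/-- A `G`-skew brace of type `N`: the multiplicative group is isomorphic to `G` and the additive
group is isomorphic to `N`. -/
def IsSkewBraceOfType (B : Type*) [SkewBrace B] (G N : Type*) [Group G] [Group N] : Prop :=
  Nonempty (B ≃* G) ∧ Nonempty (B ≃+ Additive N)

/-- The isomorphism classes of `G`-skew braces `B` of type `N` with `|Θ(B)| = r`. -/
def skewBraceClasses (G N : Type*) [Group G] [Group N] (r : ℕ) :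
    Set (Quotient BundledSkewBrace.setoid.{w}) :=
  {q | ∃ B : BundledSkewBrace.{w}, Quotient.mk _ B = q ∧
    IsSkewBraceOfType B.carrier G N ∧ SkewBrace.thetaCard B.carrier = r}

/-! ### The holomorph and the skew brace of a regular subgroup -/

/-- The holomorph `N ⋊ Aut N`. -/
abbrev Hol (N : Type*) [Group N] : Type _ := N ⋊[MonoidHom.id (MulAut N)] MulAut N

/-- The action of the holomorph on `N`: `ηα` sends `x` to `η α(x)`. -/
def Hol.act {N : Type*} [Group N] (g : Hol N) (x : N) : N := g.left * g.right x

/-- A subgroup of the holomorph is regular if it acts freely and transitively on `N`. -/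
def Hol.IsRegular {N : Type*} [Group N] (H : Subgroup (Hol N)) : Prop :=
  ∀ x y : N, ∃! g : Hol N, g ∈ H ∧ Hol.act g x = y

namespace Hol

variable {N : Type*} [Group N]

/-- For a regular subgroup `H` of the holomorph, the bijection `H → N`, `g ↦ g(1)`. -/
noncomputable def orbitEquiv (H : Subgroup (Hol N)) (hH : IsRegular H) : H ≃ N :=
  Equiv.ofBijective (fun g => Hol.act (g : Hol N) 1) (by
    refine ⟨fun g h hgh => ?_, fun y => ?_⟩
    · exact Subtype.ext ((hH 1 (Hol.act (g : Hol N) 1)).unique ⟨g.2, rfl⟩ ⟨h.2, hgh.symm⟩)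
    · obtain ⟨g, ⟨hg, hy⟩, _⟩ := hH 1 y
      exact ⟨⟨g, hg⟩, hy⟩)

/-- The carrier of the skew brace given by a regular subgroup `H`. -/
def Brace (H : Subgroup (Hol N)) (_hH : IsRegular H) : Type _ := H

/-- The map `g ↦ g(1)` on the skew brace given by `H`. -/
noncomputable def Brace.psi (H : Subgroup (Hol N)) (hH : IsRegular H) : Brace H hH ≃ N :=
  orbitEquiv H hH

/-- The skew brace given by a regular subgroup `H`: its multiplicative group is `H`, and its
addition is transported from `N` along `g ↦ g(1)`. -/
noncomputable instance (H : Subgroup (Hol N)) (hH : IsRegular H) : SkewBrace (Brace H hH) where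
  toAddGroup := ((Brace.psi H hH).trans (Additive.ofMul : N ≃ Additive N)).addGroup
  toGroup := inferInstanceAs (Group H)
  brace_property := fun (a b c : H) => by
    let ψ : H ≃ N := orbitEquiv H hH
    have hmul : ∀ g h : H, ψ (g * h) = ψ g * (g : Hol N).right (ψ h) := by
      intro g h
      simp [ψ, orbitEquiv, Hol.act]
    change a * ψ.symm (ψ b * ψ c) =
      ψ.symm (ψ (ψ.symm (ψ (a * b) * ψ (ψ.symm (ψ a)⁻¹))) * ψ (a * c))
    apply ψ.injective
    simp only [Equiv.apply_symm_apply, hmul, map_mul]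
    group

theorem Brace.psi_add (H : Subgroup (Hol N)) (hH : IsRegular H) (x y : Brace H hH) :
    Brace.psi H hH (x + y) = Brace.psi H hH x * Brace.psi H hH y :=
  (Brace.psi H hH).apply_symm_apply _

/-- The automorphism group of the skew brace given by `H`, identified with a group of
automorphisms of `N` along the isomorphism `g ↦ g(1)` from its additive group to `N`. -/
noncomputable def Brace.autHom (H : Subgroup (Hol N)) (hH : IsRegular H) :
    SkewBraceIso (Brace H hH) (Brace H hH) →* MulAut N where
  toFun f :=
    { toEquiv := ((Brace.psi H hH).symm.trans f.toEquiv).trans (Brace.psi H hH)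
      map_mul' := fun x y => by
        have h1 : (Brace.psi H hH).symm (x * y) =
            (Brace.psi H hH).symm x + (Brace.psi H hH).symm y := by
          apply (Brace.psi H hH).injective
          simp [Brace.psi_add]
        have h2 := f.map_add' ((Brace.psi H hH).symm x) ((Brace.psi H hH).symm y)
        change Brace.psi H hH (f.toEquiv ((Brace.psi H hH).symm (x * y))) = _
        rw [h1]
        exact (congrArg (Brace.psi H hH) h2).trans (Brace.psi_add H hH _ _) }
  map_one' := by
    ext x
    exact (Brace.psi H hH).apply_symm_apply x
  map_mul' f g := by
    ext x
    change Brace.psi H hH (f.toEquiv (g.toEquiv ((Brace.psi H hH).symm x))) =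
      Brace.psi H hH (f.toEquiv ((Brace.psi H hH).symm
        (Brace.psi H hH (g.toEquiv ((Brace.psi H hH).symm x)))))
    rw [Equiv.symm_apply_apply]

end Hol

/-! ### The Heisenberg group -/

/-- The Heisenberg group of order `p ^ 3`,
`⟨ρ, σ, τ | ρ^p = σ^p = τ^p = 1, σρ = ρσ, τρ = ρτ, τσ = ρστ⟩`.
The triple `⟨x, y, z⟩` stands for the normal form `ρ^x σ^y τ^z`. -/
@[ext]
structure Heis (p : ℕ) where
  x : ZMod p
  y : ZMod p
  z : ZMod p

namespace Heis

variable {p : ℕ}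

instance : Group (Heis p) where
  mul u v := ⟨u.x + v.x + u.z * v.y, u.y + v.y, u.z + v.z⟩
  one := ⟨0, 0, 0⟩
  inv u := ⟨-u.x + u.y * u.z, -u.y, -u.z⟩
  mul_assoc u v w := by
    apply Heis.ext
    · change u.x + v.x + u.z * v.y + w.x + (u.z + v.z) * w.y =
        u.x + (v.x + w.x + v.z * w.y) + u.z * (v.y + w.y)
      ring
    · exact add_assoc _ _ _
    · exact add_assoc _ _ _
  one_mul u := by
    apply Heis.ext
    · change 0 + u.x + 0 * u.y = u.x
      ring
    · exact zero_add _
    · exact zero_add _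
  mul_one u := by
    apply Heis.ext
    · change u.x + 0 + u.z * 0 = u.x
      ring
    · exact add_zero _
    · exact add_zero _
  inv_mul_cancel u := by
    apply Heis.ext
    · change -u.x + u.y * u.z + u.x + -u.z * u.y = 0
      ring
    · exact neg_add_cancel _
    · exact neg_add_cancel _

theorem mul_def (u v : Heis p) :
    u * v = ⟨u.x + v.x + u.z * v.y, u.y + v.y, u.z + v.z⟩ := rfl

theorem one_def : (1 : Heis p) = ⟨0, 0, 0⟩ := rfl

/-- The generator `ρ`. -/
def rho (p : ℕ) : Heis p := ⟨1, 0, 0⟩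
/-- The generator `σ`. -/
def sigma (p : ℕ) : Heis p := ⟨0, 1, 0⟩
/-- The generator `τ`. -/
def tau (p : ℕ) : Heis p := ⟨0, 0, 1⟩

theorem rho_pow (n : ℕ) : rho p ^ n = ⟨n, 0, 0⟩ := by
  induction n with
  | zero => simp [one_def]
  | succ k ih => rw [pow_succ, ih, mul_def]; simp [rho]

theorem sigma_pow (n : ℕ) : sigma p ^ n = ⟨0, n, 0⟩ := by
  induction n with
  | zero => simp [one_def]
  | succ k ih => rw [pow_succ, ih, mul_def]; simp [sigma]

theorem tau_pow (n : ℕ) : tau p ^ n = ⟨0, 0, n⟩ := by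
  induction n with
  | zero => simp [one_def]
  | succ k ih => rw [pow_succ, ih, mul_def]; simp [tau]

/-- The defining relations hold. -/
theorem relations : rho p ^ p = 1 ∧ sigma p ^ p = 1 ∧ tau p ^ p = 1 ∧
    sigma p * rho p = rho p * sigma p ∧ tau p * rho p = rho p * tau p ∧
    tau p * sigma p = rho p * sigma p * tau p := by
  rw [rho_pow, sigma_pow, tau_pow]
  simp [one_def, mul_def, rho, sigma, tau]

/-- Every element has a normal form in the generators. -/
theorem normal_form [NeZero p] (v : Heis p) :
    v = rho p ^ v.x.val * sigma p ^ v.y.val * tau p ^ v.z.val := by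
  simp [rho_pow, sigma_pow, tau_pow, mul_def]

instance [NeZero p] : Finite (Heis p) :=
  Finite.of_injective (fun v : Heis p => (v.x, v.y, v.z)) (by
    rintro ⟨a, b, c⟩ ⟨a', b', c'⟩ h
    simpa using h)

variable [Fact p.Prime]

theorem two_ne_zero_of_lt (hp : 3 < p) : (2 : ZMod p) ≠ 0 := by
  intro h
  have h2 : ((2 : ℕ) : ZMod p) = 0 := by exact_mod_cast h
  rw [ZMod.natCast_eq_zero_iff] at h2
  have := Nat.le_of_dvd (by norm_num) h2
  omega

/-- The endomorphism with `σ ↦ ρ^b₁ σ^a₁ τ^a₃`, `τ ↦ ρ^b₂ σ^a₂ τ^a₄`, where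
`A = (a₁ a₂; a₃ a₄)`, written in normal forms. -/
def bracketHom (hp : 3 < p) (A : Matrix (Fin 2) (Fin 2) (ZMod p)) (b₁ b₂ : ZMod p) :
    Heis p →* Heis p where
  toFun v :=
    ⟨A.det * v.x + b₁ * v.y + 2⁻¹ * A 0 0 * A 1 0 * (v.y * (v.y - 1))
        + b₂ * v.z + 2⁻¹ * A 0 1 * A 1 1 * (v.z * (v.z - 1)) + A 0 1 * A 1 0 * (v.y * v.z),
      A 0 0 * v.y + A 0 1 * v.z,
      A 1 0 * v.y + A 1 1 * v.z⟩
  map_one' := by simp [one_def]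
  map_mul' u v := by
    have h2 := two_ne_zero_of_lt hp
    simp only [mul_def, Matrix.det_fin_two]
    ext
    · simp only
      field_simp
      ring
    · simp only
      ring
    · simp only
      ring

/-- The automorphism `[det A, b₁, b₂; 0, A]` of the Heisenberg group: the one with
`ρ ↦ ρ^(det A)`, `σ ↦ ρ^b₁ σ^a₁ τ^a₃`, `τ ↦ ρ^b₂ σ^a₂ τ^a₄` for `A = (a₁ a₂; a₃ a₄)`. -/
noncomputable def bracket (hp : 3 < p) (A : GL (Fin 2) (ZMod p)) (b₁ b₂ : ZMod p) :
    MulAut (Heis p) :=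
  MulEquiv.ofBijective (bracketHom hp A.val b₁ b₂) (by
    apply Function.Injective.bijective_of_finite
    rw [injective_iff_map_eq_one]
    intro v hv
    have hdet : A.val.det ≠ 0 := ((Matrix.isUnit_iff_isUnit_det _).mp A.isUnit).ne_zero
    simp only [bracketHom, MonoidHom.coe_mk, OneHom.coe_mk, one_def, Heis.mk.injEq] at hv
    obtain ⟨h1, h2, h3⟩ := hv
    have hd := Matrix.det_fin_two A.val
    have hy : v.y = 0 := by
      have : A.val.det * v.y = 0 := by
        rw [hd]
        linear_combination A.val 1 1 * h2 - A.val 0 1 * h3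
      exact (mul_eq_zero.mp this).resolve_left hdet
    have hz : v.z = 0 := by
      have : A.val.det * v.z = 0 := by
        rw [hd]
        linear_combination A.val 0 0 * h3 - A.val 1 0 * h2
      exact (mul_eq_zero.mp this).resolve_left hdet
    have hx : v.x = 0 := by
      rw [hy, hz] at h1
      have : A.val.det * v.x = 0 := by simpa using h1
      exact (mul_eq_zero.mp this).resolve_left hdet
    rw [one_def]
    ext <;> assumption)

theorem bracket_rho (hp : 3 < p) (A : GL (Fin 2) (ZMod p)) (b₁ b₂ : ZMod p) :
    bracket hp A b₁ b₂ (rho p) = ⟨A.val.det, 0, 0⟩ := by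
  simp [bracket, bracketHom, rho]

theorem bracket_sigma (hp : 3 < p) (A : GL (Fin 2) (ZMod p)) (b₁ b₂ : ZMod p) :
    bracket hp A b₁ b₂ (sigma p) = ⟨b₁, A.val 0 0, A.val 1 0⟩ := by
  simp [bracket, bracketHom, sigma]

theorem bracket_tau (hp : 3 < p) (A : GL (Fin 2) (ZMod p)) (b₁ b₂ : ZMod p) :
    bracket hp A b₁ b₂ (tau p) = ⟨b₂, A.val 0 1, A.val 1 1⟩ := by
  simp [bracket, bracketHom, tau]

/-- `α₁ : σ ↦ ρσ, τ ↦ τ`. -/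
noncomputable def alpha1 (hp : 3 < p) : MulAut (Heis p) := bracket hp 1 1 0

/-- `α₂ : σ ↦ στ, τ ↦ τ`. -/
noncomputable def alpha2 (hp : 3 < p) : MulAut (Heis p) :=
  bracket hp (Matrix.GeneralLinearGroup.mkOfDetNeZero !![1, 0; 1, 1] (by simp)) 0 0

/-- `α₃ : σ ↦ σ, τ ↦ ρτ`. -/
noncomputable def alpha3 (hp : 3 < p) : MulAut (Heis p) := bracket hp 1 0 1

/-- The automorphism corresponding to `A = (a b; c d)` in `GL₂`, namely
`[det A, ac/2, bd/2; 0, A]`. -/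
noncomputable def alphaGL (hp : 3 < p) (A : GL (Fin 2) (ZMod p)) : MulAut (Heis p) :=
  bracket hp A (A.val 0 0 * A.val 1 0 / 2) (A.val 0 1 * A.val 1 1 / 2)

/-- The subgroup `⟨ρ, τ, σ α₁^a α₂^b α₃^c⟩` of the holomorph of the Heisenberg group. -/
noncomputable def holSubgroup (hp : 3 < p) (i : ℕ × ℕ × ℕ) : Subgroup (Hol (Heis p)) :=
  Subgroup.closure {SemidirectProduct.inl (rho p), SemidirectProduct.inl (tau p),
    SemidirectProduct.inl (sigma p) *
      SemidirectProduct.inr (alpha1 hp ^ i.1 * alpha2 hp ^ i.2.1 * alpha3 hp ^ i.2.2)}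

end Heis

/-- The exponents `(a, b, c)` of the representatives `⟨ρ, τ, σα₃⟩`, `⟨ρ, τ, σα₂α₃⟩`. -/
def exponentsC : Set (ℕ × ℕ × ℕ) := {(0, 0, 1), (0, 1, 1)}

/-- The exponents `(a, b, c)` of the representatives `⟨ρ, τ, σα₁⟩`, `⟨ρ, τ, σα₂⟩` and
`⟨ρ, τ, σα₃^c⟩`, `⟨ρ, τ, σα₂α₃^c⟩` for `c = 2, …, p - 1`. -/
def exponentsM (p : ℕ) : Set (ℕ × ℕ × ℕ) :=
  {i | i = (1, 0, 0) ∨ i = (0, 1, 0) ∨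
    ∃ c : ℕ, 2 ≤ c ∧ c < p ∧ (i = (0, 0, c) ∨ i = (0, 1, c))}

/-- The elementary abelian group of order `p ^ 3`, in multiplicative notation. -/
abbrev ElemAb (p : ℕ) : Type := Multiplicative (Fin 3 → ZMod p)

/-! ### Hopf-Galois structures -/

/-- A Hopf-Galois structure on `L / K`: a finite-dimensional cocommutative `K`-Hopf algebra `H`
acting on `L` such that `L` is an `H`-module algebra and
`j : L ⊗ H → End_K(L)`, `j (x ⊗ h) (z) = x (h z)`, is bijective. -/
structure HopfGaloisStructure (K : Type u) (L : Type v) [Field K] [Field L] [Algebra K L] :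
    Type (max u (v + 1)) where
  H : Type v
  [ring : Ring H]
  [hopf : HopfAlgebra K H]
  [cocomm : Coalgebra.IsCocomm K H]
  [finite : Module.Finite K H]
  act : H →ₐ[K] Module.End K L
  act_mul : ∀ (h : H) (x y : L), act h (x * y) =
    LinearMap.mul' K L (TensorProduct.map (act.toLinearMap.flip x) (act.toLinearMap.flip y)
      (Coalgebra.comul (R := K) h))
  act_one : ∀ h : H, act h 1 = algebraMap K L (Coalgebra.counit (R := K) h)
  galois : Function.Bijective
    (LinearMap.mul' K (Module.End K L) ∘ₗ
      TensorProduct.map (Algebra.lmul K L).toLinearMap act.toLinearMap :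
        L ⊗[K] H →ₗ[K] Module.End K L)

attribute [instance] HopfGaloisStructure.ring HopfGaloisStructure.hopf
  HopfGaloisStructure.cocomm HopfGaloisStructure.finite

namespace HopfGaloisStructure

variable {K : Type u} {L : Type v} [Field K] [Field L] [Algebra K L]

/-- Two Hopf-Galois structures are the same if there is an isomorphism of Hopf algebras between
them which respects the actions on `L`. (A bialgebra isomorphism respects the antipodes.) -/
instance setoid : Setoid (HopfGaloisStructure K L) where
  r S T := ∃ e : S.H ≃ₐc[K] T.H, ∀ (h : S.H) (x : L), T.act (e h) x = S.act h x
  iseqv := by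
    refine ⟨fun S => ⟨BialgEquiv.refl K S.H, fun _ _ => rfl⟩, ?_, ?_⟩
    · rintro S T ⟨e, he⟩
      refine ⟨e.symm, fun h x => ?_⟩
      have h1 := he (e.symm h) x
      rw [← h1, BialgEquiv.apply_symm_apply]
    · rintro S T U ⟨e, he⟩ ⟨f, hf⟩
      exact ⟨e.trans f, fun h x => (hf (e h) x).trans (he h x)⟩

end HopfGaloisStructure

/-- A subgroup of `Perm X` is regular if it acts freely and transitively on `X`. -/
def IsRegularPerm {X : Type*} (N : Subgroup (Equiv.Perm X)) : Prop :=
  ∀ x y : X, ∃! n : Equiv.Perm X, n ∈ N ∧ n x = y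

/-- `N` is normalised by the left translations of `G`. -/
def IsNormalisedByLeft {G : Type*} [Group G] (N : Subgroup (Equiv.Perm G)) : Prop :=
  ∀ (g : G), ∀ n ∈ N, Equiv.mulLeft g * n * (Equiv.mulLeft g)⁻¹ ∈ N

/-- The Hopf-Galois structure `S` on `L / K`, with `G = Gal(L / K)`, is `L[N]^G`: the Hopf algebra
of `S` is isomorphic, through `ι`, to the `K`-Hopf algebra of the elements of the group algebra
`L[N]` fixed by `G`, where `G` acts on `L` by field automorphisms and on `N` by conjugation with
left translations, and `∑ c_n n` acts on `L` by `x ↦ ∑ c_n (n⁻¹(1))(x)`. -/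
def HopfGaloisStructure.IsFixedAlgebra {K : Type u} {L : Type v} [Field K] [Field L]
    [Algebra K L] (S : HopfGaloisStructure K L) (N : Subgroup (Equiv.Perm (L ≃ₐ[K] L))) : Prop :=
  ∃ ι : S.H →ₐ[K] MonoidAlgebra L N,
    Function.Injective ι ∧
    (∀ f : MonoidAlgebra L N, f ∈ Set.range ι ↔
      ∀ (g : L ≃ₐ[K] L) (n n' : N),
        (n' : Equiv.Perm (L ≃ₐ[K] L)) = Equiv.mulLeft g * n * (Equiv.mulLeft g)⁻¹ →
          f.coeff n' = g (f.coeff n)) ∧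
    (∀ h : S.H, Coalgebra.comul (R := L) (ι h) =
      TensorProduct.mapOfCompatibleSMul L K K (MonoidAlgebra L N) (MonoidAlgebra L N)
        (TensorProduct.map ι.toLinearMap ι.toLinearMap (Coalgebra.comul (R := K) h))) ∧
    (∀ h : S.H, Coalgebra.counit (R := L) (ι h) =
      algebraMap K L (Coalgebra.counit (R := K) h)) ∧
    (∀ (h : S.H) (x : L), S.act h x =
      (ι h).coeff.sum fun n c => c * ((n : Equiv.Perm (L ≃ₐ[K] L))⁻¹ 1) x)

namespace PermBrace

variable {G : Type*} [Group G]

/-- For a regular subgroup `N` of `Perm G`, the bijection `N → G`, `n ↦ n(1)`. -/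
noncomputable def orbitEquiv (N : Subgroup (Equiv.Perm G)) (hN : IsRegularPerm N) : N ≃ G :=
  Equiv.ofBijective (fun n => (n : Equiv.Perm G) 1) (by
    refine ⟨fun n m hnm => ?_, fun y => ?_⟩
    · exact Subtype.ext ((hN 1 ((n : Equiv.Perm G) 1)).unique ⟨n.2, rfl⟩ ⟨m.2, hnm.symm⟩)
    · obtain ⟨n, ⟨hn, hy⟩, _⟩ := hN 1 y
      exact ⟨⟨n, hn⟩, hy⟩)

/-- The carrier of the skew brace given by a regular subgroup `N` of `Perm G` which is normalised
by the left translations. -/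
def Carrier (N : Subgroup (Equiv.Perm G)) (_hN : IsRegularPerm N)
    (_hl : IsNormalisedByLeft N) : Type _ := G

/-- The skew brace given by a regular subgroup `N` of `Perm G` which is normalised by the left
translations: its multiplicative group is `G`, and its addition is transported from `N` along the
bijection `n ↦ n(1)`. -/
noncomputable instance (N : Subgroup (Equiv.Perm G)) (hN : IsRegularPerm N)
    (hl : IsNormalisedByLeft N) : SkewBrace (Carrier N hN hl) where
  toAddGroup := ((orbitEquiv N hN).symm.trans (Additive.ofMul : N ≃ Additive N)).addGroup
  toGroup := inferInstanceAs (Group G)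
  brace_property := fun (a b c : G) => by
    let φ : N ≃ G := orbitEquiv N hN
    have hφ : ∀ n : N, φ n = (n : Equiv.Perm G) 1 := fun n => rfl
    have hs : ∀ g : G, ((φ.symm g : N) : Equiv.Perm G) 1 = g := fun g => φ.apply_symm_apply g
    change a * φ (φ.symm b * φ.symm c) =
      φ (φ.symm (φ (φ.symm (a * b) * φ.symm (φ (φ.symm a)⁻¹))) * φ.symm (a * c))
    simp only [Equiv.symm_apply_apply]
    let m : N := ⟨_, hl a _ (φ.symm b).2⟩
    have hm : ∀ x : G, (m : Equiv.Perm G) (a * x) = a * ((φ.symm b : N) : Equiv.Perm G) x := by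
      intro x
      simp [m, Equiv.Perm.mul_apply]
    have hm2 : m * φ.symm a = φ.symm (a * b) := by
      apply φ.injective
      have h1 := hm 1
      rw [mul_one, hs b] at h1
      rw [φ.apply_symm_apply, hφ]
      change (m : Equiv.Perm G) (((φ.symm a : N) : Equiv.Perm G) 1) = _
      rw [hs a]
      exact h1
    rw [← hm2, mul_inv_cancel_right]
    change a * ((φ.symm b : N) : Equiv.Perm G) (((φ.symm c : N) : Equiv.Perm G) 1) =
      (m : Equiv.Perm G) (((φ.symm (a * c) : N) : Equiv.Perm G) 1)
    rw [hs, hs, hm]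

end PermBrace

/-- The Hopf-Galois structures on `L / K` (up to isomorphism) which are of type `M` and whose
skew brace `B` has `|Θ(B)| = r`. -/
def hopfGaloisClasses (K : Type u) (L : Type v) [Field K] [Field L] [Algebra K L]
    (M : Type*) [Group M] (r : ℕ) : Set (Quotient (HopfGaloisStructure.setoid (K := K) (L := L))) :=
  {q | ∃ S : HopfGaloisStructure K L, Quotient.mk _ S = q ∧
    ∃ (N : Subgroup (Equiv.Perm (L ≃ₐ[K] L))) (hN : IsRegularPerm N) (hl : IsNormalisedByLeft N),
      S.IsFixedAlgebra N ∧ Nonempty (N ≃* M) ∧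
        SkewBrace.thetaCard (PermBrace.Carrier N hN hl) = r}

/-! Skew braces. A skew brace on the additive group `Heis p` amounts to its function `λ`, which
satisfies the gamma identity `γ(u · γ_u(v)) = γ_u γ_v`. The elements with trivial `λ` form an
additive subgroup whose index is the number of distinct `λ_a` (`index_gammaKer`). If this index is
`p`, an automorphism moves the subgroup to `⟨ρ, τ⟩` (`exists_aut_of_index_eq`). Then `λ_a` depends
only on the exponent `k` of `σ` in `a`, and it is the `k`-th power of one automorphism `σ ↦ ρ^r σ
τ^t`, `τ ↦ ρ^s τ`. So such a skew brace is described by a nonzero triple `P = (t, r, s)`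
(`exists_chart`). The subgroup `⟨ρ, τ, σα₁^aα₂^bα₃^c⟩` is the graph of these powers for the triple
`(b, a, c)` (`holSubgroup_eq`).

Isomorphisms between the skew braces with triples `P` and `Q` are the automorphisms of `Heis p`
which intertwine the two families of powers. For an automorphism written out in coordinates this is
a system of four polynomial equations (`intertwines_bracket_iff`). They show that `s` and the
vanishing of `t` are invariants, that a nonzero `t` can be scaled to `1`, and that `r` can be
removed unless `t = s = 0`, in which case it can be scaled to `1`. This is the list of
representatives (`eq_of_intertwines`, `exists_intertwines`). For `P = Q` the same equations describe
the automorphism groups and give their orders. In suitable polynomial coordinates of degree at most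
three the multiplication is bilinear up to addition, with cocycle `(1 - s) z y` (`straightX_circ`).
So the multiplicative group is elementary abelian for `s = 1` and a Heisenberg group otherwise. The
change of coordinates divides by `6`, which is possible because `p > 3`.

Hopf-Galois structures. Those considered here correspond bijectively to the regular groups `N`
normalised by the left translations (`ncard_hopfGaloisClasses`). This is Galois descent: the
equivariant functions `X → L` form a `K`-form of the space of all functions
(`linearIndependent_of_fixed`, `span_fixed`), so the Hopf structure of `L[N]` descends, and an
identity known for fixed elements extends to all of `L[N]`. Finally, the groups `N` with skew brace
isomorphic to `B` number `|Aut G| / |Aut B|` (`card_permGroups_mul`), and summing over the list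
gives both counts. -/

set_option linter.unusedSectionVars false
set_option linter.unusedSimpArgs false

/-! ### Galois descent for functions on a finite set with an action of the Galois group -/

namespace GaloisDescent

/-! ### Equivariant functions as a `K`-form of all functions. -/

section Fixed

variable {K : Type u} {L : Type v} [Field K] [Field L] [Algebra K L]
  {X Y : Type*} (σ : (L ≃ₐ[K] L) →* Equiv.Perm X)

/-- The equivariant functions from `X` to `L`. -/
def fixed : Submodule K (X → L) where
  carrier := {f | ∀ g x, f (σ g x) = g (f x)}
  add_mem' hf hh g x := by simp [hf g x, hh g x]
  zero_mem' g x := by simp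
  smul_mem' c f hf g x := by simp [hf g x]

variable {σ}

theorem mem_fixed {f : X → L} : f ∈ fixed σ ↔ ∀ g x, f (σ g x) = g (f x) := Iff.rfl

theorem fixed_apply_inv {f : X → L} (hf : f ∈ fixed σ) (g : L ≃ₐ[K] L) (x : X) :
    g (f (σ g⁻¹ x)) = f x := by
  rw [hf g⁻¹ x]
  exact g.apply_symm_apply _

variable [FiniteDimensional K L] [IsGalois K L]

/-- Equivariant functions which are linearly independent over `K` are so over `L`. -/
theorem linearIndependent_of_fixed {ι : Type*} {v : ι → X → L} (hv : ∀ i, v i ∈ fixed σ)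
    (h : LinearIndependent K v) : LinearIndependent L v := by
  rw [linearIndependent_iff'] at h ⊢
  intro s c hc i hi
  -- Apply each `g` to `z` times the relation, evaluated at `g⁻¹x`: equivariance turns it into `∑
  -- g(z c_j) v_j(x) = 0`. The sum over `g` is a relation over `K` with coefficients `Tr(z c_j)`,
  -- which must vanish. Nondegeneracy of the trace form then gives `c_i = 0`.
  have key : ∀ z : L, Algebra.trace K L (z * c i) = 0 := by
    intro z
    refine h s (fun i => Algebra.trace K L (z * c i)) ?_ i hi
    funext x
    have h1 : ∀ g : L ≃ₐ[K] L, ∑ j ∈ s, g (z * c j) * v j x = 0 := by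
      intro g
      have h2 := congrFun hc (σ g⁻¹ x)
      have h3 := congrArg (fun y => g (z * y)) h2
      simp only [Finset.sum_apply, Pi.smul_apply, smul_eq_mul, Finset.mul_sum, map_sum,
        Pi.zero_apply, mul_zero, map_zero] at h3
      rw [← h3]
      refine Finset.sum_congr rfl fun j _ => ?_
      rw [← mul_assoc, map_mul g (z * c j), fixed_apply_inv (hv j)]
    simp only [Finset.sum_apply, Pi.smul_apply, Pi.zero_apply]
    simp only [Algebra.smul_def, trace_eq_sum_automorphisms, Finset.sum_mul]
    rw [Finset.sum_comm]
    exact Finset.sum_eq_zero fun g _ => h1 g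
  have hnd := (traceForm_nondegenerate K L).2
  refine hnd (c i) fun z => ?_
  simpa [Algebra.traceForm_apply] using key z

/-- The equivariant functions span the space of all functions. -/
theorem span_fixed [Finite X] (σ : (L ≃ₐ[K] L) →* Equiv.Perm X) :
    Submodule.span L (fixed σ : Set (X → L)) = ⊤ := by
  by_contra hne
  obtain ⟨φ, hφ, hle⟩ := Submodule.exists_le_ker_of_lt_top _ (lt_top_iff_ne_top.mpr hne)
  refine hφ (LinearMap.ext fun f => ?_)
  have hD := linearIndependent_toLinearMap K L L
  rw [Fintype.linearIndependent_iff] at hD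
  -- The value of `φ` at the `g`-translate of `f`. Dedekind's theorem will make all these values
  -- vanish, and the one at the identity is `φ f`.
  let a : (L →ₐ[K] L) → L := fun g =>
    φ (fun x => AlgEquiv.ofBijective g (Algebra.IsAlgebraic.algHom_bijective g)
      (f (σ (AlgEquiv.ofBijective g (Algebra.IsAlgebraic.algHom_bijective g))⁻¹ x)))
  have h0 := hD a ?_ (AlgHom.id K L)
  · have h1 : AlgEquiv.ofBijective (AlgHom.id K L)
        (Algebra.IsAlgebraic.algHom_bijective (AlgHom.id K L)) = 1 := by
      ext; rfl
    simp only [a, h1, inv_one, map_one, Equiv.Perm.coe_one, id_eq, AlgEquiv.one_apply] at h0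
    simpa using h0
  · ext z
    -- For every `z` this twisted trace of `f` is equivariant, hence killed by `φ`. As `z` varies
    -- this is a linear relation between the automorphisms.
    have hmem : (fun x => ∑ g : L ≃ₐ[K] L, g z * g (f (σ g⁻¹ x))) ∈ fixed σ := by
      intro g x
      rw [map_sum]
      refine (Fintype.sum_equiv (Equiv.mulLeft g) _ _ fun t => ?_).symm
      simp only [Equiv.coe_mulLeft, mul_inv_rev, map_mul, AlgEquiv.mul_apply,
        Equiv.Perm.mul_apply]
      rw [← Equiv.Perm.mul_apply (σ g⁻¹), ← map_mul σ, inv_mul_cancel, map_one]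
      rfl
    have h2 : φ (fun x => ∑ g : L ≃ₐ[K] L, g z * g (f (σ g⁻¹ x))) = 0 :=
      hle (Submodule.subset_span hmem)
    have h3 : (fun x => ∑ g : L ≃ₐ[K] L, g z * g (f (σ g⁻¹ x))) =
        ∑ g : L ≃ₐ[K] L, g z • (fun x => g (f (σ g⁻¹ x))) := by
      funext x
      simp
    rw [h3, map_sum] at h2
    rw [LinearMap.sum_apply, LinearMap.zero_apply, ← h2]
    refine Fintype.sum_equiv (algEquivEquivAlgHom K L).symm _ _ fun g => ?_
    simp only [LinearMap.smul_apply, AlgHom.toLinearMap_apply, smul_eq_mul, map_smul]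
    rw [mul_comm]
    rfl

/-- A `K`-basis of the equivariant functions remains independent over `L` and spans, so it is an
`L`-basis of `X → L`. -/
theorem finrank_fixed [Finite X] (σ : (L ≃ₐ[K] L) →* Equiv.Perm X) :
    Module.finrank K (fixed σ) = Nat.card X := by
  have := Fintype.ofFinite X
  let b := Module.finBasis K (fixed σ)
  have hli : LinearIndependent L (fun i => (b i : X → L)) :=
    linearIndependent_of_fixed (fun i => (b i).2)
      (b.linearIndependent.map' (fixed σ).subtype (Submodule.ker_subtype _))
  have hsp : ⊤ ≤ Submodule.span L (Set.range fun i => (b i : X → L)) := by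
    rw [← span_fixed σ, Submodule.span_le]
    intro f hf
    have h1 := b.sum_repr ⟨f, hf⟩
    have h2 : f = ∑ i, b.repr ⟨f, hf⟩ i • (b i : X → L) := by
      have := congrArg (fixed σ).subtype h1
      rw [map_sum] at this
      exact this.symm
    rw [h2]
    refine Submodule.sum_mem _ fun i _ => ?_
    rw [← algebraMap_smul L]
    exact Submodule.smul_mem _ _ (Submodule.subset_span ⟨i, rfl⟩)
  have h3 := Module.finrank_eq_card_basis (Module.Basis.mk hli hsp)
  rw [Module.finrank_fintype_fun_eq_card, Fintype.card_fin] at h3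
  rw [← h3, Nat.card_eq_fintype_card]

end Fixed

/-! ### Tensor products of spaces of functions. -/

section Tensor

variable {K : Type u} {L : Type v} [Field K] [Field L] [Algebra K L] {X Y : Type*}
  {A B A' B' : Type*} [AddCommGroup A] [Module K A] [AddCommGroup B] [Module K B]
  [AddCommGroup A'] [Module K A'] [AddCommGroup B'] [Module K B']

/-- The map `A ⊗ B → (X × Y → L)`, `x ⊗ y ↦ ((s, t) ↦ a x s * b y t)`. -/
noncomputable def evTensor (a : A →ₗ[K] X → L) (b : B →ₗ[K] Y → L) :
    A ⊗[K] B →ₗ[K] X × Y → L :=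
  TensorProduct.lift (LinearMap.mk₂ K (fun x y s => a x s.1 * b y s.2)
    (fun x x' y => by funext s; simp [add_mul])
    (fun c x y => by funext s; simp)
    (fun x y y' => by funext s; simp [mul_add])
    (fun c x y => by funext s; simp))

@[simp]
theorem evTensor_tmul (a : A →ₗ[K] X → L) (b : B →ₗ[K] Y → L) (x : A) (y : B) (s : X × Y) :
    evTensor a b (x ⊗ₜ y) s = a x s.1 * b y s.2 := rfl

/-- A linear map to functions with values in `L` which preserves linear independence, from that
over `K` to that over `L`. -/
def IsForm (a : A →ₗ[K] X → L) : Prop :=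
  ∀ (n : ℕ) (v : Fin n → A), LinearIndependent K v → LinearIndependent L (fun i => a (v i))

/-- Write the tensor as `∑ e_i ⊗ f_i` with a basis `e_i`. For fixed second argument `y`, the
vanishing of its image is an `L`-relation between the `a(e_i)` with coefficients `b(f_i)(y)`. Only
the left factor has to preserve independence over `L`. -/
theorem evTensor_injective [Module.Finite K A] {a : A →ₗ[K] X → L} {b : B →ₗ[K] Y → L}
    (ha : IsForm a) (hb : Function.Injective b) : Function.Injective (evTensor a b) := by
  rw [injective_iff_map_eq_zero]
  intro t ht
  let e := Module.finBasis K A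
  obtain ⟨f, rfl⟩ := (TensorProduct.equivFinsuppOfBasisLeft e).symm.surjective t
  have hf : f = 0 := by
    ext i
    apply hb
    rw [Finsupp.zero_apply, map_zero]
    funext y
    have hli := ha _ e e.linearIndependent
    rw [Fintype.linearIndependent_iff] at hli
    refine hli (fun i => b (f i) y) ?_ i
    funext x
    have h1 := congrFun ht (x, y)
    rw [TensorProduct.equivFinsuppOfBasisLeft_symm_apply, Finsupp.sum_fintype _ _ (by simp),
      map_sum] at h1
    simp only [Finset.sum_apply, evTensor_tmul, Pi.zero_apply] at h1
    simp only [Finset.sum_apply, Pi.smul_apply, smul_eq_mul, Pi.zero_apply]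
    rw [← h1]
    exact Finset.sum_congr rfl fun i _ => mul_comm _ _
  rw [hf, map_zero]

end Tensor

end GaloisDescent

/-! ### The Hopf algebra of the fixed elements of the group algebra -/

namespace GaloisDescent

/-- The action of `G` by conjugation with left translations on a group of permutations which is
normalised by them. -/
def conjPerm {G : Type*} [Group G] {N : Subgroup (Equiv.Perm G)} (hl : IsNormalisedByLeft N) :
    G →* Equiv.Perm N :=
  MonoidHom.toHomPerm
    { toFun := fun g n => ⟨Equiv.mulLeft g * n * (Equiv.mulLeft g)⁻¹, hl g n n.2⟩
      map_one' := by
        funext n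
        refine Subtype.ext (Equiv.ext fun x => ?_)
        change 1 * (n : Equiv.Perm G) (1⁻¹ * x) = (n : Equiv.Perm G) x
        rw [inv_one, one_mul, one_mul]
      map_mul' := fun g h => by
        funext n
        refine Subtype.ext (Equiv.ext fun x => ?_)
        change g * h * (n : Equiv.Perm G) ((g * h)⁻¹ * x) =
          g * (h * (n : Equiv.Perm G) (h⁻¹ * (g⁻¹ * x)))
        rw [mul_inv_rev, mul_assoc, mul_assoc] }

section Conj

variable {G : Type*} [Group G] {N : Subgroup (Equiv.Perm G)} (hl : IsNormalisedByLeft N)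

theorem coe_conjPerm (g : G) (n : N) :
    (conjPerm hl g n : Equiv.Perm G) = Equiv.mulLeft g * n * (Equiv.mulLeft g)⁻¹ := rfl

theorem conjPerm_mul (g : G) (n m : N) :
    conjPerm hl g (n * m) = conjPerm hl g n * conjPerm hl g m := by
  apply Subtype.ext
  simp only [coe_conjPerm, Subgroup.coe_mul, Subgroup.coe_inv]
  group

theorem conjPerm_inv (g : G) (n : N) : conjPerm hl g n⁻¹ = (conjPerm hl g n)⁻¹ := by
  apply Subtype.ext
  simp only [coe_conjPerm, Subgroup.coe_mul, Subgroup.coe_inv]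
  group

theorem conjPerm_one (g : G) : conjPerm hl g 1 = 1 := by
  apply Subtype.ext
  simp only [coe_conjPerm, Subgroup.coe_one]
  group

theorem conjPerm_inv_apply (g : G) (n : N) :
    ((conjPerm hl g n : Equiv.Perm G)⁻¹) g = g * ((n : Equiv.Perm G)⁻¹) 1 := by
  simp [coe_conjPerm, Equiv.Perm.mul_apply]

end Conj

theorem coeff_mul_eq_sum {R M : Type*} [Semiring R] [Group M] [Fintype M]
    (x y : MonoidAlgebra R M) (m : M) :
    (x * y).coeff m = ∑ a, x.coeff a * y.coeff (a⁻¹ * m) := by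
  classical
  rw [MonoidAlgebra.coeff_mul, Finsupp.sum_fintype _ _ (by simp)]
  refine Finset.sum_congr rfl fun a _ => ?_
  rw [Finsupp.sum_fintype _ _ (by simp), Finset.sum_eq_single (a⁻¹ * m)]
  · simp
  · intro b _ hb
    rw [if_neg]
    rintro rfl
    simp at hb
  · simp

variable {K : Type u} {L : Type v} [Field K] [Field L] [Algebra K L]

theorem coeff_algebraMap_apply {M : Type*} [Group M] [DecidableEq M] (c : K) (m : M) :
    (algebraMap K (MonoidAlgebra L M) c).coeff m = if m = 1 then algebraMap K L c else 0 := by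
  classical
  rw [MonoidAlgebra.coe_algebraMap, Function.comp_apply, MonoidAlgebra.coeff_single,
    Finsupp.single_apply]
  simp only [eq_comm]

/-- The coefficients of the elements of a group algebra. -/
def coeffMap (K : Type u) {L : Type v} [Field K] [Field L] [Algebra K L] (M : Type*) :
    MonoidAlgebra L M →ₗ[K] M → L where
  toFun f := f.coeff
  map_add' _ _ := rfl
  map_smul' _ _ := rfl

@[simp]
theorem coeffMap_apply {M : Type*} (f : MonoidAlgebra L M) (m : M) :
    coeffMap K M f m = f.coeff m := rfl

theorem coeffMap_injective (M : Type*) :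
    Function.Injective (coeffMap K M : MonoidAlgebra L M →ₗ[K] M → L) := by
  intro f g h
  ext m
  exact congrFun h m

theorem isForm_coeffMap (L : Type v) [Field L] (M : Type*) :
    IsForm (coeffMap L M : MonoidAlgebra L M →ₗ[L] M → L) := fun _ _ hv =>
  hv.map' _ (LinearMap.ker_eq_bot.mpr (coeffMap_injective M))

theorem evTensor_mapOfCompatibleSMul {A M : Type*} [AddCommGroup A] [Module K A]
    (f : A →ₗ[K] MonoidAlgebra L M) (t : A ⊗[K] A) :
    evTensor (coeffMap L M) (coeffMap L M)
      (TensorProduct.mapOfCompatibleSMul L K K (MonoidAlgebra L M) (MonoidAlgebra L M)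
        (TensorProduct.map f f t)) =
      evTensor (coeffMap K M ∘ₗ f) (coeffMap K M ∘ₗ f) t := by
  induction t with
  | zero => simp
  | tmul x y =>
    funext s
    simp
  | add x y hx hy => simp [hx, hy]

/-- Elements of the group are grouplike, so the comultiplication of the group algebra restricts
coefficients to the diagonal. This is the form in which it descends. -/
theorem evTensor_comul {M : Type*} [Finite M] [DecidableEq M] (f : MonoidAlgebra L M)
    (s : M × M) :
    evTensor (coeffMap L M) (coeffMap L M) (Coalgebra.comul (R := L) f) s =
      if s.1 = s.2 then f.coeff s.1 else 0 := by
  induction f using MonoidAlgebra.induction_linear with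
  | zero => simp
  | add f g hf hg =>
    rw [map_add, map_add, Pi.add_apply, hf, hg, MonoidAlgebra.coeff_add]
    split_ifs <;> simp
  | single m c =>
    rw [MonoidAlgebra.comul_single, CommSemiring.comul_apply, TensorProduct.map_tmul,
      evTensor_tmul]
    simp only [coeffMap_apply, MonoidAlgebra.lsingle_apply, MonoidAlgebra.coeff_single,
      Finsupp.single_apply]
    obtain ⟨a, b⟩ := s
    dsimp only
    split_ifs <;> simp_all

theorem counit_eq_sum {M : Type*} [Fintype M] (f : MonoidAlgebra L M) :
    Coalgebra.counit (R := L) f = ∑ m, f.coeff m := by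
  classical
  induction f using MonoidAlgebra.induction_linear with
  | zero => simp
  | add f g hf hg => simp [hf, hg, Finset.sum_add_distrib]
  | single m c =>
    rw [MonoidAlgebra.counit_single]
    simp [Finsupp.single_apply]

variable (N : Subgroup (Equiv.Perm (L ≃ₐ[K] L))) (hl : IsNormalisedByLeft N)

/-- The `K`-algebra of the elements of `L[N]` fixed by the Galois group. -/
def fixedAlgebra [FiniteDimensional K L] : Subalgebra K (MonoidAlgebra L N) where
  carrier := {f | coeffMap K N f ∈ fixed (conjPerm hl)}
  add_mem' {f h} hf hh := by
    rw [Set.mem_ofPred_eq, map_add]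
    exact Submodule.add_mem _ hf hh
  mul_mem' {f h} hf hh g n := by
    have := Fintype.ofFinite N
    simp only [coeffMap_apply, coeff_mul_eq_sum, map_sum, map_mul]
    refine (Fintype.sum_equiv (conjPerm hl g) _ _ fun a => ?_).symm
    rw [← conjPerm_inv, ← conjPerm_mul]
    exact congrArg₂ _ (hf g a).symm (hh g _).symm
  algebraMap_mem' c g n := by
    classical
    simp only [coeffMap_apply, coeff_algebraMap_apply]
    have : conjPerm hl g n = 1 ↔ n = 1 := by
      rw [← (conjPerm hl g).apply_eq_iff_eq (x := n) (y := 1), conjPerm_one]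
    simp only [this]
    split_ifs <;> simp

variable {N}

/-- An algebra homomorphism to `L[N]` which is an isomorphism to the algebra of fixed elements. -/
structure IsFixedModel {A : Type*} [Ring A] [Algebra K A] (ι : A →ₐ[K] MonoidAlgebra L N) :
    Prop where
  injective : Function.Injective ι
  mem_range : ∀ f, f ∈ Set.range ι ↔ coeffMap K N f ∈ fixed (conjPerm hl)

theorem isFixedModel_val [FiniteDimensional K L] : IsFixedModel hl (fixedAlgebra N hl).val where
  injective := Subtype.val_injective
  mem_range f := ⟨by rintro ⟨h, rfl⟩; exact h.2, fun hf => ⟨⟨f, hf⟩, rfl⟩⟩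

/-- The action of `G` on the square of a set. -/
def prodPerm {G X : Type*} [Group G] (σ : G →* Equiv.Perm X) : G →* Equiv.Perm (X × X) where
  toFun g := (σ g).prodCongr (σ g)
  map_one' := by ext <;> simp
  map_mul' g h := by ext <;> simp

/-! ### Coefficients of the fixed algebra and of its tensor square. -/

section Model

variable {A : Type*} [Ring A] [Algebra K A] (ι : A →ₐ[K] MonoidAlgebra L N)

/-- The coefficients of the elements of the fixed algebra. -/
noncomputable def coefs : A →ₗ[K] N → L := coeffMap K N ∘ₗ ι.toLinearMap

@[simp]
theorem coefs_apply (h : A) (n : N) : coefs ι h n = (ι h).coeff n := rfl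

/-- The coefficients of the elements of the tensor square of the fixed algebra. -/
noncomputable def coefs₂ : A ⊗[K] A →ₗ[K] N × N → L := evTensor (coefs ι) (coefs ι)

theorem coefs₂_tmul (x y : A) (s : N × N) :
    coefs₂ ι (x ⊗ₜ y) s = (ι x).coeff s.1 * (ι y).coeff s.2 := rfl

theorem coefs₂_mul [Fintype N] (t t' : A ⊗[K] A) (s : N × N) :
    coefs₂ ι (t * t') s = ∑ r : N × N, coefs₂ ι t r * coefs₂ ι t' (r⁻¹ * s) := by
  induction t with
  | zero => simp
  | tmul x y =>
    induction t' with
    | zero => simp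
    | tmul x' y' =>
      rw [Algebra.TensorProduct.tmul_mul_tmul]
      simp only [coefs₂_tmul, map_mul, coeff_mul_eq_sum,
        Prod.fst_mul, Prod.snd_mul, Prod.fst_inv, Prod.snd_inv]
      rw [Fintype.sum_mul_sum, Fintype.sum_prod_type]
      exact Finset.sum_congr rfl fun a _ => Finset.sum_congr rfl fun b _ => by ring
    | add x' y' hx hy =>
      rw [mul_add, map_add, map_add, Pi.add_apply, hx, hy, ← Finset.sum_add_distrib]
      exact Finset.sum_congr rfl fun r _ => by rw [Pi.add_apply, mul_add]
  | add x y hx hy =>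
    rw [add_mul, map_add, map_add, Pi.add_apply, hx, hy, ← Finset.sum_add_distrib]
    exact Finset.sum_congr rfl fun r _ => by rw [Pi.add_apply, add_mul]

variable {hl ι}

variable [FiniteDimensional K L]

theorem IsFixedModel.coefs_mem (hι : IsFixedModel hl ι) (h : A) :
    coefs ι h ∈ fixed (conjPerm hl) :=
  (hι.mem_range _).mp ⟨h, rfl⟩

theorem IsFixedModel.coefs_injective (hι : IsFixedModel hl ι) : Function.Injective (coefs ι) :=
  (coeffMap_injective (K := K) (L := L) N).comp hι.injective

theorem IsFixedModel.exists_coefs_eq (hι : IsFixedModel hl ι) {f : N → L}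
    (hf : f ∈ fixed (conjPerm hl)) :
    ∃ h, coefs ι h = f := by
  obtain ⟨h, hh⟩ :=
    (hι.mem_range (MonoidAlgebra.ofCoeff (Finsupp.equivFunOnFinite.symm f))).mpr hf
  exact ⟨h, congrArg (coeffMap K N) hh⟩

theorem IsFixedModel.range_coefs (hι : IsFixedModel hl ι) :
    LinearMap.range (coefs ι) = fixed (conjPerm hl) := by
  ext f
  exact ⟨by rintro ⟨h, rfl⟩; exact hι.coefs_mem h, fun hf => hι.exists_coefs_eq hf⟩

theorem IsFixedModel.moduleFinite (hι : IsFixedModel hl ι) : Module.Finite K A :=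
  Module.Finite.of_injective _ hι.coefs_injective

theorem IsFixedModel.coefs₂_mem (hι : IsFixedModel hl ι) (t : A ⊗[K] A) :
    coefs₂ ι t ∈ fixed (prodPerm (conjPerm hl)) := by
  induction t with
  | zero => simp
  | tmul x y =>
    intro g s
    rw [coefs₂_tmul, coefs₂_tmul, map_mul]
    exact congrArg₂ _ (hι.coefs_mem x g s.1) (hι.coefs_mem y g s.2)
  | add x y hx hy =>
    rw [map_add]
    exact Submodule.add_mem _ hx hy

variable [IsGalois K L]

theorem IsFixedModel.isForm (hι : IsFixedModel hl ι) : IsForm (coefs ι) := fun _ _ hv =>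
  linearIndependent_of_fixed (fun _ => hι.coefs_mem _)
    (hv.map' _ (LinearMap.ker_eq_bot.mpr hι.coefs_injective))

/-- Allows identities in the tensor square over `K` to be checked on functions on `N × N`. -/
theorem IsFixedModel.coefs₂_injective (hι : IsFixedModel hl ι) : Function.Injective (coefs₂ ι) :=
  have := hι.moduleFinite
  evTensor_injective hι.isForm hι.coefs_injective

theorem IsFixedModel.finrank_eq (hι : IsFixedModel hl ι) : Module.finrank K A = Nat.card N := by
  rw [← LinearMap.finrank_range_of_inj hι.coefs_injective, hι.range_coefs, finrank_fixed]

/-- One inclusion is clear, and both spaces have dimension `|N|²` over `K`. -/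
theorem IsFixedModel.range_coefs₂ (hι : IsFixedModel hl ι) :
    LinearMap.range (coefs₂ ι) = fixed (prodPerm (conjPerm hl)) := by
  refine Submodule.eq_of_le_of_finrank_eq ?_ ?_
  · rintro _ ⟨t, rfl⟩
    exact hι.coefs₂_mem t
  · rw [LinearMap.finrank_range_of_inj hι.coefs₂_injective, Module.finrank_tensorProduct,
      finrank_fixed, hι.finrank_eq, Nat.card_prod]

end Model

/-! ### Descent of the comultiplication, counit and antipode. -/

section Hopf

open Classical in
/-- The functions on the square of a set which are supported on the diagonal. -/
noncomputable def diagonal (K : Type u) (L : Type v) [Field K] [Field L] [Algebra K L]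
    (X : Type*) : (X → L) →ₗ[K] X × X → L where
  toFun f s := if s.1 = s.2 then f s.1 else 0
  map_add' f h := by
    funext s
    simp only [Pi.add_apply]
    split_ifs <;> simp
  map_smul' c f := by
    funext s
    simp

open Classical in
theorem diagonal_apply {X : Type*} (f : X → L) (s : X × X) :
    diagonal K L X f s = if s.1 = s.2 then f s.1 else 0 := rfl

theorem diagonal_mem {X : Type*} {σ : (L ≃ₐ[K] L) →* Equiv.Perm X} {f : X → L}
    (hf : f ∈ fixed σ) : diagonal K L X f ∈ fixed (prodPerm σ) := by
  intro g s
  have h : (prodPerm σ g s).1 = (prodPerm σ g s).2 ↔ s.1 = s.2 := (σ g).apply_eq_iff_eq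
  rw [diagonal_apply, diagonal_apply]
  by_cases hs : s.1 = s.2
  · rw [if_pos (h.mpr hs), if_pos hs]
    exact hf g s.1
  · rw [if_neg (mt h.mp hs), if_neg hs, map_zero]

variable {A : Type*} [Ring A] [Algebra K A] {ι : A →ₐ[K] MonoidAlgebra L N} {hl}
  [FiniteDimensional K L] [IsGalois K L]

/-- The extension of an equivariant function by zero off the diagonal is equivariant on `N × N`, so
by `range_coefs₂` it comes from a unique tensor over `K`. -/
theorem IsFixedModel.exists_comul (hι : IsFixedModel hl ι) :
    ∃ Δ : A →ₗ[K] A ⊗[K] A, ∀ h, coefs₂ ι (Δ h) = diagonal K L N (coefs ι h) := by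
  let e := LinearEquiv.ofInjective _ hι.coefs₂_injective
  have hmem : ∀ h, (diagonal K L N ∘ₗ coefs ι) h ∈ LinearMap.range (coefs₂ ι) := fun h => by
    rw [hι.range_coefs₂]
    exact diagonal_mem (hι.coefs_mem h)
  refine ⟨e.symm.toLinearMap ∘ₗ (diagonal K L N ∘ₗ coefs ι).codRestrict _ hmem, fun h => ?_⟩
  exact congrArg Subtype.val (e.apply_symm_apply ⟨_, hmem h⟩)

/-- The Galois group permutes the coefficients of a fixed element, so their sum is invariant and
lies in `K`. -/
theorem IsFixedModel.exists_counit (hι : IsFixedModel hl ι) [Fintype N] :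
    ∃ ε : A →ₗ[K] K, ∀ h, algebraMap K L (ε h) = ∑ n, (ι h).coeff n := by
  let s : A →ₗ[K] L := (∑ n, LinearMap.proj n) ∘ₗ coefs ι
  have hs : ∀ h, s h = ∑ n, (ι h).coeff n := fun h => by
    simp [s, LinearMap.sum_apply]
  have hmem : ∀ h, s h ∈ LinearMap.range (Algebra.linearMap K L) := by
    intro h
    have h1 : s h ∈ (⊥ : IntermediateField K L) := by
      rw [IsGalois.mem_bot_iff_fixed]
      intro g
      rw [hs, map_sum]
      exact Fintype.sum_equiv (conjPerm hl g) _ _ fun n => (hι.coefs_mem h g n).symm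
    obtain ⟨c, hc⟩ := IntermediateField.mem_bot.mp h1
    exact ⟨c, hc⟩
  let e := LinearEquiv.ofInjective (Algebra.linearMap K L) (algebraMap K L).injective
  refine ⟨e.symm.toLinearMap ∘ₗ s.codRestrict _ hmem, fun h => ?_⟩
  rw [← hs]
  exact congrArg Subtype.val (e.apply_symm_apply ⟨_, hmem h⟩)

theorem IsFixedModel.exists_antipode (hι : IsFixedModel hl ι) :
    ∃ S : A →ₗ[K] A, ∀ h n, (ι (S h)).coeff n = (ι h).coeff n⁻¹ := by
  let e := LinearEquiv.ofInjective _ hι.coefs_injective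
  let r : (N → L) →ₗ[K] N → L := LinearMap.funLeft K L (fun n => n⁻¹)
  have hmem : ∀ h, (r ∘ₗ coefs ι) h ∈ LinearMap.range (coefs ι) := fun h => by
    rw [hι.range_coefs]
    intro g n
    change coefs ι h (conjPerm hl g n)⁻¹ = g (coefs ι h n⁻¹)
    rw [← conjPerm_inv]
    exact hι.coefs_mem h g _
  refine ⟨e.symm.toLinearMap ∘ₗ (r ∘ₗ coefs ι).codRestrict _ hmem, fun h n => ?_⟩
  exact congrFun (congrArg Subtype.val (e.apply_symm_apply ⟨_, hmem h⟩)) n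

end Hopf

/-! ### The Hopf algebra axioms, checked on coefficients. -/

section Structure

open Classical

variable {K : Type u} {L : Type v} [Field K] [Field L] [Algebra K L]
  {N : Subgroup (Equiv.Perm (L ≃ₐ[K] L))} {hl : IsNormalisedByLeft N}
  {A : Type*} [Ring A] [Algebra K A] {ι : A →ₐ[K] MonoidAlgebra L N}

theorem coefs₂_comm (t : A ⊗[K] A) (s : N × N) :
    coefs₂ ι (TensorProduct.comm K A A t) s = coefs₂ ι t s.swap := by
  induction t with
  | zero => simp
  | tmul x y =>
    rw [TensorProduct.comm_tmul, coefs₂_tmul, coefs₂_tmul]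
    exact mul_comm _ _
  | add x y hx hy => simp only [map_add, Pi.add_apply, hx, hy]

theorem coeff_mul' [Fintype N] (t : A ⊗[K] A) (n : N) :
    (ι (LinearMap.mul' K A t)).coeff n = ∑ a, coefs₂ ι t (a, a⁻¹ * n) := by
  induction t with
  | zero => simp
  | tmul x y => simp only [LinearMap.mul'_apply, map_mul, coeff_mul_eq_sum, coefs₂_tmul]
  | add x y hx hy =>
    simp only [map_add, Pi.add_apply, Finset.sum_add_distrib, MonoidAlgebra.coeff_add,
      Finsupp.add_apply, hx, hy]

variable {Δ : A →ₗ[K] A ⊗[K] A} (hΔ : ∀ h, coefs₂ ι (Δ h) = diagonal K L N (coefs ι h))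
  {ε : A →ₗ[K] K} {S : A →ₗ[K] A} (hS : ∀ h n, (ι (S h)).coeff n = (ι h).coeff n⁻¹)

theorem coefs₂_rTensor_antipode (hS : ∀ h n, (ι (S h)).coeff n = (ι h).coeff n⁻¹)
    (t : A ⊗[K] A) (s : N × N) :
    coefs₂ ι (S.rTensor A t) s = coefs₂ ι t (s.1⁻¹, s.2) := by
  induction t with
  | zero => simp
  | tmul x y => rw [LinearMap.rTensor_tmul, coefs₂_tmul, coefs₂_tmul, hS]
  | add x y hx hy => simp only [map_add, Pi.add_apply, hx, hy]

theorem coefs₂_lTensor_antipode (hS : ∀ h n, (ι (S h)).coeff n = (ι h).coeff n⁻¹)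
    (t : A ⊗[K] A) (s : N × N) :
    coefs₂ ι (S.lTensor A t) s = coefs₂ ι t (s.1, s.2⁻¹) := by
  induction t with
  | zero => simp
  | tmul x y => rw [LinearMap.lTensor_tmul, coefs₂_tmul, coefs₂_tmul, hS]
  | add x y hx hy => simp only [map_add, Pi.add_apply, hx, hy]

theorem coeff_rTensor_counit [Fintype N] (hε : ∀ h, algebraMap K L (ε h) = ∑ n, (ι h).coeff n)
    (t : A ⊗[K] A) (m : N) :
    (ι (TensorProduct.lid K A (ε.rTensor A t))).coeff m = ∑ n, coefs₂ ι t (n, m) := by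
  induction t with
  | zero => simp
  | tmul x y =>
    rw [LinearMap.rTensor_tmul, TensorProduct.lid_tmul, map_smul,
      MonoidAlgebra.coeff_smul_apply, Algebra.smul_def, hε, Finset.sum_mul]
    rfl
  | add x y hx hy =>
    simp only [map_add, Pi.add_apply, Finset.sum_add_distrib, MonoidAlgebra.coeff_add,
      Finsupp.add_apply, hx, hy]

theorem coeff_lTensor_counit [Fintype N] (hε : ∀ h, algebraMap K L (ε h) = ∑ n, (ι h).coeff n)
    (t : A ⊗[K] A) (m : N) :
    (ι (TensorProduct.rid K A (ε.lTensor A t))).coeff m = ∑ n, coefs₂ ι t (m, n) := by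
  induction t with
  | zero => simp
  | tmul x y =>
    rw [LinearMap.lTensor_tmul, TensorProduct.rid_tmul, map_smul,
      MonoidAlgebra.coeff_smul_apply, Algebra.smul_def, hε, mul_comm, Finset.mul_sum]
    rfl
  | add x y hx hy =>
    simp only [map_add, Pi.add_apply, Finset.sum_add_distrib, MonoidAlgebra.coeff_add,
      Finsupp.add_apply, hx, hy]

variable (ι) in
/-- The coefficients of the elements of the tensor cube of the fixed algebra. -/
noncomputable def coefs₃ : A ⊗[K] (A ⊗[K] A) →ₗ[K] N × (N × N) → L :=
  evTensor (coefs ι) (coefs₂ ι)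

theorem coefs₃_tmul (x : A) (t : A ⊗[K] A) (s : N × (N × N)) :
    coefs₃ ι (x ⊗ₜ t) s = (ι x).coeff s.1 * coefs₂ ι t s.2 := rfl

theorem coefs₃_assoc (t : A ⊗[K] A) (y : A) (s : N × (N × N)) :
    coefs₃ ι (TensorProduct.assoc K A A A (t ⊗ₜ y)) s =
      coefs₂ ι t (s.1, s.2.1) * (ι y).coeff s.2.2 := by
  induction t with
  | zero => simp
  | tmul x z =>
    rw [TensorProduct.assoc_tmul, coefs₃_tmul, coefs₂_tmul, coefs₂_tmul, mul_assoc]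
  | add x z hx hz => simp only [TensorProduct.add_tmul, map_add, Pi.add_apply, hx, hz, add_mul]

theorem coefs₃_assoc_rTensor (hΔ : ∀ h, coefs₂ ι (Δ h) = diagonal K L N (coefs ι h))
    (t : A ⊗[K] A) (s : N × (N × N)) :
    coefs₃ ι (TensorProduct.assoc K A A A (Δ.rTensor A t)) s =
      if s.1 = s.2.1 then coefs₂ ι t (s.1, s.2.2) else 0 := by
  induction t with
  | zero => simp
  | tmul x y =>
    rw [LinearMap.rTensor_tmul, coefs₃_assoc, hΔ, diagonal_apply, coefs₂_tmul]
    split_ifs <;> simp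
  | add x y hx hy =>
    simp only [map_add, Pi.add_apply, hx, hy]
    split_ifs <;> simp

theorem coefs₃_lTensor (hΔ : ∀ h, coefs₂ ι (Δ h) = diagonal K L N (coefs ι h))
    (t : A ⊗[K] A) (s : N × (N × N)) :
    coefs₃ ι (Δ.lTensor A t) s =
      if s.2.1 = s.2.2 then coefs₂ ι t (s.1, s.2.1) else 0 := by
  induction t with
  | zero => simp
  | tmul x y =>
    rw [LinearMap.lTensor_tmul, coefs₃_tmul, hΔ, diagonal_apply, coefs₂_tmul]
    split_ifs <;> simp
  | add x y hx hy =>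
    simp only [map_add, Pi.add_apply, hx, hy]
    split_ifs <;> simp

variable [FiniteDimensional K L] [IsGalois K L]

theorem IsFixedModel.coefs₃_injective (hι : IsFixedModel hl ι) :
    Function.Injective (coefs₃ ι) :=
  have := hι.moduleFinite
  evTensor_injective hι.isForm hι.coefs₂_injective

/-- On `N × N × N` both sides are the coefficient function of `h` placed on the triple diagonal. -/
theorem IsFixedModel.coassoc (hι : IsFixedModel hl ι)
    (hΔ : ∀ h, coefs₂ ι (Δ h) = diagonal K L N (coefs ι h)) :
    TensorProduct.assoc K A A A ∘ₗ Δ.rTensor A ∘ₗ Δ = Δ.lTensor A ∘ₗ Δ := by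
  ext h
  apply hι.coefs₃_injective
  funext s
  obtain ⟨a, b, c⟩ := s
  simp only [LinearMap.comp_apply, LinearEquiv.coe_coe]
  rw [coefs₃_assoc_rTensor hΔ, coefs₃_lTensor hΔ, hΔ, diagonal_apply, diagonal_apply]
  dsimp only
  by_cases h1 : a = b <;> by_cases h2 : b = c <;> simp_all

theorem IsFixedModel.rTensor_counit [Fintype N] (hι : IsFixedModel hl ι)
    (hΔ : ∀ h, coefs₂ ι (Δ h) = diagonal K L N (coefs ι h))
    (hε : ∀ h, algebraMap K L (ε h) = ∑ n, (ι h).coeff n) :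
    ε.rTensor A ∘ₗ Δ = TensorProduct.mk K _ _ 1 := by
  ext h
  apply (TensorProduct.lid K A).injective
  apply hι.coefs_injective
  funext m
  rw [coefs_apply, LinearMap.comp_apply, coeff_rTensor_counit hε, hΔ]
  simp only [diagonal_apply]
  rw [Fintype.sum_eq_single m fun n hn => if_neg hn, if_pos rfl]
  simp

theorem IsFixedModel.lTensor_counit [Fintype N] (hι : IsFixedModel hl ι)
    (hΔ : ∀ h, coefs₂ ι (Δ h) = diagonal K L N (coefs ι h))
    (hε : ∀ h, algebraMap K L (ε h) = ∑ n, (ι h).coeff n) :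
    ε.lTensor A ∘ₗ Δ = (TensorProduct.mk K _ _).flip 1 := by
  ext h
  apply (TensorProduct.rid K A).injective
  apply hι.coefs_injective
  funext m
  rw [coefs_apply, LinearMap.comp_apply, coeff_lTensor_counit hε, hΔ]
  simp only [diagonal_apply]
  rw [Fintype.sum_eq_single m fun n hn => if_neg hn.symm, if_pos rfl]
  simp

theorem coeff_map_one (n : N) : (ι 1).coeff n = if n = 1 then 1 else 0 := by
  rw [map_one, MonoidAlgebra.one_def, MonoidAlgebra.coeff_single, Finsupp.single_apply]
  simp only [eq_comm]

theorem IsFixedModel.comul_one (hι : IsFixedModel hl ι)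
    (hΔ : ∀ h, coefs₂ ι (Δ h) = diagonal K L N (coefs ι h)) : Δ 1 = 1 := by
  apply hι.coefs₂_injective
  funext s
  obtain ⟨a, b⟩ := s
  rw [hΔ, diagonal_apply, Algebra.TensorProduct.one_def, coefs₂_tmul]
  simp only [coefs_apply, coeff_map_one]
  by_cases h1 : a = b <;> by_cases h2 : b = 1 <;> simp_all

theorem IsFixedModel.comul_mul [Fintype N] (hι : IsFixedModel hl ι)
    (hΔ : ∀ h, coefs₂ ι (Δ h) = diagonal K L N (coefs ι h)) (x y : A) :
    Δ (x * y) = Δ x * Δ y := by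
  apply hι.coefs₂_injective
  funext s
  obtain ⟨a, b⟩ := s
  rw [coefs₂_mul, Fintype.sum_prod_type]
  simp only [hΔ, diagonal_apply, coefs_apply, map_mul, coeff_mul_eq_sum, ite_mul, zero_mul,
    Finset.sum_ite_eq, Finset.mem_univ, if_true]
  by_cases h1 : a = b
  · subst h1
    simp
  · simp [h1]

theorem IsFixedModel.counit_one [Fintype N]
    (hε : ∀ h, algebraMap K L (ε h) = ∑ n, (ι h).coeff n) : ε 1 = 1 := by
  apply (algebraMap K L).injective
  rw [hε, map_one (algebraMap K L), Fintype.sum_eq_single 1]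
  · rw [coeff_map_one, if_pos rfl]
  · intro n hn
    rw [coeff_map_one, if_neg hn]

theorem IsFixedModel.counit_mul [Fintype N]
    (hε : ∀ h, algebraMap K L (ε h) = ∑ n, (ι h).coeff n) (x y : A) :
    ε (x * y) = ε x * ε y := by
  apply (algebraMap K L).injective
  rw [map_mul (algebraMap K L), hε, hε, hε, Fintype.sum_mul_sum]
  simp only [map_mul, coeff_mul_eq_sum]
  rw [Finset.sum_comm]
  refine Finset.sum_congr rfl fun a _ => ?_
  exact Fintype.sum_equiv (Equiv.mulLeft a⁻¹) _ _ fun b => rfl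

/-- The coefficient at `n` collects the pairs `(a⁻¹, a⁻¹n)` on the diagonal. There are none unless
`n = 1`, and then all coefficients of `h` are summed. -/
theorem IsFixedModel.mul_antipode_rTensor [Fintype N] (hι : IsFixedModel hl ι)
    (hΔ : ∀ h, coefs₂ ι (Δ h) = diagonal K L N (coefs ι h))
    (hε : ∀ h, algebraMap K L (ε h) = ∑ n, (ι h).coeff n)
    (hS : ∀ h n, (ι (S h)).coeff n = (ι h).coeff n⁻¹) :
    LinearMap.mul' K A ∘ₗ S.rTensor A ∘ₗ Δ = Algebra.linearMap K A ∘ₗ ε := by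
  ext h
  apply hι.coefs_injective
  funext n
  simp only [LinearMap.comp_apply, coefs_apply, coeff_mul', coefs₂_rTensor_antipode hS, hΔ,
    diagonal_apply, Algebra.linearMap_apply, AlgHom.commutes, coeff_algebraMap_apply, hε]
  by_cases hn : n = 1
  · subst hn
    simp only [mul_one, if_true]
    exact Fintype.sum_equiv (Equiv.inv N) _ _ fun b => rfl
  · rw [if_neg hn]
    refine Finset.sum_eq_zero fun a _ => if_neg fun ha => hn ?_
    simpa using ha

theorem IsFixedModel.mul_antipode_lTensor [Fintype N] (hι : IsFixedModel hl ι)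
    (hΔ : ∀ h, coefs₂ ι (Δ h) = diagonal K L N (coefs ι h))
    (hε : ∀ h, algebraMap K L (ε h) = ∑ n, (ι h).coeff n)
    (hS : ∀ h n, (ι (S h)).coeff n = (ι h).coeff n⁻¹) :
    LinearMap.mul' K A ∘ₗ S.lTensor A ∘ₗ Δ = Algebra.linearMap K A ∘ₗ ε := by
  ext h
  apply hι.coefs_injective
  funext n
  simp only [LinearMap.comp_apply, coefs_apply, coeff_mul', coefs₂_lTensor_antipode hS, hΔ,
    diagonal_apply, Algebra.linearMap_apply, AlgHom.commutes, coeff_algebraMap_apply, hε]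
  by_cases hn : n = 1
  · subst hn
    simp
  · rw [if_neg hn]
    refine Finset.sum_eq_zero fun a _ => if_neg fun ha => hn ?_
    rw [mul_inv_rev, inv_inv] at ha
    simpa using ha

theorem IsFixedModel.comm_comul (hι : IsFixedModel hl ι)
    (hΔ : ∀ h, coefs₂ ι (Δ h) = diagonal K L N (coefs ι h)) (h : A) :
    TensorProduct.comm K A A (Δ h) = Δ h := by
  apply hι.coefs₂_injective
  funext s
  obtain ⟨a, b⟩ := s
  rw [coefs₂_comm, hΔ, diagonal_apply, diagonal_apply]
  dsimp only [Prod.swap]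
  by_cases h1 : a = b
  · subst h1
    rfl
  · rw [if_neg h1, if_neg (Ne.symm h1)]

/-- The coalgebra structure of the fixed algebra. -/
@[reducible] noncomputable def IsFixedModel.coalgebra (hι : IsFixedModel hl ι) : Coalgebra K A :=
  letI := Fintype.ofFinite N
  { comul := hι.exists_comul.choose
    counit := hι.exists_counit.choose
    coassoc := hι.coassoc hι.exists_comul.choose_spec
    rTensor_counit_comp_comul :=
      hι.rTensor_counit hι.exists_comul.choose_spec hι.exists_counit.choose_spec
    lTensor_counit_comp_comul :=
      hι.lTensor_counit hι.exists_comul.choose_spec hι.exists_counit.choose_spec }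

theorem IsFixedModel.coefs₂_comul (hι : IsFixedModel hl ι) (h : A) :
    coefs₂ ι (hι.coalgebra.comul h) = diagonal K L N (coefs ι h) :=
  hι.exists_comul.choose_spec h

theorem IsFixedModel.algebraMap_counit [Fintype N] (hι : IsFixedModel hl ι) (h : A) :
    algebraMap K L (hι.coalgebra.counit h) = ∑ n, (ι h).coeff n := by
  -- The counit was chosen with this `Fintype` instance, whereas the sum in the statement uses an
  -- arbitrary one.
  let F := Fintype.ofFinite N
  have h1 : algebraMap K L (hι.coalgebra.counit h) = ∑ n ∈ F.elems, (ι h).coeff n :=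
    hι.exists_counit.choose_spec h
  rw [h1]
  exact Finset.sum_congr (Finset.ext fun n => by simp [F.complete n]) fun _ _ => rfl

/-- The Hopf algebra structure of the fixed algebra. -/
@[reducible] noncomputable def IsFixedModel.hopfAlgebra (hι : IsFixedModel hl ι) : HopfAlgebra K A :=
  letI := Fintype.ofFinite N
  letI := hι.coalgebra
  letI : Bialgebra K A := Bialgebra.mk' K A
    (IsFixedModel.counit_one hι.algebraMap_counit)
    (IsFixedModel.counit_mul hι.algebraMap_counit _ _)
    (hι.comul_one hι.coefs₂_comul)
    (hι.comul_mul hι.coefs₂_comul _ _)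
  { antipode := hι.exists_antipode.choose
    mul_antipode_rTensor_comul := hι.mul_antipode_rTensor hι.coefs₂_comul
      hι.algebraMap_counit hι.exists_antipode.choose_spec
    mul_antipode_lTensor_comul := hι.mul_antipode_lTensor hι.coefs₂_comul
      hι.algebraMap_counit hι.exists_antipode.choose_spec }

theorem IsFixedModel.isCocomm (hι : IsFixedModel hl ι) :
    letI := hι.coalgebra
    Coalgebra.IsCocomm K A :=
  letI := hι.coalgebra
  ⟨LinearMap.ext fun h => hι.comm_comul hι.coefs₂_comul h⟩

end Structure

/-! ### The action on `L` and the Galois condition. -/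

section Action

variable {K : Type u} {L : Type v} [Field K] [Field L] [Algebra K L]
  {N : Subgroup (Equiv.Perm (L ≃ₐ[K] L))} {hl : IsNormalisedByLeft N}
  {A : Type*} [Ring A] [Algebra K A] {ι : A →ₐ[K] MonoidAlgebra L N}

/-- A permutation `n` of the Galois group gives the automorphism `n⁻¹(1)`. -/
def permAut (n : N) : L ≃ₐ[K] L := ((n : Equiv.Perm (L ≃ₐ[K] L))⁻¹) 1

theorem permAut_injective (hN : IsRegularPerm N) :
    Function.Injective (permAut : N → (L ≃ₐ[K] L)) := by
  intro n m h
  refine Subtype.ext (inv_injective ?_)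
  exact (hN 1 (permAut n)).unique ⟨N.inv_mem n.2, rfl⟩ ⟨N.inv_mem m.2, h.symm⟩

theorem permAut_surjective (hN : IsRegularPerm N) :
    Function.Surjective (permAut : N → (L ≃ₐ[K] L)) := by
  intro g
  obtain ⟨n, ⟨hn, h1⟩, _⟩ := hN 1 g
  exact ⟨⟨n⁻¹, N.inv_mem hn⟩, by simpa [permAut] using h1⟩

/-- With `g = n⁻¹(1)` one has `(n · ᵍm)⁻¹(1) = (ᵍm)⁻¹(g) = g · m⁻¹(1)`. This twisted
multiplicativity is what makes fixed elements act compatibly with products. -/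
theorem permAut_mul_conj (n m : N) :
    permAut (n * conjPerm hl (permAut n) m) = permAut n * permAut m := by
  change (((n : Equiv.Perm (L ≃ₐ[K] L)) * conjPerm hl (permAut n) m)⁻¹) 1 = _
  rw [mul_inv_rev, Equiv.Perm.mul_apply]
  exact conjPerm_inv_apply hl (permAut n) m

/-- Dedekind's theorem for the automorphisms given by a regular group of permutations. -/
theorem eq_zero_of_sum_permAut [Fintype N] (hN : IsRegularPerm N) {c : N → L}
    (h : ∀ z, ∑ n, c n * permAut n z = 0) : c = 0 := by
  have hD := (linearIndependent_toLinearMap K L L).comp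
    (fun n : N => (permAut n : L →ₐ[K] L))
    (fun n m hnm => permAut_injective hN (AlgEquiv.ext fun x => DFunLike.congr_fun hnm x))
  rw [Fintype.linearIndependent_iff] at hD
  funext n
  refine hD c (LinearMap.ext fun z => ?_) n
  rw [LinearMap.sum_apply, LinearMap.zero_apply, ← h z]
  rfl

/-- The action on `L` of the elements of `L[N]`. -/
noncomputable def permAction (K : Type u) {L : Type v} [Field K] [Field L] [Algebra K L]
    (N : Subgroup (Equiv.Perm (L ≃ₐ[K] L))) [Fintype N] :
    MonoidAlgebra L N →ₗ[K] Module.End K L where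
  toFun f := ∑ n, f.coeff n • (permAut n).toLinearMap
  map_add' f g := by
    simp [add_smul, Finset.sum_add_distrib]
  map_smul' c f := by
    simp [Finset.smul_sum]

theorem permAction_apply [Fintype N] (f : MonoidAlgebra L N) (z : L) :
    permAction K N f z = ∑ n, f.coeff n * permAut n z := by
  simp [permAction, LinearMap.sum_apply]

theorem permAction_eq_sum [Fintype N] (f : MonoidAlgebra L N) (z : L) :
    permAction K N f z =
      f.coeff.sum fun n c => c * ((n : Equiv.Perm (L ≃ₐ[K] L))⁻¹ 1) z := by
  rw [permAction_apply, Finsupp.sum_fintype _ _ (by simp)]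
  rfl

theorem permAction_one [Fintype N] : permAction K N 1 = 1 := by
  classical
  ext z
  rw [permAction_apply, MonoidAlgebra.one_def, MonoidAlgebra.coeff_single,
    Fintype.sum_eq_single 1]
  · simp [permAut]
  · intro n hn
    rw [Finsupp.single_apply, if_neg hn.symm, zero_mul]

/-- Moving `permAut a` past a coefficient of `h` turns `h(m)` into `h(ᵃm)`, since `h` is fixed; then
`permAut_mul_conj` and a reindexing give the product. Nothing is needed of `f`. -/
theorem permAction_mul [Fintype N] (f h : MonoidAlgebra L N)
    (hh : coeffMap K N h ∈ fixed (conjPerm hl)) :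
    permAction K N (f * h) = permAction K N f * permAction K N h := by
  ext z
  rw [Module.End.mul_apply, permAction_apply, permAction_apply, permAction_apply]
  simp only [coeff_mul_eq_sum, Finset.sum_mul, map_sum, map_mul, Finset.mul_sum]
  rw [Finset.sum_comm]
  refine Finset.sum_congr rfl fun a _ => ?_
  refine (Fintype.sum_equiv ((conjPerm hl (permAut a)).trans (Equiv.mulLeft a)) _ _
    fun m => ?_).symm
  simp only [Equiv.trans_apply, Equiv.coe_mulLeft, inv_mul_cancel_left]
  have h1 : h.coeff (conjPerm hl (permAut a) m) = permAut a (h.coeff m) := hh _ _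
  rw [h1, permAut_mul_conj, AlgEquiv.mul_apply, mul_assoc]

theorem mul_map_permAction [Fintype N] (x y : L) (t : A ⊗[K] A) :
    LinearMap.mul' K L (TensorProduct.map ((permAction K N ∘ₗ ι.toLinearMap).flip x)
      ((permAction K N ∘ₗ ι.toLinearMap).flip y) t) =
      ∑ s : N × N, coefs₂ ι t s * (permAut s.1 x * permAut s.2 y) := by
  induction t with
  | zero => simp
  | tmul a b =>
    rw [TensorProduct.map_tmul, LinearMap.mul'_apply]
    simp only [LinearMap.flip_apply, LinearMap.comp_apply, AlgHom.toLinearMap_apply,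
      permAction_apply, coefs₂_tmul]
    rw [Fintype.sum_mul_sum, Fintype.sum_prod_type]
    exact Finset.sum_congr rfl fun n _ => Finset.sum_congr rfl fun m _ => by ring
  | add a b ha hb =>
    simp only [map_add, Pi.add_apply, add_mul, Finset.sum_add_distrib, ha, hb]

/-- The map `A ⊗ L → (N × Unit → L)`. -/
noncomputable def coefsL (ι : A →ₐ[K] MonoidAlgebra L N) : A ⊗[K] L →ₗ[K] N × Unit → L :=
  evTensor (coefs ι) (LinearMap.pi fun _ => LinearMap.id)

theorem coefsL_tmul (a : A) (x : L) (s : N × Unit) :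
    coefsL ι (a ⊗ₜ x) s = (ι a).coeff s.1 * x := rfl

/-- Presents `j` as a combination of automorphisms, ready for Dedekind's theorem. The factors are
swapped because `evTensor_injective` needs the descended algebra on the left. -/
theorem galoisMap_apply [Fintype N] (t : L ⊗[K] A) (z : L) :
    LinearMap.mul' K (Module.End K L) (TensorProduct.map (Algebra.lmul K L).toLinearMap
      (permAction K N ∘ₗ ι.toLinearMap) t) z =
      ∑ n, coefsL ι (TensorProduct.comm K L A t) (n, ()) * permAut n z := by
  induction t with
  | zero => simp
  | tmul x a =>
    rw [TensorProduct.map_tmul, LinearMap.mul'_apply, TensorProduct.comm_tmul,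
      Module.End.mul_apply]
    simp only [LinearMap.comp_apply, AlgHom.toLinearMap_apply, permAction_apply, coefsL_tmul,
      Algebra.coe_lmul_eq_mul, LinearMap.mul_apply', Finset.mul_sum]
    exact Finset.sum_congr rfl fun n _ => by ring
  | add x y hx hy =>
    simp only [map_add, LinearMap.add_apply, Pi.add_apply, add_mul, Finset.sum_add_distrib,
      hx, hy]

variable [FiniteDimensional K L] [IsGalois K L]

/-- Injectivity is Dedekind's theorem followed by injectivity of `coefsL`. Surjectivity is a
dimension count, as `|N| = |G| = [L : K]` by regularity. -/
theorem IsFixedModel.galois_bijective [Fintype N] (hN : IsRegularPerm N)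
    (hι : IsFixedModel hl ι) : Function.Bijective
      (LinearMap.mul' K (Module.End K L) ∘ₗ
        TensorProduct.map (Algebra.lmul K L).toLinearMap
          (permAction K N ∘ₗ ι.toLinearMap) : L ⊗[K] A →ₗ[K] Module.End K L) := by
  have := hι.moduleFinite
  have hinj : Function.Injective
      (LinearMap.mul' K (Module.End K L) ∘ₗ
        TensorProduct.map (Algebra.lmul K L).toLinearMap
          (permAction K N ∘ₗ ι.toLinearMap) : L ⊗[K] A →ₗ[K] Module.End K L) := by
    rw [injective_iff_map_eq_zero]
    intro t ht
    have h1 := eq_zero_of_sum_permAut hN fun z => by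
      rw [← galoisMap_apply t z]
      exact LinearMap.congr_fun ht z
    have h2 : coefsL ι (TensorProduct.comm K L A t) = 0 := by
      funext s
      exact congrFun h1 s.1
    have h3 : Function.Injective (coefsL ι) :=
      evTensor_injective hι.isForm fun x y h => congrFun h ()
    exact (TensorProduct.comm K L A).injective ((h3 (h2.trans (map_zero _).symm)).trans
      (map_zero _).symm)
  refine ⟨hinj, (LinearMap.injective_iff_surjective_of_finrank_eq_finrank ?_).mp hinj⟩
  rw [Module.finrank_tensorProduct, hι.finrank_eq, Module.finrank_linearMap,
    Nat.card_congr (Equiv.ofBijective _ ⟨permAut_injective hN, permAut_surjective hN⟩),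
    IsGalois.card_aut_eq_finrank]

end Action

/-! ### Every regular normalised group gives a Hopf-Galois structure. -/

section Existence

variable {K : Type u} {L : Type v} [Field K] [Field L] [Algebra K L]
  {N : Subgroup (Equiv.Perm (L ≃ₐ[K] L))} [FiniteDimensional K L] [IsGalois K L]

/-- The Hopf-Galois structure given by an algebra isomorphic to `L[N]^G`. -/
noncomputable def IsFixedModel.hopfGaloisStructure {hl : IsNormalisedByLeft N} {A : Type v}
    [Ring A] [Algebra K A] {ι : A →ₐ[K] MonoidAlgebra L N} (hι : IsFixedModel hl ι)
    (hN : IsRegularPerm N) : HopfGaloisStructure K L :=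
  letI := Fintype.ofFinite N
  letI := hι.hopfAlgebra
  { H := A
    cocomm := hι.isCocomm
    finite := hι.moduleFinite
    act := AlgHom.ofLinearMap (permAction K N ∘ₗ ι.toLinearMap)
      (by
        rw [LinearMap.comp_apply, AlgHom.toLinearMap_apply, map_one]
        exact permAction_one)
      (fun x y => by
        simp only [LinearMap.comp_apply, AlgHom.toLinearMap_apply, map_mul]
        exact permAction_mul (hl := hl) _ _ (hι.coefs_mem y))
    act_mul := fun h x y => by
      classical
      refine Eq.trans ?_ (mul_map_permAction (ι := ι) x y (hι.coalgebra.comul h)).symm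
      rw [hι.coefs₂_comul, Fintype.sum_prod_type]
      simp only [diagonal_apply, AlgHom.ofLinearMap_apply, LinearMap.comp_apply,
        AlgHom.toLinearMap_apply, permAction_apply]
      refine Finset.sum_congr rfl fun n _ => ?_
      rw [Fintype.sum_eq_single n, if_pos rfl, map_mul]
      · rfl
      · intro m hm
        rw [if_neg hm.symm, zero_mul]
    act_one := fun h => by
      refine Eq.trans ?_ (hι.algebraMap_counit h).symm
      simp [permAction_apply]
    galois := hι.galois_bijective hN }

theorem IsFixedModel.mem_range_iff {hl : IsNormalisedByLeft N} {A : Type*} [Ring A]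
    [Algebra K A] {ι : A →ₐ[K] MonoidAlgebra L N} (hι : IsFixedModel hl ι)
    (f : MonoidAlgebra L N) : f ∈ Set.range ι ↔
      ∀ (g : L ≃ₐ[K] L) (n n' : N),
        (n' : Equiv.Perm (L ≃ₐ[K] L)) = Equiv.mulLeft g * n * (Equiv.mulLeft g)⁻¹ →
          f.coeff n' = g (f.coeff n) := by
  rw [hι.mem_range, mem_fixed]
  constructor
  · intro h g n n' hn
    have : n' = conjPerm hl g n := Subtype.ext hn
    rw [this]
    exact h g n
  · intro h g n
    exact h g n _ rfl

theorem IsFixedModel.comul_eq {hl : IsNormalisedByLeft N} {A : Type*} [Ring A]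
    [Algebra K A] {ι : A →ₐ[K] MonoidAlgebra L N} (hι : IsFixedModel hl ι) (h : A) :
    Coalgebra.comul (R := L) (ι h) =
      TensorProduct.mapOfCompatibleSMul L K K (MonoidAlgebra L N) (MonoidAlgebra L N)
        (TensorProduct.map ι.toLinearMap ι.toLinearMap (hι.coalgebra.comul h)) := by
  classical
  apply evTensor_injective (isForm_coeffMap L N) (coeffMap_injective (K := L) N)
  funext s
  rw [evTensor_comul, evTensor_mapOfCompatibleSMul]
  refine Eq.trans ?_ (congrFun (hι.coefs₂_comul h) s).symm
  rw [diagonal_apply]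
  congr

theorem IsFixedModel.counit_eq {hl : IsNormalisedByLeft N} {A : Type*} [Ring A]
    [Algebra K A] {ι : A →ₐ[K] MonoidAlgebra L N} (hι : IsFixedModel hl ι) (h : A) :
    Coalgebra.counit (R := L) (ι h) = algebraMap K L (hι.coalgebra.counit h) := by
  let _ := Fintype.ofFinite N
  rw [counit_eq_sum]
  exact (hι.algebraMap_counit h).symm

theorem IsFixedModel.isFixedAlgebra {hl : IsNormalisedByLeft N} {A : Type v}
    [Ring A] [Algebra K A] {ι : A →ₐ[K] MonoidAlgebra L N} (hι : IsFixedModel hl ι)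
    (hN : IsRegularPerm N) : (hι.hopfGaloisStructure hN).IsFixedAlgebra N := by
  let _ := Fintype.ofFinite N
  have h5 : ∀ (h : A) (x : L), permAction K N (ι h) x =
      (ι h).coeff.sum fun n c => c * ((n : Equiv.Perm (L ≃ₐ[K] L))⁻¹ 1) x :=
    fun h x => permAction_eq_sum _ _
  exact ⟨ι, hι.injective, hι.mem_range_iff, hι.comul_eq, hι.counit_eq, h5⟩

theorem exists_isFixedAlgebra (hN : IsRegularPerm N) (hl : IsNormalisedByLeft N) :
    ∃ S : HopfGaloisStructure K L, S.IsFixedAlgebra N :=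
  ⟨_, (isFixedModel_val hl).isFixedAlgebra hN⟩

theorem isFixedModel_of_mem_range_iff {hl : IsNormalisedByLeft N} {A : Type*} [Ring A]
    [Algebra K A] {ι : A →ₐ[K] MonoidAlgebra L N} (hinj : Function.Injective ι)
    (h : ∀ f : MonoidAlgebra L N, f ∈ Set.range ι ↔
      ∀ (g : L ≃ₐ[K] L) (n n' : N),
        (n' : Equiv.Perm (L ≃ₐ[K] L)) = Equiv.mulLeft g * n * (Equiv.mulLeft g)⁻¹ →
          f.coeff n' = g (f.coeff n)) : IsFixedModel hl ι where
  injective := hinj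
  mem_range f := by
    rw [h, mem_fixed]
    constructor
    · intro h g n
      exact h g n _ rfl
    · intro h g n n' hn
      have : n' = conjPerm hl g n := Subtype.ext hn
      rw [this]
      exact h g n

end Existence

/-! ### The structure and the group of permutations determine each other. -/

section Uniqueness

variable {K : Type u} {L : Type v} [Field K] [Field L] [Algebra K L]
  {N : Subgroup (Equiv.Perm (L ≃ₐ[K] L))} [FiniteDimensional K L] [IsGalois K L]

/-- Since `coefs₂` is injective on a fixed model, this leaves no choice for the comultiplication
once `ι` is known. -/
theorem coefs₂_comul_of_eq {A : Type*} [Ring A] [HopfAlgebra K A]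
    {ι : A →ₐ[K] MonoidAlgebra L N}
    (h : ∀ h : A, Coalgebra.comul (R := L) (ι h) =
      TensorProduct.mapOfCompatibleSMul L K K (MonoidAlgebra L N) (MonoidAlgebra L N)
        (TensorProduct.map ι.toLinearMap ι.toLinearMap (Coalgebra.comul (R := K) h))) (x : A) :
    coefs₂ ι (Coalgebra.comul (R := K) x) = diagonal K L N (coefs ι x) := by
  classical
  funext s
  have h1 := congrFun (congrArg (evTensor (coeffMap L N) (coeffMap L N)) (h x)) s
  rw [evTensor_comul, evTensor_mapOfCompatibleSMul] at h1
  refine Eq.trans h1.symm ?_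
  rw [diagonal_apply]
  congr

/-- Hopf-Galois structures which are given by the same group of permutations are isomorphic. -/
theorem equiv_of_isFixedAlgebra (hl : IsNormalisedByLeft N) {S T : HopfGaloisStructure K L}
    (hS : S.IsFixedAlgebra N) (hT : T.IsFixedAlgebra N) : S ≈ T := by
  obtain ⟨ι, h1, h2, h3, h4, h5⟩ := hS
  obtain ⟨κ, k1, k2, k3, k4, k5⟩ := hT
  have hι : IsFixedModel hl ι := isFixedModel_of_mem_range_iff h1 h2
  have hκ : IsFixedModel hl κ := isFixedModel_of_mem_range_iff k1 k2
  have hr : ι.range = κ.range := by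
    ext f
    exact (h2 f).trans (k2 f).symm
  -- Both algebras embed in `L[N]` with the same range, so they are identified through it.
  let e : S.H ≃ₐ[K] T.H := (AlgEquiv.ofInjective ι h1).trans
    ((Subalgebra.equivOfEq _ _ hr).trans (AlgEquiv.ofInjective κ k1).symm)
  have he : ∀ x, κ (e x) = ι x := fun x =>
    congrArg Subtype.val ((AlgEquiv.ofInjective κ k1).apply_symm_apply
      (Subalgebra.equivOfEq _ _ hr (AlgEquiv.ofInjective ι h1 x)))
  refine ⟨BialgEquiv.ofAlgEquiv e ?_ ?_, ?_⟩
  · refine AlgHom.ext fun x => (algebraMap K L).injective ?_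
    change algebraMap K L (Coalgebra.counit (R := K) (e x)) =
      algebraMap K L (Coalgebra.counit (R := K) x)
    rw [← k4, ← h4, he]
  · refine AlgHom.ext fun x => hκ.coefs₂_injective ?_
    change coefs₂ κ (TensorProduct.map e.toLinearMap e.toLinearMap
      (Coalgebra.comul (R := K) x)) = coefs₂ κ (Coalgebra.comul (R := K) (e x))
    have hm : ∀ t, coefs₂ κ (TensorProduct.map e.toLinearMap e.toLinearMap t) = coefs₂ ι t := by
      intro t
      induction t with
      | zero => simp
      | tmul a b =>
        funext s
        rw [TensorProduct.map_tmul, coefs₂_tmul, coefs₂_tmul]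
        change (κ (e a)).coeff s.1 * (κ (e b)).coeff s.2 = _
        rw [he, he]
      | add a b ha hb => rw [map_add, map_add, map_add, ha, hb]
    rw [hm, coefs₂_comul_of_eq h3, coefs₂_comul_of_eq k3]
    have : coefs κ (e x) = coefs ι x := congrArg (coeffMap K N) (he x)
    rw [this]
  · intro x z
    change T.act (e x) z = _
    rw [h5, k5, he]

/-- Functionals which agree on the fixed functions are equal. -/
theorem linearMap_ext_fixed {X : Type*} [Finite X] (σ : (L ≃ₐ[K] L) →* Equiv.Perm X)
    {φ ψ : (X → L) →ₗ[L] L} (h : ∀ f ∈ fixed σ, φ f = ψ f) : φ = ψ := by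
  refine LinearMap.ext fun f => ?_
  have hf : f ∈ Submodule.span L (fixed σ : Set (X → L)) := by
    rw [span_fixed]
    trivial
  induction hf using Submodule.span_induction with
  | mem x hx => exact h x hx
  | zero => rw [map_zero, map_zero]
  | add x y _ _ hx hy => rw [map_add, map_add, hx, hy]
  | smul c x _ hx => rw [map_smul, map_smul, hx]

/-- A Hopf-Galois structure determines the group of permutations by which it is given. -/
theorem eq_of_isFixedAlgebra {N' : Subgroup (Equiv.Perm (L ≃ₐ[K] L))}
    (hN : IsRegularPerm N) (hl : IsNormalisedByLeft N)
    (hN' : IsRegularPerm N') {S T : HopfGaloisStructure K L}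
    (hST : S ≈ T) (hS : S.IsFixedAlgebra N) (hT : T.IsFixedAlgebra N') : N = N' := by
  classical
  let _ := Fintype.ofFinite N
  let _ := Fintype.ofFinite N'
  obtain ⟨ι, h1, h2, -, -, h5⟩ := hS
  obtain ⟨κ, -, -, -, -, k5⟩ := hT
  obtain ⟨e, he⟩ := hST
  have hι : IsFixedModel hl ι := isFixedModel_of_mem_range_iff h1 h2
  let u := Equiv.ofBijective _ ⟨permAut_injective hN, permAut_surjective hN⟩
  let u' := Equiv.ofBijective _ ⟨permAut_injective hN', permAut_surjective hN'⟩
  -- Pairs the permutations which give the same automorphism of `L`. The rest of the proof shows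
  -- that paired permutations are equal.
  let β : N ≃ N' := u.trans u'.symm
  have hβ : ∀ n, permAut (β n) = permAut n := fun n => u'.apply_symm_apply (u n)
  have hcoef : ∀ h n, (κ (e h)).coeff (β n) = (ι h).coeff n := by
    intro h n
    -- The elements `h` and `e h` act equally on `L`, and by Dedekind the action determines the
    -- coefficients.
    have h0 := eq_zero_of_sum_permAut hN
      (c := fun n => (κ (e h)).coeff (β n) - (ι h).coeff n) fun z => by
        have hz := he h z
        rw [h5, k5, ← permAction_eq_sum, ← permAction_eq_sum, permAction_apply,
          permAction_apply, ← Equiv.sum_comp β] at hz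
        simp only [hβ] at hz
        simp only [sub_mul, Finset.sum_sub_distrib, hz, sub_self]
    exact sub_eq_zero.mp (congrFun h0 n)
  -- Multiplicativity of `ι` and of `κ ∘ e` gives this for fixed `f` and `f'`. Both sides are
  -- `L`-bilinear and fixed functions span, so it holds for all functions, one argument at a time.
  have key : ∀ n (f f' : N → L), ∑ a, f a * f' (a⁻¹ * n) =
      ∑ a, f a * f' (β.symm ((β a)⁻¹ * β n)) := by
    intro n f f'
    have hA : ∀ f ∈ fixed (conjPerm hl), ∀ f' ∈ fixed (conjPerm hl),
        ∑ a, f a * f' (a⁻¹ * n) = ∑ a, f a * f' (β.symm ((β a)⁻¹ * β n)) := by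
      intro f hf f' hf'
      obtain ⟨x, rfl⟩ := hι.exists_coefs_eq hf
      obtain ⟨y, rfl⟩ := hι.exists_coefs_eq hf'
      have hxy := hcoef (x * y) n
      rw [map_mul, map_mul, map_mul, coeff_mul_eq_sum, coeff_mul_eq_sum,
        ← Equiv.sum_comp β] at hxy
      simp only [coefs_apply]
      rw [← hxy]
      refine Finset.sum_congr rfl fun a _ => ?_
      rw [hcoef, ← hcoef y, Equiv.apply_symm_apply]
    have hB : ∀ f ∈ fixed (conjPerm hl), ∀ f' : N → L,
        ∑ a, f a * f' (a⁻¹ * n) = ∑ a, f a * f' (β.symm ((β a)⁻¹ * β n)) := by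
      intro f hf f'
      have := linearMap_ext_fixed (conjPerm hl)
        (φ := ∑ a, f a • LinearMap.proj (a⁻¹ * n))
        (ψ := ∑ a, f a • LinearMap.proj (β.symm ((β a)⁻¹ * β n)))
        (fun f' hf' => by simpa [LinearMap.sum_apply] using hA f hf f' hf')
      simpa [LinearMap.sum_apply] using LinearMap.congr_fun this f'
    have := linearMap_ext_fixed (conjPerm hl)
      (φ := ∑ a, f' (a⁻¹ * n) • LinearMap.proj a)
      (ψ := ∑ a, f' (β.symm ((β a)⁻¹ * β n)) • LinearMap.proj a)
      (fun f hf => by simpa [LinearMap.sum_apply, mul_comm] using hB f hf f')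
    simpa [LinearMap.sum_apply, mul_comm] using LinearMap.congr_fun this f
  have hmul : ∀ a b, β (a * b) = β a * β b := by
    intro a b
    -- Delta functions at `a` and `b` read off the two multiplications: the left side is `1`.
    have h0 := key (a * b) (Pi.single a 1) (Pi.single b 1)
    rw [Fintype.sum_eq_single a (fun c hc => by rw [Pi.single_eq_of_ne hc, zero_mul]),
      Fintype.sum_eq_single a (fun c hc => by rw [Pi.single_eq_of_ne hc, zero_mul]),
      Pi.single_eq_same, one_mul, one_mul, inv_mul_cancel_left, Pi.single_eq_same] at h0
    have hb : β.symm ((β a)⁻¹ * β (a * b)) = b := by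
      by_contra hne
      rw [Pi.single_eq_of_ne hne] at h0
      exact one_ne_zero h0
    rw [Equiv.symm_apply_eq] at hb
    rw [← hb, mul_inv_cancel_left]
  let βm : N ≃* N' := { β with map_mul' := hmul }
  have hone : ∀ n : N, ((β n : N') : Equiv.Perm (L ≃ₐ[K] L)) 1 =
      (n : Equiv.Perm (L ≃ₐ[K] L)) 1 := by
    intro n
    have h0 := hβ n⁻¹
    have h6 : β n⁻¹ = (β n)⁻¹ := map_inv βm n
    rw [h6] at h0
    simpa [permAut] using h0
  have heq : ∀ n : N, ((β n : N') : Equiv.Perm (L ≃ₐ[K] L)) = n := by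
    intro n
    ext1 g
    -- With `g = m(1)`, agreement at `1` for `m` and for `nm` gives agreement of `n` and `β n` at
    -- `g`.
    obtain ⟨m, ⟨hm, rfl⟩, _⟩ := hN 1 g
    have h7 := hone (n * ⟨m, hm⟩)
    rw [hmul] at h7
    have h8 := hone ⟨m, hm⟩
    simp only [Subgroup.coe_mul, Equiv.Perm.mul_apply] at h7
    rw [h8] at h7
    exact h7
  ext n
  constructor
  · intro hn
    have := (β ⟨n, hn⟩).2
    rwa [heq] at this
  · intro hn
    have h9 := heq (β.symm ⟨n, hn⟩)
    rw [Equiv.apply_symm_apply] at h9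
    have := (β.symm ⟨n, hn⟩).2
    rw [← h9] at this
    exact this

/-- Hopf-Galois structures are counted by regular groups of permutations normalised by the left
translations. -/
theorem ncard_hopfGaloisClasses (K : Type u) (L : Type v) [Field K] [Field L] [Algebra K L]
    [FiniteDimensional K L] [IsGalois K L] (M : Type*) [Group M] (r : ℕ) :
    (hopfGaloisClasses K L M r).ncard =
      {N : Subgroup (Equiv.Perm (L ≃ₐ[K] L)) | ∃ (hN : IsRegularPerm N)
        (hl : IsNormalisedByLeft N), Nonempty (N ≃* M) ∧
          SkewBrace.thetaCard (PermBrace.Carrier N hN hl) = r}.ncard := by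
  symm
  refine Set.ncard_congr
    (fun N hN => Quotient.mk _ (exists_isFixedAlgebra hN.choose hN.choose_spec.choose).choose)
    ?_ ?_ ?_
  · intro N hN
    exact ⟨_, rfl, N, hN.choose, hN.choose_spec.choose,
      (exists_isFixedAlgebra hN.choose hN.choose_spec.choose).choose_spec,
      hN.choose_spec.choose_spec⟩
  · intro N N' hN hN' h
    exact eq_of_isFixedAlgebra hN.choose hN.choose_spec.choose hN'.choose
      (Quotient.exact h)
      (exists_isFixedAlgebra hN.choose hN.choose_spec.choose).choose_spec
      (exists_isFixedAlgebra hN'.choose hN'.choose_spec.choose).choose_spec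
  · rintro _ ⟨S, rfl, N, hN, hl, hS, hM⟩
    refine ⟨N, ⟨hN, hl, hM⟩, Quotient.sound ?_⟩
    exact equiv_of_isFixedAlgebra hl
      (exists_isFixedAlgebra hN hl).choose_spec hS

end Uniqueness

end GaloisDescent

/-! ### Automorphisms of the Heisenberg group -/

namespace Heis

variable {p : ℕ}

theorem mul_x (u v : Heis p) : (u * v).x = u.x + v.x + u.z * v.y := rfl
theorem mul_y (u v : Heis p) : (u * v).y = u.y + v.y := rfl
theorem mul_z (u v : Heis p) : (u * v).z = u.z + v.z := rfl
theorem one_y : (1 : Heis p).y = 0 := rfl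
theorem one_z : (1 : Heis p).z = 0 := rfl
theorem inv_x (u : Heis p) : (u⁻¹).x = -u.x + u.y * u.z := rfl
theorem inv_y (u : Heis p) : (u⁻¹).y = -u.y := rfl
theorem inv_z (u : Heis p) : (u⁻¹).z = -u.z := rfl

theorem rho_eq_commutator : rho p = tau p * sigma p * (sigma p * tau p)⁻¹ := by
  ext <;> simp [rho, tau, sigma, mul_def, inv_x, inv_y, inv_z]

variable [Fact p.Prime]

/-- The third generator `ρ` is a commutator of `τ` and `σ`. -/
theorem hom_ext {M : Type*} [Group M] {f g : Heis p →* M} (hσ : f (sigma p) = g (sigma p))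
    (hτ : f (tau p) = g (tau p)) : f = g := by
  have hρ : f (rho p) = g (rho p) := by
    simp only [rho_eq_commutator, map_mul, map_inv, hσ, hτ]
  ext v
  rw [normal_form v]
  simp only [map_mul, map_pow, hρ, hσ, hτ]

theorem aut_ext {f g : MulAut (Heis p)} (hσ : f (sigma p) = g (sigma p))
    (hτ : f (tau p) = g (tau p)) : f = g := by
  have := hom_ext (f := f.toMonoidHom) (g := g.toMonoidHom) hσ hτ
  exact MulEquiv.ext fun v => DFunLike.congr_fun this v

variable (hp : 3 < p)

theorem bracket_apply (A : GL (Fin 2) (ZMod p)) (b₁ b₂ : ZMod p) (v : Heis p) :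
    bracket hp A b₁ b₂ v =
      ⟨A.val.det * v.x + b₁ * v.y + 2⁻¹ * A.val 0 0 * A.val 1 0 * (v.y * (v.y - 1))
        + b₂ * v.z + 2⁻¹ * A.val 0 1 * A.val 1 1 * (v.z * (v.z - 1))
        + A.val 0 1 * A.val 1 0 * (v.y * v.z),
      A.val 0 0 * v.y + A.val 0 1 * v.z,
      A.val 1 0 * v.y + A.val 1 1 * v.z⟩ := rfl

/-- Every automorphism of the Heisenberg group is given by an invertible matrix and two further
parameters. -/
theorem exists_bracket (φ : MulAut (Heis p)) : ∃ A b₁ b₂, φ = bracket hp A b₁ b₂ := by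
  let M : Matrix (Fin 2) (Fin 2) (ZMod p) :=
    !![(φ (sigma p)).y, (φ (tau p)).y; (φ (sigma p)).z, (φ (tau p)).z]
  -- The commutator of the images of `τ` and `σ` is `ρ` to the determinant of their exponents.
  -- Injectivity of `φ` then makes this determinant nonzero.
  have hρ : φ (rho p) = ⟨M.det, 0, 0⟩ := by
    rw [rho_eq_commutator]
    simp only [map_mul, map_inv]
    ext
    · simp only [mul_x, mul_y, mul_z, inv_x, inv_y, M, Matrix.det_fin_two_of]
      ring
    · simp only [mul_y, inv_y]
      ring
    · simp only [mul_z, inv_z]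
      ring
  have hM : M.det ≠ 0 := by
    intro h0
    have h1 : φ (rho p) = φ 1 := by
      rw [hρ, h0, map_one]
      rfl
    have h2 := congrArg Heis.x (φ.injective h1)
    exact one_ne_zero h2
  refine ⟨Matrix.GeneralLinearGroup.mkOfDetNeZero M hM, (φ (sigma p)).x, (φ (tau p)).x, ?_⟩
  apply aut_ext
  · rw [bracket_sigma]
    rfl
  · rw [bracket_tau]
    rfl

theorem bracket_injective {A A' : GL (Fin 2) (ZMod p)} {b₁ b₂ b₁' b₂' : ZMod p}
    (h : bracket hp A b₁ b₂ = bracket hp A' b₁' b₂') : A = A' ∧ b₁ = b₁' ∧ b₂ = b₂' := by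
  have h1 := DFunLike.congr_fun h (sigma p)
  have h2 := DFunLike.congr_fun h (tau p)
  rw [bracket_sigma, bracket_sigma, Heis.mk.injEq] at h1
  rw [bracket_tau, bracket_tau, Heis.mk.injEq] at h2
  refine ⟨Units.ext (Matrix.ext fun i j => ?_), h1.1, h2.1⟩
  fin_cases i <;> fin_cases j
  · exact h1.2.1
  · exact h2.2.1
  · exact h1.2.2
  · exact h2.2.2

/-- The automorphisms of the Heisenberg group are parametrised by matrices and pairs. -/
noncomputable def bracketEquiv :
    GL (Fin 2) (ZMod p) × ZMod p × ZMod p ≃ MulAut (Heis p) :=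
  Equiv.ofBijective (fun d => bracket hp d.1 d.2.1 d.2.2)
    ⟨fun d d' h => by
      obtain ⟨h1, h2, h3⟩ := bracket_injective hp h
      exact Prod.ext h1 (Prod.ext h2 h3),
    fun φ => by
      obtain ⟨A, b₁, b₂, rfl⟩ := exists_bracket hp φ
      exact ⟨(A, b₁, b₂), rfl⟩⟩

theorem card_mulAut (hp : 3 < p) :
    Nat.card (MulAut (Heis p)) = (p ^ 2 - 1) * (p ^ 2 - p) * p ^ 2 := by
  rw [← Nat.card_congr (bracketEquiv hp), Nat.card_prod, Nat.card_prod, Matrix.card_GL_field]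
  simp [Fin.prod_univ_two, Nat.card_eq_fintype_card, ZMod.card, pow_two]

/-- The lower unitriangular matrix with entry `t`. -/
noncomputable def lowerGL (t : ZMod p) : GL (Fin 2) (ZMod p) :=
  Matrix.GeneralLinearGroup.mkOfDetNeZero !![1, 0; t, 1] (by simp)

theorem lowerGL_val (t : ZMod p) : (lowerGL t).val = !![1, 0; t, 1] := rfl

/-- The triples which parametrise a Sylow subgroup of the automorphism group. -/
@[ext]
structure Param (p : ℕ) where
  t : ZMod p
  r : ZMod p
  s : ZMod p

instance : Zero (Param p) := ⟨⟨0, 0, 0⟩⟩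

theorem Param.zero_def : (0 : Param p) = ⟨0, 0, 0⟩ := rfl

/-- The powers of the automorphism `σ ↦ ρ^r σ τ^t`, `τ ↦ ρ^s τ`. -/
noncomputable def unip (P : Param p) (k : ZMod p) : MulAut (Heis p) :=
  bracket hp (lowerGL (k * P.t)) (k * P.r + 2⁻¹ * (k * (k - 1)) * (P.t * P.s)) (k * P.s)

theorem unip_apply (P : Param p) (k : ZMod p) (v : Heis p) :
    unip hp P k v =
      ⟨v.x + (k * P.r + 2⁻¹ * (k * (k - 1)) * (P.t * P.s)) * v.y
        + 2⁻¹ * (k * P.t) * (v.y * (v.y - 1)) + k * P.s * v.z, v.y, k * P.t * v.y + v.z⟩ := by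
  rw [unip, bracket_apply, lowerGL_val]
  simp

theorem unip_apply_y (P : Param p) (k : ZMod p) (v : Heis p) : (unip hp P k v).y = v.y := by
  rw [unip_apply]

/-- The quadratic term in `unip` is a triangular number: the `i`-th power sends `σ` to `σ τ^{it}`
modulo `ρ`, and the next application adds `its` to the exponent of `ρ`. -/
theorem unip_add (P : Param p) (k l : ZMod p) :
    unip hp P (k + l) = unip hp P k * unip hp P l := by
  have h2 := two_ne_zero_of_lt hp
  ext v : 1
  rw [MulAut.mul_apply, unip_apply, unip_apply, unip_apply]
  ext
  · simp only
    field_simp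
    ring
  · simp only
  · simp only
    ring

theorem unip_zero (P : Param p) : unip hp P 0 = 1 := by
  ext v : 1
  rw [unip_apply]
  simp

theorem unip_natCast (P : Param p) (n : ℕ) : unip hp P n = unip hp P 1 ^ n := by
  induction n with
  | zero => simp [unip_zero]
  | succ n ih => rw [Nat.cast_succ, unip_add, ih, pow_succ]

theorem unip_eq_pow (P : Param p) (k : ZMod p) : unip hp P k = unip hp P 1 ^ k.val := by
  rw [← unip_natCast, ZMod.natCast_zmod_val]

theorem unip_sigma (P : Param p) (k : ZMod p) : unip hp P k (sigma p) =
    ⟨k * P.r + 2⁻¹ * (k * (k - 1)) * (P.t * P.s), 1, k * P.t⟩ := by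
  rw [unip_apply]
  simp [sigma]

theorem unip_tau (P : Param p) (k : ZMod p) : unip hp P k (tau p) = ⟨k * P.s, 0, 1⟩ := by
  rw [unip_apply]
  simp [tau]

theorem unip_eq_one {P : Param p} (hP : P ≠ 0) {k : ZMod p} (h : unip hp P k = 1) : k = 0 := by
  by_contra hk
  have h1 := DFunLike.congr_fun h (sigma p)
  have h2 := DFunLike.congr_fun h (tau p)
  rw [unip_sigma] at h1
  rw [unip_tau] at h2
  simp only [MulAut.one_apply, sigma, tau, Heis.mk.injEq] at h1 h2
  have ht : P.t = 0 := (mul_eq_zero.mp h1.2.2).resolve_left hk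
  have hs : P.s = 0 := (mul_eq_zero.mp h2.1).resolve_left hk
  have hr : P.r = 0 := by
    have := h1.1
    rw [ht, zero_mul, mul_zero, add_zero] at this
    exact (mul_eq_zero.mp this).resolve_left hk
  exact hP (Param.ext ht hr hs)

theorem unip_injective {P : Param p} (hP : P ≠ 0) : Function.Injective (unip hp P) := by
  intro k l h
  have h1 : unip hp P (k - l) = 1 := by
    have h2 := unip_add hp P (k - l) l
    rw [sub_add_cancel, h] at h2
    exact right_eq_mul.mp h2
  exact sub_eq_zero.mp (unip_eq_one hp hP h1)

/-- The condition on an automorphism of the additive group to be an isomorphism between the skew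
braces with parameters `P` and `Q`. -/
def Intertwines (P Q : Param p) (φ : MulAut (Heis p)) : Prop :=
  ∀ u v, φ (unip hp P u.y v) = unip hp Q (φ u).y (φ v)

/-- The automorphism must preserve `⟨ρ, τ⟩`, where the family of powers is trivial. Then `y` is
multiplied by `a = A 0 0`, and everything reduces to `φ ∘ unip P 1 = unip Q a ∘ φ`. The other three
equations compare the `τ`-exponent at `σ`, the `ρ`-exponent at `τ` and the `ρ`-exponent at `σ`. -/
theorem intertwines_bracket_iff {P Q : Param p} (hQ : Q ≠ 0)
    (A : GL (Fin 2) (ZMod p)) (b₁ b₂ : ZMod p) :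
    Intertwines hp P Q (bracket hp A b₁ b₂) ↔
      A.val 0 1 = 0 ∧ A.val 1 1 * P.t = A.val 0 0 ^ 2 * Q.t ∧ P.s = Q.s ∧
        A.val 0 0 * A.val 1 1 * P.r + b₂ * P.t = A.val 0 0 ^ 2 * Q.r +
          2⁻¹ * (A.val 0 0 ^ 2 * (A.val 0 0 - 1)) * (Q.t * (Q.s + 1)) +
          A.val 0 0 * A.val 1 0 * Q.s := by
  have h2 := two_ne_zero_of_lt hp
  have hdet : A.val.det ≠ 0 := ((Matrix.isUnit_iff_isUnit_det _).mp A.isUnit).ne_zero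
  rw [Matrix.det_fin_two] at hdet
  constructor
  · intro h
    have h01 : A.val 0 1 = 0 := by
      -- As `τ` has `y = 0`, its power on the `P` side is the identity. Since `Q ≠ 0`, its image
      -- must have `y = 0` too.
      have h1 : unip hp Q (bracket hp A b₁ b₂ (tau p)).y = 1 := by
        ext v : 1
        obtain ⟨v, rfl⟩ := (bracket hp A b₁ b₂).surjective v
        rw [← h]
        simp [tau, unip_zero]
      have h3 := unip_eq_one hp hQ h1
      rwa [bracket_tau] at h3
    rw [h01, zero_mul, sub_zero] at hdet
    have ha : A.val 0 0 ≠ 0 := left_ne_zero_of_mul hdet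
    have hs := h (sigma p) (sigma p)
    have ht := h (sigma p) (tau p)
    rw [bracket_sigma] at hs ht
    rw [bracket_tau] at ht
    rw [bracket_apply, unip_sigma, unip_apply] at hs
    rw [bracket_apply, unip_tau, unip_apply] at ht
    simp only [Heis.mk.injEq, sigma, h01, Matrix.det_fin_two] at hs ht
    obtain ⟨hs1, -, hs3⟩ := hs
    obtain ⟨ht1, -, -⟩ := ht
    refine ⟨h01, ?_, ?_, ?_⟩
    · linear_combination hs3
    · refine mul_left_cancel₀ hdet ?_
      linear_combination ht1
    · field_simp at hs1 ⊢
      linear_combination hs1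
  · rintro ⟨h01, h11, hs, hr⟩
    rw [h01, zero_mul, sub_zero] at hdet
    have key : bracket hp A b₁ b₂ * unip hp P 1 =
        unip hp Q (A.val 0 0) * bracket hp A b₁ b₂ := by
      apply aut_ext
      · rw [MulAut.mul_apply, MulAut.mul_apply, unip_sigma, bracket_sigma, bracket_apply,
          unip_apply]
        simp only [Heis.mk.injEq, h01, Matrix.det_fin_two]
        refine ⟨?_, ?_, ?_⟩
        · field_simp at hr ⊢
          linear_combination hr
        · ring
        · linear_combination h11
      · rw [MulAut.mul_apply, MulAut.mul_apply, unip_tau, bracket_tau, bracket_apply,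
          unip_apply]
        simp only [Heis.mk.injEq, h01, Matrix.det_fin_two]
        refine ⟨?_, ?_, ?_⟩
        · rw [hs]
          ring
        · ring
        · ring
    have key2 : ∀ n : ℕ, bracket hp A b₁ b₂ * unip hp P 1 ^ n =
        unip hp Q (A.val 0 0 * n) * bracket hp A b₁ b₂ := by
      intro n
      induction n with
      | zero => simp [unip_zero]
      | succ n ih =>
        rw [pow_succ, ← mul_assoc, ih, mul_assoc, key, ← mul_assoc, ← unip_add, Nat.cast_succ,
          mul_add, mul_one]
    intro u v
    have h3 := DFunLike.congr_fun (key2 u.y.val) v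
    rw [← unip_natCast, ZMod.natCast_zmod_val, MulAut.mul_apply, MulAut.mul_apply] at h3
    have hy : (bracket hp A b₁ b₂ u).y = A.val 0 0 * u.y := by
      rw [bracket_apply]
      simp only
      rw [h01, zero_mul, add_zero]
    rw [h3, hy]

end Heis

/-! ### Skew braces with parameters -/

namespace Heis

variable {p : ℕ} [Fact p.Prime] (hp : 3 < p)

/-- An identification of a skew brace with the Heisenberg group, under which the multiplication is
given by the powers of a unipotent automorphism. -/
structure Chart (B : Type*) [SkewBrace B] (P : Param p) extends B ≃ Heis p where
  map_add' : ∀ b c, toFun (b + c) = toFun b * toFun c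
  map_mul' : ∀ b c, toFun (b * c) = toFun b * unip hp P (toFun b).y (toFun c)

variable {hp}

namespace Chart

variable {B C : Type*} [SkewBrace B] [SkewBrace C] {P Q : Param p}

theorem map_add (e : Chart hp B P) (b c : B) :
    e.toEquiv (b + c) = e.toEquiv b * e.toEquiv c := e.map_add' b c

theorem map_mul (e : Chart hp B P) (b c : B) :
    e.toEquiv (b * c) = e.toEquiv b * unip hp P (e.toEquiv b).y (e.toEquiv c) := e.map_mul' b c

theorem symm_mul (e : Chart hp B P) (u v : Heis p) :
    e.toEquiv.symm (u * v) = e.toEquiv.symm u + e.toEquiv.symm v := by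
  apply e.toEquiv.injective
  simp [e.map_add]

/-- The chart as an isomorphism of the additive group. -/
def addEquiv (e : Chart hp B P) : B ≃+ Additive (Heis p) where
  toEquiv := e.toEquiv.trans Additive.ofMul
  map_add' := e.map_add

theorem map_neg (e : Chart hp B P) (b : B) : e.toEquiv (-b) = (e.toEquiv b)⁻¹ :=
  e.addEquiv.map_neg b

theorem map_lam (e : Chart hp B P) (b c : B) :
    e.toEquiv (SkewBrace.lam b c) = unip hp P (e.toEquiv b).y (e.toEquiv c) := by
  change e.toEquiv (-b + b * c) = _
  rw [e.map_add, e.map_neg, e.map_mul, inv_mul_cancel_left]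

/-- An isomorphism of skew braces gives an automorphism of the Heisenberg group. -/
def autOfIso (e : Chart hp B P) (e' : Chart hp C Q) (f : SkewBraceIso B C) : MulAut (Heis p) where
  toEquiv := (e.toEquiv.symm.trans f.toEquiv).trans e'.toEquiv
  map_mul' u v := by
    have h := f.map_add' (e.toEquiv.symm u) (e.toEquiv.symm v)
    change e'.toEquiv (f.toEquiv (e.toEquiv.symm (u * v))) = _
    rw [symm_mul]
    exact (congrArg e'.toEquiv h).trans (e'.map_add _ _)

theorem autOfIso_apply (e : Chart hp B P) (e' : Chart hp C Q) (f : SkewBraceIso B C) (b : B) :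
    e.autOfIso e' f (e.toEquiv b) = e'.toEquiv (f.toEquiv b) := by
  change e'.toEquiv (f.toEquiv (e.toEquiv.symm (e.toEquiv b))) = _
  rw [Equiv.symm_apply_apply]

theorem intertwines_autOfIso (e : Chart hp B P) (e' : Chart hp C Q) (f : SkewBraceIso B C) :
    Intertwines hp P Q (e.autOfIso e' f) := by
  intro u v
  obtain ⟨b, rfl⟩ := e.toEquiv.surjective u
  obtain ⟨c, rfl⟩ := e.toEquiv.surjective v
  have h1 : e'.toEquiv (f.toEquiv (b * c)) =
      e'.toEquiv (f.toEquiv b * f.toEquiv c) := congrArg e'.toEquiv (f.map_mul' b c)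
  rw [e'.map_mul, ← autOfIso_apply e e' f, ← autOfIso_apply e e' f, ← autOfIso_apply e e' f,
    e.map_mul, _root_.map_mul] at h1
  exact mul_left_cancel h1

/-- An automorphism of the Heisenberg group which intertwines the parameters gives an
isomorphism of skew braces. -/
def isoOfAut (e : Chart hp B P) (e' : Chart hp C Q) (φ : MulAut (Heis p))
    (hφ : Intertwines hp P Q φ) : SkewBraceIso B C where
  toEquiv := (e.toEquiv.trans φ.toEquiv).trans e'.toEquiv.symm
  map_add' b c := by
    change e'.toEquiv.symm (φ (e.toEquiv (b + c))) =
      e'.toEquiv.symm (φ (e.toEquiv b)) + e'.toEquiv.symm (φ (e.toEquiv c))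
    rw [e.map_add, _root_.map_mul, symm_mul]
  map_mul' b c := by
    change e'.toEquiv.symm (φ (e.toEquiv (b * c))) =
      e'.toEquiv.symm (φ (e.toEquiv b)) * e'.toEquiv.symm (φ (e.toEquiv c))
    apply e'.toEquiv.injective
    rw [e'.map_mul, Equiv.apply_symm_apply, Equiv.apply_symm_apply, Equiv.apply_symm_apply,
      e.map_mul, _root_.map_mul, hφ]

theorem autOfIso_isoOfAut (e : Chart hp B P) (e' : Chart hp C Q) (φ : MulAut (Heis p))
    (hφ : Intertwines hp P Q φ) : e.autOfIso e' (e.isoOfAut e' φ hφ) = φ := by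
  ext1 u
  obtain ⟨b, rfl⟩ := e.toEquiv.surjective u
  rw [autOfIso_apply]
  exact e'.toEquiv.apply_symm_apply _

theorem nonempty_iso_iff (e : Chart hp B P) (e' : Chart hp C Q) :
    Nonempty (SkewBraceIso B C) ↔ ∃ φ, Intertwines hp P Q φ :=
  ⟨fun ⟨f⟩ => ⟨_, e.intertwines_autOfIso e' f⟩, fun ⟨φ, hφ⟩ => ⟨e.isoOfAut e' φ hφ⟩⟩

/-- A chart of the target of an isomorphism gives one of the source. -/
def comp (e' : Chart hp C P) (f : SkewBraceIso B C) : Chart hp B P where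
  toEquiv := f.toEquiv.trans e'.toEquiv
  map_add' b c := (congrArg e'.toEquiv (f.map_add' b c)).trans (e'.map_add _ _)
  map_mul' b c := (congrArg e'.toEquiv (f.map_mul' b c)).trans (e'.map_mul _ _)

/-- The map `λ_b` depends only on the `y`-coordinate of `b`, and the powers of a nontrivial `unip`
are distinct. -/
theorem thetaCard_eq (e : Chart hp B P) (hP : P ≠ 0) : SkewBrace.thetaCard B = p := by
  let g : ZMod p → (B ≃+ B) := fun k => SkewBrace.lam (e.toEquiv.symm ⟨0, k, 0⟩)
  have hg : ∀ k c, e.toEquiv (g k c) = unip hp P k (e.toEquiv c) := fun k c => by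
    rw [e.map_lam, Equiv.apply_symm_apply]
  have hinj : Function.Injective g := by
    intro k l hkl
    apply unip_injective hp hP
    ext1 v
    obtain ⟨c, rfl⟩ := e.toEquiv.surjective v
    rw [← hg, ← hg, hkl]
  have hrange : Set.range (SkewBrace.lam : B → (B ≃+ B)) = Set.range g := by
    ext f
    constructor
    · rintro ⟨b, rfl⟩
      refine ⟨(e.toEquiv b).y, AddEquiv.ext fun c => e.toEquiv.injective ?_⟩
      rw [hg, e.map_lam]
    · rintro ⟨k, rfl⟩
      exact ⟨_, rfl⟩
  rw [SkewBrace.thetaCard, hrange, Nat.card_range_of_injective hinj, Nat.card_zmod]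

end Chart

/-! ### The multiplicative group -/

section MulGroup

variable (hp) (P : Param p)

/-- The multiplication of the skew brace with parameters `P`. -/
theorem circ_eq (u v : Heis p) : u * unip hp P u.y v =
    ⟨u.x + (v.x + (u.y * P.r + 2⁻¹ * (u.y * (u.y - 1)) * (P.t * P.s)) * v.y
        + 2⁻¹ * (u.y * P.t) * (v.y * (v.y - 1)) + u.y * P.s * v.z) + u.z * v.y,
      u.y + v.y, u.z + (u.y * P.t * v.y + v.z)⟩ := by
  rw [unip_apply]
  rfl

/-- The coordinate which straightens the third component. -/
def straightZ (u : Heis p) : ZMod p := u.z - 2⁻¹ * P.t * u.y ^ 2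

/-- The coordinate which straightens the first component. -/
def straightX (u : Heis p) : ZMod p :=
  u.x - P.s * u.y * straightZ P u - 6⁻¹ * (P.t * (1 + P.s)) * u.y ^ 3
    - 2⁻¹ * (P.r - 2⁻¹ * (P.t * (1 + P.s))) * u.y ^ 2

/-- The third coordinate of a product has the extra term `t y y'`, which is the coboundary of `t y²
/ 2`. -/
theorem straightZ_circ (u v : Heis p) :
    straightZ P (u * unip hp P u.y v) = straightZ P u + straightZ P v := by
  have h2 := two_ne_zero_of_lt hp
  rw [circ_eq]
  simp only [straightZ]
  field_simp
  ring

theorem six_ne_zero_of_lt (hp : 3 < p) : (6 : ZMod p) ≠ 0 := by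
  have h3 : (3 : ZMod p) ≠ 0 := by
    intro h
    have h3 : ((3 : ℕ) : ZMod p) = 0 := by exact_mod_cast h
    rw [ZMod.natCast_eq_zero_iff] at h3
    have := Nat.le_of_dvd (by norm_num) h3
    omega
  have h6 : (6 : ZMod p) = 2 * 3 := by norm_num
  rw [h6]
  exact mul_ne_zero (two_ne_zero_of_lt hp) h3

/-- The polynomial corrections absorb all coboundary terms, leaving the cocycle `(1 - s) z y`. Hence
`s = 1` is exactly the abelian case. The cubic correction is the place where `6` must be invertible.
-/
theorem straightX_circ (u v : Heis p) :
    straightX P (u * unip hp P u.y v) =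
      straightX P u + straightX P v + (1 - P.s) * straightZ P u * v.y := by
  have h2 := two_ne_zero_of_lt hp
  have h6 := six_ne_zero_of_lt hp
  rw [circ_eq]
  simp only [straightX, straightZ]
  field_simp
  ring

/-- The multiplicative group of a skew brace whose parameter `s` is not `1` is a Heisenberg
group. -/
def heisEquiv (hs : P.s ≠ 1) : Heis p ≃ Heis p where
  toFun u := ⟨(1 - P.s)⁻¹ * straightX P u, u.y, straightZ P u⟩
  invFun w :=
    ⟨(1 - P.s) * w.x + P.s * w.y * w.z + 6⁻¹ * (P.t * (1 + P.s)) * w.y ^ 3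
      + 2⁻¹ * (P.r - 2⁻¹ * (P.t * (1 + P.s))) * w.y ^ 2, w.y, w.z + 2⁻¹ * P.t * w.y ^ 2⟩
  left_inv u := by
    have h : 1 - P.s ≠ 0 := sub_ne_zero.mpr (Ne.symm hs)
    ext
    · simp only [mul_inv_cancel_left₀ h]
      simp only [straightX]
      ring
    · rfl
    · simp [straightZ]
  right_inv w := by
    have h : 1 - P.s ≠ 0 := sub_ne_zero.mpr (Ne.symm hs)
    ext
    · simp only [straightX, straightZ]
      rw [inv_mul_eq_iff_eq_mul₀ h]
      ring
    · rfl
    · simp [straightZ]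

theorem heisEquiv_circ (hs : P.s ≠ 1) (u v : Heis p) :
    heisEquiv P hs (u * unip hp P u.y v) = heisEquiv P hs u * heisEquiv P hs v := by
  have h : 1 - P.s ≠ 0 := sub_ne_zero.mpr (Ne.symm hs)
  ext
  · change (1 - P.s)⁻¹ * straightX P _ = (1 - P.s)⁻¹ * straightX P u +
      (1 - P.s)⁻¹ * straightX P v + straightZ P u * v.y
    rw [straightX_circ]
    field_simp
  · change _ = u.y + v.y
    rw [circ_eq]
    rfl
  · exact straightZ_circ hp P u v

/-- The multiplicative group of a skew brace whose parameter `s` is `1` is elementary abelian. -/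
def elemAbEquiv : Heis p ≃ ElemAb p where
  toFun u := Multiplicative.ofAdd ![straightX P u, u.y, straightZ P u]
  invFun w :=
    ⟨w.toAdd 0 + P.s * w.toAdd 1 * w.toAdd 2 + 6⁻¹ * (P.t * (1 + P.s)) * w.toAdd 1 ^ 3
      + 2⁻¹ * (P.r - 2⁻¹ * (P.t * (1 + P.s))) * w.toAdd 1 ^ 2, w.toAdd 1,
      w.toAdd 2 + 2⁻¹ * P.t * w.toAdd 1 ^ 2⟩
  left_inv u := by
    ext
    · simp only [straightX, toAdd_ofAdd, Matrix.cons_val]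
      ring
    · rfl
    · simp [straightZ]
  right_inv w := by
    apply Multiplicative.toAdd.injective
    funext i
    fin_cases i
    · simp only [straightX, straightZ, toAdd_ofAdd]
      simp
      ring
    · rfl
    · simp [straightZ]

theorem elemAbEquiv_circ (hs : P.s = 1) (u v : Heis p) :
    elemAbEquiv P (u * unip hp P u.y v) = elemAbEquiv P u * elemAbEquiv P v := by
  apply Multiplicative.toAdd.injective
  funext i
  fin_cases i
  · change straightX P _ = straightX P u + straightX P v
    rw [straightX_circ, hs]
    ring
  · change _ = u.y + v.y
    rw [circ_eq]
    rfl
  · exact straightZ_circ hp P u v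

variable {hp P} {B : Type*} [SkewBrace B]

theorem Chart.isSkewBraceOfType_heis (e : Chart hp B P) (hs : P.s ≠ 1) :
    IsSkewBraceOfType B (Heis p) (Heis p) :=
  ⟨⟨{ toEquiv := e.toEquiv.trans (heisEquiv P hs)
      map_mul' := fun b c => (congrArg (heisEquiv P hs) (e.map_mul b c)).trans
        (heisEquiv_circ hp P hs _ _) }⟩, ⟨e.addEquiv⟩⟩

theorem Chart.isSkewBraceOfType_elemAb (e : Chart hp B P) (hs : P.s = 1) :
    IsSkewBraceOfType B (ElemAb p) (Heis p) :=
  ⟨⟨{ toEquiv := e.toEquiv.trans (elemAbEquiv P)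
      map_mul' := fun b c => (congrArg (elemAbEquiv P) (e.map_mul b c)).trans
        (elemAbEquiv_circ hp P hs _ _) }⟩, ⟨e.addEquiv⟩⟩

end MulGroup

theorem not_nonempty_heis_mulEquiv_elemAb : ¬ Nonempty (Heis p ≃* ElemAb p) := by
  rintro ⟨f⟩
  have h : tau p * sigma p = sigma p * tau p := by
    apply f.injective
    rw [map_mul, map_mul, mul_comm]
  have h1 := congrArg Heis.x h
  simp [mul_x, tau, sigma] at h1

end Heis

/-! ### The regular subgroups of the holomorph -/

namespace Heis

variable {p : ℕ} [Fact p.Prime] (hp : 3 < p)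

theorem alpha1_eq : alpha1 hp = unip hp ⟨0, 1, 0⟩ 1 := by
  apply aut_ext
  · rw [alpha1, bracket_sigma, unip_sigma]
    simp
  · rw [alpha1, bracket_tau, unip_tau]
    simp

theorem alpha2_eq : alpha2 hp = unip hp ⟨1, 0, 0⟩ 1 := by
  apply aut_ext
  · rw [alpha2, bracket_sigma, unip_sigma]
    simp [Matrix.GeneralLinearGroup.mkOfDetNeZero]
  · rw [alpha2, bracket_tau, unip_tau]
    simp [Matrix.GeneralLinearGroup.mkOfDetNeZero]

theorem alpha3_eq : alpha3 hp = unip hp ⟨0, 0, 1⟩ 1 := by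
  apply aut_ext
  · rw [alpha3, bracket_sigma, unip_sigma]
    simp
  · rw [alpha3, bracket_tau, unip_tau]
    simp

/-- The parameters given by the exponents of `α₁`, `α₂`, `α₃`. -/
def paramOf (p : ℕ) (i : ℕ × ℕ × ℕ) : Param p := ⟨i.2.1, i.1, i.2.2⟩

/-- In this order no mixed term arises: `α₃` fixes `σ`, while `α₁` and `α₂` fix `ρ` and `τ`. -/
theorem alpha_prod_eq (i : ℕ × ℕ × ℕ) :
    alpha1 hp ^ i.1 * alpha2 hp ^ i.2.1 * alpha3 hp ^ i.2.2 = unip hp (paramOf p i) 1 := by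
  rw [alpha1_eq, alpha2_eq, alpha3_eq, ← unip_natCast, ← unip_natCast, ← unip_natCast]
  apply aut_ext
  · rw [MulAut.mul_apply, MulAut.mul_apply, unip_sigma, unip_apply, unip_apply, unip_sigma]
    simp [paramOf]
  · rw [MulAut.mul_apply, MulAut.mul_apply, unip_tau, unip_apply, unip_apply, unip_tau]
    simp [paramOf]

/-- The elements of the holomorph whose second component is given by the first one. -/
noncomputable def graphSubgroup (P : Param p) : Subgroup (Hol (Heis p)) where
  carrier := {g | g.right = unip hp P g.left.y}
  one_mem' := by
    change (1 : MulAut (Heis p)) = unip hp P 0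
    rw [unip_zero]
  mul_mem' {g h} hg hh := by
    change g.right * h.right = unip hp P (g.left * g.right h.left).y
    rw [hg, hh, mul_y, unip_apply_y, unip_add]
  inv_mem' {g} hg := by
    change (g⁻¹).right = unip hp P (g⁻¹).left.y
    have h1 : (g⁻¹).right = unip hp P (-g.left.y) := by
      rw [SemidirectProduct.inv_right, hg, inv_eq_iff_mul_eq_one, ← unip_add, add_neg_cancel,
        unip_zero]
    have h2 : (g⁻¹).left = (g⁻¹).right (g.left⁻¹) := rfl
    rw [h2, h1, unip_apply_y, inv_y]

theorem mem_graphSubgroup {P : Param p} {g : Hol (Heis p)} :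
    g ∈ graphSubgroup hp P ↔ g.right = unip hp P g.left.y := Iff.rfl

/-- The generators lie in the graph. Conversely, dividing by powers of the third generator brings
the `y`-coordinate to `0`, where the graph consists of the elements `ρ^x τ^z`. -/
theorem holSubgroup_eq (i : ℕ × ℕ × ℕ) :
    holSubgroup hp i = graphSubgroup hp (paramOf p i) := by
  apply le_antisymm
  · rw [holSubgroup, Subgroup.closure_le]
    rintro g (rfl | rfl | rfl)
    · change (1 : MulAut (Heis p)) = unip hp _ 0
      rw [unip_zero]
    · change (1 : MulAut (Heis p)) = unip hp _ 0
      rw [unip_zero]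
    · rw [alpha_prod_eq]
      change 1 * unip hp _ 1 = unip hp _ (sigma p * 1).y
      rw [one_mul, mul_one]
      rfl
  · intro g hg
    have hρ : SemidirectProduct.inl (rho p) ∈ holSubgroup hp i :=
      Subgroup.subset_closure (Or.inl rfl)
    have hτ : SemidirectProduct.inl (tau p) ∈ holSubgroup hp i :=
      Subgroup.subset_closure (Or.inr (Or.inl rfl))
    have hσ : SemidirectProduct.inl (sigma p) *
        SemidirectProduct.inr (unip hp (paramOf p i) 1) ∈ holSubgroup hp i := by
      rw [← alpha_prod_eq]
      exact Subgroup.subset_closure (Or.inr (Or.inr rfl))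
    have key : ∀ n : ℕ, ∀ g ∈ graphSubgroup hp (paramOf p i), g.left.y = n →
        g ∈ holSubgroup hp i := by
      intro n
      induction n with
      | zero =>
        intro g hg hy
        rw [mem_graphSubgroup, hy, Nat.cast_zero, unip_zero] at hg
        have h1 : g = SemidirectProduct.inl (rho p) ^ g.left.x.val *
            SemidirectProduct.inl (tau p) ^ g.left.z.val := by
          rw [← map_pow, ← map_pow, ← map_mul]
          refine SemidirectProduct.ext ?_ hg
          rw [SemidirectProduct.left_inl, rho_pow, tau_pow, mul_def]
          ext
          · simp
          · simpa using hy
          · simp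
        rw [h1]
        exact mul_mem (pow_mem hρ _) (pow_mem hτ _)
      | succ n ih =>
        intro g hg hy
        have hw : SemidirectProduct.inl (sigma p) *
            SemidirectProduct.inr (unip hp (paramOf p i) 1) ∈
              graphSubgroup hp (paramOf p i) := by
          rw [mem_graphSubgroup]
          change 1 * unip hp _ 1 = unip hp _ (sigma p * 1).y
          rw [one_mul, mul_one]
          rfl
        have h1 := ih _ (mul_mem hg (inv_mem hw)) (by
          rw [SemidirectProduct.mul_left, mul_y]
          change g.left.y + (g.right _).y = _
          rw [(mem_graphSubgroup hp).mp hg, unip_apply_y, hy]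
          have h2 : (SemidirectProduct.inl (sigma p) * SemidirectProduct.inr
              (unip hp (paramOf p i) 1) : Hol (Heis p))⁻¹.left =
                (unip hp (paramOf p i) (-1)) (sigma p)⁻¹ := by
            have h3 : unip hp (paramOf p i) (-1) = (unip hp (paramOf p i) 1)⁻¹ := by
              rw [eq_inv_iff_mul_eq_one, ← unip_add, neg_add_cancel, unip_zero]
            rw [h3]
            simp [SemidirectProduct.inv_left]
          rw [h2, unip_apply_y, inv_y]
          simp [sigma])
        have h4 := mul_mem h1 hσ
        rwa [inv_mul_cancel_right] at h4
    exact key g.left.y.val g hg (ZMod.natCast_zmod_val _).symm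

/-- All the automorphisms involved preserve `y`, so an element taking `x` to `y` has `y`-coordinate
`y.y - x.y`. This fixes its second component, and then its first. -/
theorem isRegular_graphSubgroup (P : Param p) : Hol.IsRegular (graphSubgroup hp P) := by
  intro x y
  refine ⟨⟨y * (unip hp P (y.y - x.y) x)⁻¹, unip hp P (y.y - x.y)⟩, ⟨?_, ?_⟩, ?_⟩
  · rw [mem_graphSubgroup]
    change unip hp P (y.y - x.y) = unip hp P (y.y + -(unip hp P (y.y - x.y) x).y)
    rw [unip_apply_y, sub_eq_add_neg]
  · exact inv_mul_cancel_right _ _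
  · rintro g ⟨hg, rfl⟩
    rw [mem_graphSubgroup] at hg
    have h1 : (Hol.act g x).y = g.left.y + x.y := by
      rw [Hol.act, mul_y, hg, unip_apply_y]
    have h2 : (Hol.act g x).y - x.y = g.left.y := by rw [h1, add_sub_cancel_right]
    rw [h2, ← hg]
    ext1
    · exact (mul_inv_cancel_right _ _).symm
    · rfl

theorem isRegular_holSubgroup (i : ℕ × ℕ × ℕ) : Hol.IsRegular (holSubgroup hp i) := by
  rw [holSubgroup_eq]
  exact isRegular_graphSubgroup hp _

theorem psi_apply {N : Type*} [Group N] {H : Subgroup (Hol N)} (hH : Hol.IsRegular H) (b : H) :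
    Hol.Brace.psi H hH b = (b : Hol N).left := by
  change (b : Hol N).left * (b : Hol N).right 1 = _
  rw [map_one, mul_one]

theorem psi_mul {N : Type*} [Group N] {H : Subgroup (Hol N)} (hH : Hol.IsRegular H) (b c : H) :
    Hol.Brace.psi H hH (b * c : H) =
      Hol.Brace.psi H hH b * (b : Hol N).right (Hol.Brace.psi H hH c) := by
  rw [psi_apply, psi_apply, psi_apply]
  rfl

/-- The chart of the skew brace given by a regular subgroup. -/
noncomputable def braceChart (i : ℕ × ℕ × ℕ) (h : Hol.IsRegular (holSubgroup hp i)) :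
    Chart hp (Hol.Brace _ h) (paramOf p i) where
  toEquiv := Hol.Brace.psi _ h
  map_add' := Hol.Brace.psi_add _ h
  map_mul' := fun (b c : holSubgroup hp i) => by
    have hb : (b : Hol (Heis p)).right = unip hp (paramOf p i) (b : Hol (Heis p)).left.y := by
      rw [← mem_graphSubgroup, ← holSubgroup_eq]
      exact b.2
    have h1 := psi_mul h b c
    rw [hb, ← psi_apply h b] at h1
    exact h1

theorem autHom_injective {N : Type*} [Group N] (H : Subgroup (Hol N)) (hH : Hol.IsRegular H) :
    Function.Injective (Hol.Brace.autHom H hH) := by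
  intro f g h
  apply SkewBraceIso.toEquiv_injective
  ext1 b
  have h1 := DFunLike.congr_fun h (Hol.Brace.psi H hH b)
  change Hol.Brace.psi H hH (f.toEquiv ((Hol.Brace.psi H hH).symm (Hol.Brace.psi H hH b))) =
    Hol.Brace.psi H hH (g.toEquiv ((Hol.Brace.psi H hH).symm (Hol.Brace.psi H hH b))) at h1
  rw [Equiv.symm_apply_apply] at h1
  exact (Hol.Brace.psi H hH).injective h1

theorem range_autHom (i : ℕ × ℕ × ℕ) (h : Hol.IsRegular (holSubgroup hp i)) :
    Set.range (Hol.Brace.autHom _ h) =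
      {φ | Intertwines hp (paramOf p i) (paramOf p i) φ} := by
  have heq : ∀ f, Hol.Brace.autHom _ h f = (braceChart hp i h).autOfIso (braceChart hp i h) f :=
    fun f => rfl
  ext φ
  constructor
  · rintro ⟨f, rfl⟩
    rw [heq]
    exact Chart.intertwines_autOfIso _ _ f
  · intro hφ
    exact ⟨(braceChart hp i h).isoOfAut (braceChart hp i h) φ hφ, by
      rw [heq, Chart.autOfIso_isoOfAut]⟩

theorem paramOf_ne_zero {i : ℕ × ℕ × ℕ} (hi : i ∈ exponentsM p ∪ exponentsC) :
    paramOf p i ≠ 0 := by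
  have h1 : ((1 : ℕ) : ZMod p) ≠ 0 := by simp
  intro h0
  have ht := congrArg Param.t h0
  have hr := congrArg Param.r h0
  have hs := congrArg Param.s h0
  simp only [paramOf, Param.zero_def] at ht hr hs
  rcases hi with (rfl | rfl | ⟨c, hc2, hcp, rfl | rfl⟩) | (rfl | rfl)
  · exact h1 hr
  · exact h1 ht
  · rw [ZMod.natCast_eq_zero_iff] at hs
    have := Nat.le_of_dvd (by dsimp only; omega) hs
    dsimp only at this
    omega
  · exact h1 ht
  · exact h1 hs
  · exact h1 hs

theorem natCast_inj_of_lt {a b : ℕ} (ha : a < p) (hb : b < p)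
    (h : (a : ZMod p) = b) : a = b := by
  rwa [ZMod.natCast_eq_natCast_iff', Nat.mod_eq_of_lt ha, Nat.mod_eq_of_lt hb] at h

theorem exponents_lt {i : ℕ × ℕ × ℕ} (hp : 3 < p) (hi : i ∈ exponentsM p ∪ exponentsC) :
    i.1 < p ∧ i.2.1 < p ∧ i.2.2 < p := by
  rcases hi with (rfl | rfl | ⟨c, hc2, hcp, rfl | rfl⟩) | (rfl | rfl) <;>
    refine ⟨?_, ?_, ?_⟩ <;> dsimp only <;> omega

theorem paramOf_s_of_mem_exponentsC {i : ℕ × ℕ × ℕ} (hi : i ∈ exponentsC) :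
    (paramOf p i).s = 1 := by
  rcases hi with rfl | rfl <;> simp [paramOf]

theorem paramOf_s_of_mem_exponentsM (hp : 3 < p) {i : ℕ × ℕ × ℕ} (hi : i ∈ exponentsM p) :
    (paramOf p i).s ≠ 1 := by
  intro h
  have h1 : i.2.2 = 1 := natCast_inj_of_lt (exponents_lt hp (Or.inl hi)).2.2 (by omega)
    (by rw [Nat.cast_one]; exact h)
  rcases hi with rfl | rfl | ⟨c, hc2, hcp, rfl | rfl⟩
  · exact zero_ne_one h1
  · exact zero_ne_one h1
  · dsimp only at h1; omega
  · dsimp only at h1; omega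

/-- Different exponents in the list give parameters which are not intertwined. -/
theorem eq_of_intertwines {i j : ℕ × ℕ × ℕ} (hi : i ∈ exponentsM p ∪ exponentsC)
    (hj : j ∈ exponentsM p ∪ exponentsC) {φ : MulAut (Heis p)}
    (hφ : Intertwines hp (paramOf p i) (paramOf p j) φ) : i = j := by
  obtain ⟨A, b₁, b₂, rfl⟩ := exists_bracket hp φ
  rw [intertwines_bracket_iff hp (paramOf_ne_zero hj)] at hφ
  obtain ⟨h01, h11, hs, -⟩ := hφ
  have hdet : A.val.det ≠ 0 := ((Matrix.isUnit_iff_isUnit_det _).mp A.isUnit).ne_zero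
  rw [Matrix.det_fin_two, h01, zero_mul, sub_zero] at hdet
  have ha := left_ne_zero_of_mul hdet
  have hd := right_ne_zero_of_mul hdet
  have li := exponents_lt hp hi
  have lj := exponents_lt hp hj
  -- The parameter `s` and the vanishing of `t` already separate the entries of the list.
  have h3 : i.2.2 = j.2.2 := natCast_inj_of_lt li.2.2 lj.2.2 hs
  have h2 : i.2.1 = 0 ↔ j.2.1 = 0 := by
    have e1 : i.2.1 = 0 ↔ (i.2.1 : ZMod p) = 0 :=
      ⟨fun h => by simp [h], fun h => natCast_inj_of_lt li.2.1 (by omega) (by simpa using h)⟩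
    have e2 : j.2.1 = 0 ↔ (j.2.1 : ZMod p) = 0 :=
      ⟨fun h => by simp [h], fun h => natCast_inj_of_lt lj.2.1 (by omega) (by simpa using h)⟩
    simp only [paramOf] at h11
    rw [e1, e2]
    constructor
    · intro h
      rw [h, mul_zero] at h11
      exact (mul_eq_zero.mp h11.symm).resolve_left (pow_ne_zero 2 ha)
    · intro h
      rw [h, mul_zero] at h11
      exact (mul_eq_zero.mp h11).resolve_left hd
  rcases hi with (rfl | rfl | ⟨c, hc2, hcp, rfl | rfl⟩) | (rfl | rfl) <;>
    rcases hj with (rfl | rfl | ⟨c', hc2', hcp', rfl | rfl⟩) | (rfl | rfl) <;>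
    simp only at h2 h3 <;>
    first
    | rfl
    | (exfalso; omega)
    | (subst h3; rfl)
    | (exfalso; simp at h2)

/-- All parameters are intertwined with those in the list. -/
theorem exists_intertwines {P : Param p} (hP : P ≠ 0) :
    ∃ i ∈ exponentsM p ∪ exponentsC, ∃ φ, Intertwines hp P (paramOf p i) φ := by
  obtain ⟨t, r, s⟩ := P
  have hmem0 : s ≠ 0 → ((0, 0, s.val) : ℕ × ℕ × ℕ) ∈ exponentsM p ∪ exponentsC := by
    intro hs
    have h0 : s.val ≠ 0 := by rwa [Ne, ZMod.val_eq_zero]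
    rcases eq_or_ne s.val 1 with h1 | h1
    · rw [h1]
      exact Or.inr (Or.inl rfl)
    · exact Or.inl (Or.inr (Or.inr ⟨s.val, by omega, ZMod.val_lt s, Or.inl rfl⟩))
  have hmem1 : ((0, 1, s.val) : ℕ × ℕ × ℕ) ∈ exponentsM p ∪ exponentsC := by
    rcases Nat.lt_or_ge s.val 2 with h2 | h2
    · rcases Nat.lt_or_ge s.val 1 with h1 | h1
      · have : s.val = 0 := by omega
        rw [this]
        exact Or.inl (Or.inr (Or.inl rfl))
      · have : s.val = 1 := by omega
        rw [this]
        exact Or.inr (Or.inr rfl)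
    · exact Or.inl (Or.inr (Or.inr ⟨s.val, h2, ZMod.val_lt s, Or.inr rfl⟩))
  by_cases ht : t = 0
  · by_cases hs : s = 0
    · have hr : r ≠ 0 := by
        rintro rfl
        exact hP (Param.ext ht rfl hs)
      have hi : ((1, 0, 0) : ℕ × ℕ × ℕ) ∈ exponentsM p ∪ exponentsC := Or.inl (Or.inl rfl)
      -- The lower diagonal entry `r⁻¹` scales `r` to `1`.
      refine ⟨(1, 0, 0), hi, bracket hp (Matrix.GeneralLinearGroup.mkOfDetNeZero
        !![1, 0; 0, r⁻¹] (by simp [hr])) 0 0, ?_⟩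
      rw [intertwines_bracket_iff hp (paramOf_ne_zero hi)]
      simp [Matrix.GeneralLinearGroup.mkOfDetNeZero, paramOf, ht, hs, hr]
    -- The lower left entry contributes `(r / s) s`, which cancels `r`.
    · refine ⟨(0, 0, s.val), hmem0 hs, bracket hp (Matrix.GeneralLinearGroup.mkOfDetNeZero
        !![1, 0; r / s, 1] (by simp)) 0 0, ?_⟩
      rw [intertwines_bracket_iff hp (paramOf_ne_zero (hmem0 hs))]
      simp [Matrix.GeneralLinearGroup.mkOfDetNeZero, paramOf, ht, hs]
  -- The entry `t⁻¹` scales `t` to `1`, and `b₂` is the solution of `t⁻¹ r + b₂ t = 0`, which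
  -- removes `r`.
  · refine ⟨(0, 1, s.val), hmem1, bracket hp (Matrix.GeneralLinearGroup.mkOfDetNeZero
      !![1, 0; 0, t⁻¹] (by simp [ht])) 0 (-(t⁻¹ * r) * t⁻¹), ?_⟩
    rw [intertwines_bracket_iff hp (paramOf_ne_zero hmem1)]
    simp [Matrix.GeneralLinearGroup.mkOfDetNeZero, paramOf, ht]

end Heis

/-! ### Existence of charts -/

namespace Heis

variable {p : ℕ} [Fact p.Prime]

theorem card_heis : Nat.card (Heis p) = p ^ 3 := by
  let e : Heis p ≃ ZMod p × ZMod p × ZMod p :=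
    { toFun := fun v => (v.x, v.y, v.z)
      invFun := fun w => ⟨w.1, w.2.1, w.2.2⟩
      left_inv := fun _ => rfl
      right_inv := fun _ => rfl }
  rw [Nat.card_congr e, Nat.card_prod, Nat.card_prod, Nat.card_zmod]
  ring

/-- The homomorphism `v ↦ a v.y + b v.z`. -/
def linHom (a b : ZMod p) : Heis p →* Multiplicative (ZMod p) where
  toFun v := Multiplicative.ofAdd (a * v.y + b * v.z)
  map_one' := by simp [one_y, one_z]
  map_mul' u v := by
    rw [← ofAdd_add, mul_y, mul_z]
    congr 1
    ring

/-- A subgroup of index `p` of the Heisenberg group is mapped to the subgroup `⟨ρ, τ⟩` by some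
automorphism. -/
theorem exists_aut_of_index_eq (hp : 3 < p) {H : Subgroup (Heis p)} (hH : H.index = p) :
    ∃ φ : MulAut (Heis p), ∀ v, v ∈ H ↔ (φ v).y = 0 := by
  have hpr : p.Prime := Fact.out
  -- The index is the least prime factor of the order. The quotient is then cyclic of order `p`, and
  -- the subgroup is the kernel of a linear form `a y + b z`.
  have hn : H.Normal := by
    apply Subgroup.normal_of_index_eq_minFac_card
    rw [hH, card_heis, hpr.pow_minFac (by norm_num)]
  have hq : Nat.card (Heis p ⧸ H) = p := hH
  have hz : Nat.card (Multiplicative (ZMod p)) = p := Nat.card_zmod p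
  let e : Heis p ⧸ H ≃* Multiplicative (ZMod p) := mulEquivOfPrimeCardEq hq hz
  let f : Heis p →* Multiplicative (ZMod p) := e.toMonoidHom.comp (QuotientGroup.mk' H)
  have hker : ∀ v, v ∈ H ↔ f v = 1 := fun v => by
    change _ ↔ e (QuotientGroup.mk' H v) = 1
    rw [map_eq_one_iff e e.injective]
    exact (QuotientGroup.eq_one_iff v).symm
  obtain ⟨a, ha⟩ : ∃ a, Multiplicative.ofAdd a = f (sigma p) := ⟨_, rfl⟩
  obtain ⟨b, hb⟩ : ∃ b, Multiplicative.ofAdd b = f (tau p) := ⟨_, rfl⟩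
  have hf : f = linHom a b := by
    apply hom_ext
    · rw [← ha]
      simp [linHom, sigma]
    · rw [← hb]
      simp [linHom, tau]
  have hmem : ∀ v, v ∈ H ↔ a * v.y + b * v.z = 0 := fun v => by
    rw [hker, hf]
    exact ofAdd_eq_one
  by_cases h0 : a = 0
  · have hb0 : b ≠ 0 := by
      intro hb0
      have htop : H = ⊤ := by
        ext v
        simp [hmem, h0, hb0]
      rw [htop, Subgroup.index_top] at hH
      exact hpr.one_lt.ne hH
    -- The first row makes the form `a y + b z` the new `y`-coordinate; the second row only has to
    -- keep the matrix invertible.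
    refine ⟨bracket hp (Matrix.GeneralLinearGroup.mkOfDetNeZero !![a, b; 1, 0]
      (by simp [hb0])) 0 0, fun v => ?_⟩
    rw [hmem, bracket_apply]
    simp [Matrix.GeneralLinearGroup.mkOfDetNeZero]
  · refine ⟨bracket hp (Matrix.GeneralLinearGroup.mkOfDetNeZero !![a, b; 0, 1]
      (by simp [h0])) 0 0, fun v => ?_⟩
    rw [hmem, bracket_apply]
    simp [Matrix.GeneralLinearGroup.mkOfDetNeZero]

/-! ### Gamma functions: kernel, fibres and image. -/

section Gamma

variable {N : Type*} [Group N] {γ : N → MulAut N}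
  (hγ : ∀ u v, γ (u * γ u v) = γ u * γ v)

theorem gamma_one (hγ : ∀ u v, γ (u * γ u v) = γ u * γ v) : γ 1 = 1 := by
  have h := hγ 1 1
  rw [map_one, one_mul] at h
  exact left_eq_mul.mp h

theorem gamma_mul_of_eq_one (hγ : ∀ u v, γ (u * γ u v) = γ u * γ v) {u : N} (hu : γ u = 1)
    (v : N) : γ (u * v) = γ v := by
  have h := hγ u v
  rwa [hu, MulAut.one_apply, one_mul] at h

/-- The argument `(γ u)⁻¹ u⁻¹` is the inverse of `u` for the operation `u ∘ v = u · γ_u(v)`. -/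
theorem gamma_mul_inv (hγ : ∀ u v, γ (u * γ u v) = γ u * γ v) (u : N) :
    γ u * γ ((γ u)⁻¹ u⁻¹) = 1 := by
  have h := hγ u ((γ u)⁻¹ u⁻¹)
  rwa [MulAut.apply_inv_self, mul_inv_cancel, gamma_one hγ, eq_comm] at h

/-- If `γ_u = γ_v`, then `u v⁻¹` is the product, for the operation `∘`, of `u` with the inverse of
`v`. So the fibres of `γ` are the right cosets of its kernel. -/
theorem gamma_eq_iff (hγ : ∀ u v, γ (u * γ u v) = γ u * γ v) {u v : N} :
    γ u = γ v ↔ γ (u * v⁻¹) = 1 := by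
  constructor
  · intro h
    have h1 := hγ u ((γ v)⁻¹ v⁻¹)
    rwa [h, MulAut.apply_inv_self, gamma_mul_inv hγ] at h1
  · intro h
    have h1 := gamma_mul_of_eq_one hγ h v
    rwa [inv_mul_cancel_right] at h1

/-- The kernel of a gamma function. -/
def gammaKer (γ : N → MulAut N) (hγ : ∀ u v, γ (u * γ u v) = γ u * γ v) : Subgroup N where
  carrier := {u | γ u = 1}
  one_mem' := gamma_one hγ
  mul_mem' {u v} hu hv := (gamma_mul_of_eq_one hγ hu v).trans hv
  inv_mem' {u} hu := by
    have h := gamma_mul_of_eq_one hγ hu u⁻¹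
    rw [mul_inv_cancel, gamma_one hγ] at h
    exact h.symm

theorem mem_gammaKer {u : N} : u ∈ gammaKer γ hγ ↔ γ u = 1 := Iff.rfl

/-- The image of a gamma function. -/
def gammaRange (γ : N → MulAut N) (hγ : ∀ u v, γ (u * γ u v) = γ u * γ v) :
    Subgroup (MulAut N) where
  carrier := Set.range γ
  one_mem' := ⟨1, gamma_one hγ⟩
  mul_mem' := by
    rintro _ _ ⟨u, rfl⟩ ⟨v, rfl⟩
    exact ⟨_, hγ u v⟩
  inv_mem' := by
    rintro _ ⟨u, rfl⟩
    exact ⟨_, (inv_eq_of_mul_eq_one_right (gamma_mul_inv hγ u)).symm⟩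

/-- The fibres of `γ` are right cosets and the quotient consists of left cosets, hence the inverses
in the bijection. -/
theorem index_gammaKer : (gammaKer γ hγ).index = Nat.card (Set.range γ) := by
  refine Nat.card_congr (Equiv.ofBijective (Quotient.lift
    (fun u => (⟨γ u⁻¹, u⁻¹, rfl⟩ : Set.range γ)) ?_) ⟨?_, ?_⟩)
  · intro u v h
    rw [← Quotient.eq_iff_equiv, Quotient.eq, QuotientGroup.leftRel_apply,
      mem_gammaKer] at h
    apply Subtype.ext
    change γ u⁻¹ = γ v⁻¹
    rwa [gamma_eq_iff hγ, inv_inv]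
  · intro a b
    induction a using Quotient.inductionOn with
    | h u =>
    induction b using Quotient.inductionOn with
    | h v =>
    intro h
    have h1 : γ u⁻¹ = γ v⁻¹ := congrArg Subtype.val h
    rw [gamma_eq_iff hγ, inv_inv] at h1
    rw [Quotient.eq, QuotientGroup.leftRel_apply]
    exact h1
  · rintro ⟨_, u, rfl⟩
    refine ⟨Quotient.mk _ u⁻¹, Subtype.ext ?_⟩
    change γ (u⁻¹)⁻¹ = γ u
    rw [inv_inv]

end Gamma

variable (hp : 3 < p)

theorem pow_apply_y {φ : MulAut (Heis p)} {a : ZMod p} (h : ∀ v, (φ v).y = a * v.y) (n : ℕ)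
    (v : Heis p) : ((φ ^ n) v).y = a ^ n * v.y := by
  induction n with
  | zero => simp
  | succ n ih => rw [pow_succ', MulAut.mul_apply, h, ih, pow_succ', mul_assoc]

theorem pow_apply_z {φ : MulAut (Heis p)} {a d : ZMod p} (h : ∀ v, (φ v).y = a * v.y)
    (hz : ∀ v, v.y = 0 → (φ v).z = d * v.z) (n : ℕ)
    {v : Heis p} (hv : v.y = 0) : ((φ ^ n) v).z = d ^ n * v.z := by
  induction n with
  | zero => simp
  | succ n ih =>
    rw [pow_succ', MulAut.mul_apply, hz _ (by rw [pow_apply_y h, hv, mul_zero]), ih, pow_succ',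
      mul_assoc]

/-- An automorphism of order dividing `p` which preserves `⟨ρ, τ⟩` is unipotent. -/
theorem exists_eq_unip {φ : MulAut (Heis p)} (hφ : φ ^ p = 1) (h : (φ (tau p)).y = 0) :
    ∃ P : Param p, φ = unip hp P 1 := by
  obtain ⟨A, b₁, b₂, rfl⟩ := exists_bracket hp φ
  rw [bracket_tau] at h
  have hy : ∀ v, (bracket hp A b₁ b₂ v).y = A.val 0 0 * v.y := fun v => by
    rw [bracket_apply]
    simp only
    rw [show A.val 0 1 = 0 from h, zero_mul, add_zero]
  have hz : ∀ v : Heis p, v.y = 0 → (bracket hp A b₁ b₂ v).z = A.val 1 1 * v.z := fun v hv => by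
    rw [bracket_apply]
    simp only
    rw [hv, mul_zero, zero_add]
  -- On the quotient by `⟨ρ, τ⟩` the automorphism multiplies by this entry, so its `p`-th power is
  -- `1`; in `ZMod p` the `p`-th power of an element is the element itself.
  have h00 : A.val 0 0 = 1 := by
    have h1 := pow_apply_y hy p (sigma p)
    rw [hφ, MulAut.one_apply, ZMod.pow_card] at h1
    simpa [sigma] using h1.symm
  have h11 : A.val 1 1 = 1 := by
    have h1 := pow_apply_z hy hz p (v := tau p) rfl
    rw [hφ, MulAut.one_apply, ZMod.pow_card] at h1
    simpa [tau] using h1.symm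
  refine ⟨⟨A.val 1 0, b₁, b₂⟩, ?_⟩
  apply aut_ext
  · rw [bracket_sigma, unip_sigma, h00]
    simp
  · rw [bracket_tau, unip_tau, h11]
    simpa using h

/-- Fibres of `γ` are the levels of `y`, so `γ` is determined by its values at `σ^n`. The value at
`σ` is unipotent and preserves `y`, and the gamma identity makes the others its powers. -/
theorem gamma_eq_unip {γ : Heis p → MulAut (Heis p)}
    (hγ : ∀ u v, γ (u * γ u v) = γ u * γ v) (hpow : ∀ u, γ u ^ p = 1)
    (hker : ∀ v, γ v = 1 ↔ v.y = 0) : ∃ P : Param p, P ≠ 0 ∧ ∀ u, γ u = unip hp P u.y := by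
  have heq : ∀ u v, γ u = γ v ↔ u.y = v.y := fun u v => by
    rw [gamma_eq_iff hγ, hker, mul_y, inv_y, ← sub_eq_add_neg, sub_eq_zero]
  have hτ : ∀ u, (γ u (tau p)).y = 0 := by
    intro u
    have h1 := hγ u (tau p)
    -- As `τ` is in the kernel, `u · γ_u(τ)` has the same image under `γ` as `u`, hence the same
    -- `y`.
    rw [(hker (tau p)).mpr rfl, mul_one, heq, mul_y] at h1
    exact left_eq_add.mp h1.symm
  obtain ⟨P, hP⟩ := exists_eq_unip hp (hpow (sigma p)) (hτ (sigma p))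
  have key : ∀ n : ℕ, γ ⟨0, n, 0⟩ = unip hp P n := by
    intro n
    induction n with
    | zero =>
      rw [Nat.cast_zero, unip_zero]
      exact (hker _).mpr rfl
    | succ n ih =>
      have h1 := hγ (sigma p) ⟨0, n, 0⟩
      rw [ih, hP, ← unip_add] at h1
      rw [Nat.cast_succ, add_comm, ← h1, heq, mul_y, unip_apply_y]
      rfl
  refine ⟨P, ?_, fun u => ?_⟩
  · rintro rfl
    have h1 : γ (sigma p) = 1 := by
      rw [hP]
      ext1 v
      rw [unip_apply]
      simp [Param.zero_def]
    exact one_ne_zero ((hker _).mp h1)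
  · have h1 := key u.y.val
    rw [ZMod.natCast_zmod_val] at h1
    rw [← h1, heq]

/-- The image of `γ` is a group of order `p`, so its elements satisfy `γ_u^p = 1`, and the kernel
has index `p`. Conjugating `γ` by an automorphism which moves the kernel to `⟨ρ, τ⟩` reduces to
`gamma_eq_unip`. -/
theorem exists_gamma_eq_unip {γ : Heis p → MulAut (Heis p)}
    (hγ : ∀ u v, γ (u * γ u v) = γ u * γ v) (hc : Nat.card (Set.range γ) = p) :
    ∃ (φ : MulAut (Heis p)) (P : Param p), P ≠ 0 ∧
      ∀ u v, φ (γ u v) = unip hp P (φ u).y (φ v) := by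
  have hpow : ∀ u, γ u ^ p = 1 := by
    intro u
    have h1 : Nat.card (gammaRange γ hγ) = p := hc
    have h2 := pow_card_eq_one' (x := (⟨γ u, u, rfl⟩ : gammaRange γ hγ))
    rw [h1] at h2
    exact congrArg Subtype.val h2
  obtain ⟨φ, hφ⟩ := exists_aut_of_index_eq hp ((index_gammaKer hγ).trans hc)
  let γ' : Heis p → MulAut (Heis p) := fun v => φ * γ (φ⁻¹ v) * φ⁻¹
  have h1 : ∀ u v, γ' (u * γ' u v) = γ' u * γ' v := by
    intro u v
    simp only [γ', MulAut.mul_apply, map_mul, MulAut.inv_apply_self, hγ]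
    group
  obtain ⟨P, hP, h2⟩ := gamma_eq_unip hp h1 (fun u => by
    simp only [γ']
    rw [conj_pow, hpow, mul_one, mul_inv_cancel]) (fun v => by
    simp only [γ']
    rw [mul_inv_eq_one, mul_eq_left, ← mem_gammaKer hγ, hφ, MulAut.apply_inv_self])
  refine ⟨φ, P, hP, fun u v => ?_⟩
  rw [← h2]
  simp [γ', MulAut.mul_apply]

theorem lam_mul {B : Type*} [SkewBrace B] (a b c : B) :
    SkewBrace.lam (a * b) c = SkewBrace.lam a (SkewBrace.lam b c) :=
  SkewBrace.lam_mul_aux a b c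

theorem mul_eq_add_lam {B : Type*} [SkewBrace B] (a b : B) :
    a * b = a + SkewBrace.lam a b := (add_neg_cancel_left a (a * b)).symm

/-- A skew brace of Heisenberg type with `|Θ| = p` has a chart. -/
theorem exists_chart {B : Type*} [SkewBrace B] (e : B ≃+ Additive (Heis p))
    (hB : SkewBrace.thetaCard B = p) : ∃ P : Param p, P ≠ 0 ∧ Nonempty (Chart hp B P) := by
  let E : B ≃ Heis p := e.toEquiv.trans Additive.toMul
  have hadd : ∀ b c, E (b + c) = E b * E c := fun b c => congrArg Additive.toMul (map_add e b c)
  have hsymm : ∀ u v, E.symm (u * v) = E.symm u + E.symm v := fun u v => by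
    apply E.injective
    rw [hadd, E.apply_symm_apply, E.apply_symm_apply, E.apply_symm_apply]
  -- The function `λ`, transported to the Heisenberg group.
  let γ : Heis p → MulAut (Heis p) := fun u =>
    { toEquiv := (E.symm.trans (SkewBrace.lam (E.symm u)).toEquiv).trans E
      map_mul' := fun v w => by
        change E (SkewBrace.lam (E.symm u) (E.symm (v * w))) = _
        rw [hsymm, map_add, hadd]
        rfl }
  have hγ_apply : ∀ u v, γ u v = E (SkewBrace.lam (E.symm u) (E.symm v)) := fun _ _ => rfl
  have hγ : ∀ u v, γ (u * γ u v) = γ u * γ v := by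
    intro u v
    ext1 w
    rw [MulAut.mul_apply]
    simp only [hγ_apply]
    rw [hsymm, E.symm_apply_apply, E.symm_apply_apply, ← mul_eq_add_lam, lam_mul]
  have hc : Nat.card (Set.range γ) = p := by
    refine Eq.trans ?_ hB
    rw [SkewBrace.thetaCard]
    let T : (B ≃+ B) → MulAut (Heis p) := fun f =>
      { toEquiv := (E.symm.trans f.toEquiv).trans E
        map_mul' := fun v w => by
          change E (f (E.symm (v * w))) = _
          rw [hsymm, map_add, hadd]
          rfl }
    have hT : Function.Injective T := by
      intro f g h
      ext b
      have h1 := DFunLike.congr_fun h (E b)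
      change E (f (E.symm (E b))) = E (g (E.symm (E b))) at h1
      rw [E.symm_apply_apply] at h1
      exact E.injective h1
    have hr : Set.range γ = T '' Set.range (SkewBrace.lam : B → (B ≃+ B)) := by
      ext f
      constructor
      · rintro ⟨u, rfl⟩
        exact ⟨_, ⟨E.symm u, rfl⟩, rfl⟩
      · rintro ⟨_, ⟨b, rfl⟩, rfl⟩
        refine ⟨E b, ?_⟩
        ext1 v
        rw [hγ_apply, E.symm_apply_apply]
        rfl
    rw [hr, Nat.card_image_of_injective hT]
  obtain ⟨φ, P, hP, h⟩ := exists_gamma_eq_unip hp hγ hc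
  refine ⟨P, hP, ⟨{ toEquiv := E.trans φ.toEquiv, map_add' := ?_, map_mul' := ?_ }⟩⟩
  · intro b c
    change φ (E (b + c)) = φ (E b) * φ (E c)
    rw [hadd, map_mul]
  · intro b c
    change φ (E (b * c)) = φ (E b) * unip hp P (φ (E b)).y (φ (E c))
    rw [← h, ← map_mul, hγ_apply, E.symm_apply_apply, E.symm_apply_apply, ← hadd,
      ← mul_eq_add_lam]

end Heis

/-! ### Automorphism groups -/

namespace Heis

variable {p : ℕ} [Fact p.Prime] (hp : 3 < p)

theorem alpha_mul_alphaGL (r₁ r₃ : ZMod p) (A : GL (Fin 2) (ZMod p)) :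
    alpha1 hp ^ r₁.val * alpha3 hp ^ r₃.val * alphaGL hp A =
      bracket hp A (A.val 0 0 * A.val 1 0 / 2 + r₁ * A.val 0 0 + r₃ * A.val 1 0)
        (A.val 0 1 * A.val 1 1 / 2 + r₁ * A.val 0 1 + r₃ * A.val 1 1) := by
  rw [alpha1_eq, alpha3_eq, ← unip_eq_pow, ← unip_eq_pow, alphaGL]
  apply aut_ext
  · rw [MulAut.mul_apply, MulAut.mul_apply, bracket_sigma, bracket_sigma, unip_apply, unip_apply]
    ext <;> simp
    ring
  · rw [MulAut.mul_apply, MulAut.mul_apply, bracket_tau, bracket_tau, unip_apply, unip_apply]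
    ext <;> simp
    ring

/-- The lower triangular matrix with diagonal entries `a`, `d`. -/
noncomputable def lowTri (a d : (ZMod p)ˣ) (c : ZMod p) : GL (Fin 2) (ZMod p) :=
  Matrix.GeneralLinearGroup.mkOfDetNeZero !![(a : ZMod p), 0; c, d] (by simp)

theorem lowTri_val (a d : (ZMod p)ˣ) (c : ZMod p) : (lowTri a d c).val = !![(a : ZMod p), 0; c, d] :=
  rfl

theorem exists_eq_lowTri {A : GL (Fin 2) (ZMod p)} (h : A.val 0 1 = 0) :
    ∃ a d c, A = lowTri a d c := by
  have hdet : A.val.det ≠ 0 := ((Matrix.isUnit_iff_isUnit_det _).mp A.isUnit).ne_zero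
  rw [Matrix.det_fin_two, h, zero_mul, sub_zero] at hdet
  refine ⟨Units.mk0 _ (left_ne_zero_of_mul hdet), Units.mk0 _ (right_ne_zero_of_mul hdet),
    A.val 1 0, Units.ext (Matrix.ext fun i j => ?_)⟩
  fin_cases i <;> fin_cases j
  · rfl
  · exact h
  · rfl
  · rfl

theorem lowTri_injective {a d a' d' : (ZMod p)ˣ} {c c' : ZMod p}
    (h : lowTri a d c = lowTri a' d' c') : a = a' ∧ d = d' ∧ c = c' := by
  have h1 := congrArg Units.val h
  rw [lowTri_val, lowTri_val] at h1
  refine ⟨Units.ext (congrFun (congrFun h1 0) 0), Units.ext (congrFun (congrFun h1 1) 1),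
    congrFun (congrFun h1 1) 0⟩

theorem intertwines_lowTri_iff {P : Param p} (hP : P ≠ 0) (a d : (ZMod p)ˣ) (c b₁ b₂ : ZMod p) :
    Intertwines hp P P (bracket hp (lowTri a d c) b₁ b₂) ↔
      (d : ZMod p) * P.t = a ^ 2 * P.t ∧
        a * d * P.r + b₂ * P.t = a ^ 2 * P.r +
          2⁻¹ * (a ^ 2 * (a - 1)) * (P.t * (P.s + 1)) + a * c * P.s := by
  rw [intertwines_bracket_iff hp hP, lowTri_val]
  simp

theorem intertwines_iff_exists {P : Param p} (hP : P ≠ 0) {φ : MulAut (Heis p)} :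
    Intertwines hp P P φ ↔ ∃ (a d : (ZMod p)ˣ) (c b₁ b₂ : ZMod p),
      φ = bracket hp (lowTri a d c) b₁ b₂ ∧ (d : ZMod p) * P.t = a ^ 2 * P.t ∧
        a * d * P.r + b₂ * P.t = a ^ 2 * P.r +
          2⁻¹ * (a ^ 2 * (a - 1)) * (P.t * (P.s + 1)) + a * c * P.s := by
  constructor
  · intro h
    obtain ⟨A, b₁, b₂, rfl⟩ := exists_bracket hp φ
    obtain ⟨a, d, c, rfl⟩ := exists_eq_lowTri ((intertwines_bracket_iff hp hP _ _ _).mp h).1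
    exact ⟨a, d, c, b₁, b₂, rfl, (intertwines_lowTri_iff hp hP _ _ _ _ _).mp h⟩
  · rintro ⟨a, d, c, b₁, b₂, rfl, h⟩
    exact (intertwines_lowTri_iff hp hP _ _ _ _ _).mpr h

/-- For a lower triangular matrix the second parameter of the product is `r₃ d`, so `r₃ = b₂ / d`.
The first parameter is then solved for `r₁`, on which it depends with coefficient `a ≠ 0`. -/
theorem bracket_lowTri_eq (a d : (ZMod p)ˣ) (c b₁ b₂ : ZMod p) :
    ∃ r₁ : ZMod p, bracket hp (lowTri a d c) b₁ b₂ =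
      alpha1 hp ^ r₁.val * alpha3 hp ^ (b₂ * (d : ZMod p)⁻¹).val * alphaGL hp (lowTri a d c) := by
  refine ⟨(b₁ - a * c / 2 - b₂ * (d : ZMod p)⁻¹ * c) * (a : ZMod p)⁻¹, ?_⟩
  rw [alpha_mul_alphaGL, lowTri_val]
  have ha := a.ne_zero
  have hd := d.ne_zero
  congr 1
  · change b₁ = (a : ZMod p) * c / 2 +
      (b₁ - a * c / 2 - b₂ * (d : ZMod p)⁻¹ * c) * (a : ZMod p)⁻¹ * a + b₂ * (d : ZMod p)⁻¹ * c
    rw [inv_mul_cancel_right₀ ha]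
    ring
  · change b₂ = (0 : ZMod p) * d / 2 +
      (b₁ - a * c / 2 - b₂ * (d : ZMod p)⁻¹ * c) * (a : ZMod p)⁻¹ * 0 + b₂ * (d : ZMod p)⁻¹ * d
    rw [inv_mul_cancel_right₀ hd]
    ring

theorem alphaGL_lowTri_eq (r₁ r₃ : ZMod p) (a d : (ZMod p)ˣ) (c : ZMod p) :
    ∃ b₁ : ZMod p, alpha1 hp ^ r₁.val * alpha3 hp ^ r₃.val * alphaGL hp (lowTri a d c) =
      bracket hp (lowTri a d c) b₁ (r₃ * d) := by
  refine ⟨a * c / 2 + r₁ * a + r₃ * c, ?_⟩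
  rw [alpha_mul_alphaGL, lowTri_val]
  congr 1
  change (0 : ZMod p) * d / 2 + r₁ * 0 + r₃ * d = r₃ * d
  ring

theorem val_eq_lowTri {A : GL (Fin 2) (ZMod p)} {a c d : ZMod p} (h : A.val = !![a, 0; c, d]) :
    ∃ u w : (ZMod p)ˣ, (u : ZMod p) = a ∧ (w : ZMod p) = d ∧ A = lowTri u w c := by
  obtain ⟨u, w, c', rfl⟩ := exists_eq_lowTri (A := A) (by rw [h]; rfl)
  rw [lowTri_val] at h
  have h0 : (u : ZMod p) = a := congrFun (congrFun h 0) 0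
  have h1 : (w : ZMod p) = d := congrFun (congrFun h 1) 1
  have h2 : c' = c := congrFun (congrFun h 1) 0
  exact ⟨u, w, h0, h1, by rw [h2]⟩

/-- Skew braces with `t = s = 0`. -/
theorem intertwines_set_r {P : Param p} (ht : P.t = 0) (hs : P.s = 0) (hr : P.r ≠ 0) :
    {φ | Intertwines hp P P φ} =
      {α | ∃ (r₁ r₃ b₁ b₃ : ZMod p) (A : GL (Fin 2) (ZMod p)), A.val = !![b₁, 0; b₃, b₁] ∧
        α = alpha1 hp ^ r₁.val * alpha3 hp ^ r₃.val * alphaGL hp A} := by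
  have hP : P ≠ 0 := fun h => hr (by rw [h]; rfl)
  ext φ
  rw [Set.mem_ofPred_eq, Set.mem_ofPred_eq, intertwines_iff_exists hp hP]
  simp only [ht, hs, mul_zero, zero_mul, add_zero, true_and]
  constructor
  · rintro ⟨a, d, c, b₁, b₂, rfl, h⟩
    have had : (d : ZMod p) = a := mul_left_cancel₀ a.ne_zero
      ((mul_right_cancel₀ hr h).trans (pow_two _))
    obtain ⟨r₁, h1⟩ := bracket_lowTri_eq hp a d c b₁ b₂
    exact ⟨r₁, _, a, c, lowTri a d c, by rw [lowTri_val, had], h1⟩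
  · rintro ⟨r₁, r₃, b₁, b₃, A, hA, rfl⟩
    obtain ⟨u, w, rfl, hw, rfl⟩ := val_eq_lowTri hA
    obtain ⟨b, hb⟩ := alphaGL_lowTri_eq hp r₁ r₃ u w b₃
    exact ⟨u, w, b₃, b, _, hb, by rw [hw, pow_two]⟩

/-- Skew braces with `t = r = 0`. -/
theorem intertwines_set_s {P : Param p} (ht : P.t = 0) (hr : P.r = 0) (hs : P.s ≠ 0) :
    {φ | Intertwines hp P P φ} =
      {α | ∃ (r₁ r₃ b₁ b₄ : ZMod p) (A : GL (Fin 2) (ZMod p)), A.val = !![b₁, 0; 0, b₄] ∧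
        α = alpha1 hp ^ r₁.val * alpha3 hp ^ r₃.val * alphaGL hp A} := by
  have hP : P ≠ 0 := fun h => hs (by rw [h]; rfl)
  ext φ
  rw [Set.mem_ofPred_eq, Set.mem_ofPred_eq, intertwines_iff_exists hp hP]
  simp only [ht, hr, mul_zero, zero_mul, add_zero, zero_add, true_and]
  constructor
  · rintro ⟨a, d, c, b₁, b₂, rfl, h⟩
    have hc : c = 0 := by
      have h1 := (mul_eq_zero.mp h.symm).resolve_right hs
      exact (mul_eq_zero.mp h1).resolve_left a.ne_zero
    obtain ⟨r₁, h1⟩ := bracket_lowTri_eq hp a d c b₁ b₂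
    exact ⟨r₁, _, a, d, lowTri a d c, by rw [lowTri_val, hc], h1⟩
  · rintro ⟨r₁, r₃, b₁, b₃, A, hA, rfl⟩
    obtain ⟨u, w, -, -, rfl⟩ := val_eq_lowTri hA
    obtain ⟨b, hb⟩ := alphaGL_lowTri_eq hp r₁ r₃ u w 0
    exact ⟨u, w, 0, b, _, hb, by simp⟩

/-- Skew braces with `t = 1` and `r = 0`. -/
theorem intertwines_set_t {P : Param p} (ht : P.t = 1) (hr : P.r = 0) :
    {φ | Intertwines hp P P φ} =
      {α | ∃ (r₁ b₁ b₃ : ZMod p) (A : GL (Fin 2) (ZMod p)), A.val = !![b₁, 0; b₃, b₁ ^ 2] ∧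
        α = alpha1 hp ^ r₁.val *
          alpha3 hp ^ (P.s * b₁⁻¹ * b₃ + 2⁻¹ * (b₁ - 1) * (P.s + 1)).val * alphaGL hp A} := by
  have hP : P ≠ 0 := fun h => one_ne_zero (α := ZMod p) (by rw [← ht, h]; rfl)
  ext φ
  rw [Set.mem_ofPred_eq, Set.mem_ofPred_eq, intertwines_iff_exists hp hP]
  simp only [ht, hr, mul_zero, mul_one, one_mul, zero_add]
  constructor
  · rintro ⟨a, d, c, b₁, b₂, rfl, hd, rfl⟩
    obtain ⟨r₁, h1⟩ := bracket_lowTri_eq hp a d c b₁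
      (2⁻¹ * (a ^ 2 * (a - 1)) * (P.s + 1) + a * c * P.s)
    refine ⟨r₁, a, c, lowTri a d c, by rw [lowTri_val, hd], ?_⟩
    rw [h1, hd]
    congr 4
    -- The exponent of `α₃` is `b₂ / d` with `d = a²` and `b₂` given by the last intertwining
    -- equation.
    have ha := a.ne_zero
    field_simp
    ring
  · rintro ⟨r₁, b₁, b₃, A, hA, rfl⟩
    obtain ⟨u, w, rfl, hw, rfl⟩ := val_eq_lowTri hA
    obtain ⟨b, hb⟩ := alphaGL_lowTri_eq hp r₁
      (P.s * (u : ZMod p)⁻¹ * b₃ + 2⁻¹ * (u - 1) * (P.s + 1)) u w b₃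
    refine ⟨u, w, b₃, b, _, hb, hw, ?_⟩
    rw [hw]
    have hu := u.ne_zero
    field_simp
    ring

theorem card_units_zmod : Nat.card (ZMod p)ˣ = p - 1 := by
  rw [Nat.card_eq_fintype_card, ZMod.card_units]

/-- The only condition left is `d = a`; the parameters `c`, `b₁`, `b₂` are free. -/
theorem card_intertwines_r {P : Param p} (ht : P.t = 0) (hs : P.s = 0) (hr : P.r ≠ 0) :
    Nat.card {φ | Intertwines hp P P φ} = (p - 1) * p ^ 3 := by
  have hP : P ≠ 0 := fun h => hr (by rw [h]; rfl)
  let F : (ZMod p)ˣ × ZMod p × ZMod p × ZMod p → MulAut (Heis p) := fun w =>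
    bracket hp (lowTri w.1 w.1 w.2.1) w.2.2.1 w.2.2.2
  have hF : {φ | Intertwines hp P P φ} = Set.range F := by
    ext φ
    rw [Set.mem_ofPred_eq, intertwines_iff_exists hp hP]
    simp only [ht, hs, mul_zero, zero_mul, add_zero, true_and]
    constructor
    · rintro ⟨a, d, c, b₁, b₂, rfl, h⟩
      have had : d = a := Units.ext (mul_left_cancel₀ a.ne_zero
        ((mul_right_cancel₀ hr h).trans (pow_two _)))
      exact ⟨(a, c, b₁, b₂), by rw [had]⟩
    · rintro ⟨⟨a, c, b₁, b₂⟩, rfl⟩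
      exact ⟨a, a, c, b₁, b₂, rfl, by rw [pow_two]⟩
  have hinj : Function.Injective F := by
    rintro ⟨a, c, b₁, b₂⟩ ⟨a', c', b₁', b₂'⟩ h
    obtain ⟨h1, h2, h3⟩ := bracket_injective hp h
    obtain ⟨h4, -, h5⟩ := lowTri_injective h1
    simp only at h2 h3 h4 h5
    rw [h2, h3, h4, h5]
  rw [hF, Nat.card_range_of_injective hinj]
  simp only [Nat.card_prod, Nat.card_zmod, card_units_zmod]
  ring

/-- The only condition left is `c = 0`; both diagonal entries and `b₁`, `b₂` are free. -/
theorem card_intertwines_s {P : Param p} (ht : P.t = 0) (hr : P.r = 0) (hs : P.s ≠ 0) :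
    Nat.card {φ | Intertwines hp P P φ} = (p - 1) ^ 2 * p ^ 2 := by
  have hP : P ≠ 0 := fun h => hs (by rw [h]; rfl)
  let F : (ZMod p)ˣ × (ZMod p)ˣ × ZMod p × ZMod p → MulAut (Heis p) := fun w =>
    bracket hp (lowTri w.1 w.2.1 0) w.2.2.1 w.2.2.2
  have hF : {φ | Intertwines hp P P φ} = Set.range F := by
    ext φ
    rw [Set.mem_ofPred_eq, intertwines_iff_exists hp hP]
    simp only [ht, hr, mul_zero, zero_mul, add_zero, zero_add, true_and]
    constructor
    · rintro ⟨a, d, c, b₁, b₂, rfl, h⟩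
      have hc : c = 0 := by
        have h1 := (mul_eq_zero.mp h.symm).resolve_right hs
        exact (mul_eq_zero.mp h1).resolve_left a.ne_zero
      exact ⟨(a, d, b₁, b₂), by rw [hc]⟩
    · rintro ⟨⟨a, d, b₁, b₂⟩, rfl⟩
      exact ⟨a, d, 0, b₁, b₂, rfl, by simp⟩
  have hinj : Function.Injective F := by
    rintro ⟨a, d, b₁, b₂⟩ ⟨a', d', b₁', b₂'⟩ h
    obtain ⟨h1, h2, h3⟩ := bracket_injective hp h
    obtain ⟨h4, h5, -⟩ := lowTri_injective h1
    simp only at h2 h3 h4 h5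
    rw [h2, h3, h4, h5]
  rw [hF, Nat.card_range_of_injective hinj]
  simp only [Nat.card_prod, Nat.card_zmod, card_units_zmod]
  ring

/-- Here `d = a²` and `b₂` is determined by the others, so `a`, `c`, `b₁` are free. -/
theorem card_intertwines_t {P : Param p} (ht : P.t = 1) (hr : P.r = 0) :
    Nat.card {φ | Intertwines hp P P φ} = (p - 1) * p ^ 2 := by
  have hP : P ≠ 0 := fun h => one_ne_zero (α := ZMod p) (by rw [← ht, h]; rfl)
  let F : (ZMod p)ˣ × ZMod p × ZMod p → MulAut (Heis p) := fun w =>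
    bracket hp (lowTri w.1 (w.1 ^ 2) w.2.1) w.2.2
      (2⁻¹ * ((w.1 : ZMod p) ^ 2 * (w.1 - 1)) * (P.s + 1) + w.1 * w.2.1 * P.s)
  have hF : {φ | Intertwines hp P P φ} = Set.range F := by
    ext φ
    rw [Set.mem_ofPred_eq, intertwines_iff_exists hp hP]
    simp only [ht, hr, mul_zero, mul_one, one_mul, zero_add]
    constructor
    · rintro ⟨a, d, c, b₁, b₂, rfl, hd, rfl⟩
      have hd' : d = a ^ 2 := Units.ext (by rw [hd, Units.val_pow_eq_pow_val])
      exact ⟨(a, c, b₁), by rw [hd']⟩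
    · rintro ⟨⟨a, c, b₁⟩, rfl⟩
      exact ⟨a, a ^ 2, c, b₁, _, rfl, by rw [Units.val_pow_eq_pow_val], rfl⟩
  have hinj : Function.Injective F := by
    rintro ⟨a, c, b₁⟩ ⟨a', c', b₁'⟩ h
    obtain ⟨h1, h2, h3⟩ := bracket_injective hp h
    obtain ⟨h4, -, h5⟩ := lowTri_injective h1
    simp only at h2 h4 h5
    rw [h2, h4, h5]
  rw [hF, Nat.card_range_of_injective hinj]
  simp only [Nat.card_prod, Nat.card_zmod, card_units_zmod]
  ring

theorem Chart.card_aut {hp : 3 < p} {B : Type*} [SkewBrace B] {P : Param p}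
    (e : Chart hp B P) :
    Nat.card (SkewBraceIso B B) = Nat.card {φ | Intertwines hp P P φ} := by
  refine Nat.card_congr (Equiv.ofBijective
    (fun f => ⟨e.autOfIso e f, e.intertwines_autOfIso e f⟩) ⟨fun f g h => ?_, fun φ => ?_⟩)
  · apply SkewBraceIso.toEquiv_injective
    ext b
    have h1 := DFunLike.congr_fun (congrArg Subtype.val h) (e.toEquiv b)
    simp only [autOfIso_apply] at h1
    exact e.toEquiv.injective h1
  · exact ⟨e.isoOfAut e φ.1 φ.2, Subtype.ext (e.autOfIso_isoOfAut e φ.1 φ.2)⟩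

end Heis

/-! ### Classification -/

/-- The multiplicative part of an isomorphism of skew braces. -/
def SkewBraceIso.mulEquiv {B C : Type*} [SkewBrace B] [SkewBrace C] (f : SkewBraceIso B C) :
    B ≃* C :=
  { f.toEquiv with map_mul' := f.map_mul' }

/-- The additive part of an isomorphism of skew braces. -/
def SkewBraceIso.addEquiv {B C : Type*} [SkewBrace B] [SkewBrace C] (f : SkewBraceIso B C) :
    B ≃+ C :=
  { f.toEquiv with map_add' := f.map_add' }

instance ULift.skewBrace {B : Type u} [SkewBrace B] : SkewBrace (ULift.{w} B) where
  brace_property a b c := ULift.ext _ _ (SkewBrace.brace_property a.down b.down c.down)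

/-- A skew brace is isomorphic to its lift to another universe. -/
def SkewBraceIso.ulift (B : Type u) [SkewBrace B] : SkewBraceIso (ULift.{w} B) B where
  toEquiv := Equiv.ulift
  map_add' _ _ := rfl
  map_mul' _ _ := rfl

namespace Heis

variable {p : ℕ} [Fact p.Prime] (hp : 3 < p)

/-- The skew brace given by the subgroup `⟨ρ, τ, σ α₁^a α₂^b α₃^c⟩` of the holomorph. -/
abbrev StdBrace (i : ℕ × ℕ × ℕ) : Type :=
  Hol.Brace (holSubgroup hp i) (isRegular_holSubgroup hp i)

/-- The chart of `StdBrace`. -/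
noncomputable def stdChart (i : ℕ × ℕ × ℕ) : Chart hp (StdBrace hp i) (paramOf p i) :=
  braceChart hp i _

theorem eq_of_stdBrace_iso {i j : ℕ × ℕ × ℕ} (hi : i ∈ exponentsM p ∪ exponentsC)
    (hj : j ∈ exponentsM p ∪ exponentsC)
    (h : Nonempty (SkewBraceIso (StdBrace hp i) (StdBrace hp j))) : i = j := by
  obtain ⟨φ, hφ⟩ := ((stdChart hp i).nonempty_iso_iff (stdChart hp j)).mp h
  exact eq_of_intertwines hp hi hj hφ

theorem exists_stdBrace_iso {B : Type*} [SkewBrace B] (e : Nonempty (B ≃+ Additive (Heis p)))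
    (hB : SkewBrace.thetaCard B = p) :
    ∃ i ∈ exponentsM p ∪ exponentsC, Nonempty (SkewBraceIso B (StdBrace hp i)) := by
  obtain ⟨P, hP, ⟨c⟩⟩ := exists_chart hp e.some hB
  obtain ⟨i, hi, hφ⟩ := exists_intertwines hp hP
  exact ⟨i, hi, (c.nonempty_iso_iff (stdChart hp i)).mpr hφ⟩

theorem stdBrace_of_mem_exponentsM {i : ℕ × ℕ × ℕ} (hi : i ∈ exponentsM p) :
    IsSkewBraceOfType (StdBrace hp i) (Heis p) (Heis p) :=
  (stdChart hp i).isSkewBraceOfType_heis (paramOf_s_of_mem_exponentsM hp hi)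

theorem stdBrace_of_mem_exponentsC {i : ℕ × ℕ × ℕ} (hi : i ∈ exponentsC) :
    IsSkewBraceOfType (StdBrace hp i) (ElemAb p) (Heis p) :=
  (stdChart hp i).isSkewBraceOfType_elemAb (paramOf_s_of_mem_exponentsC hi)

theorem thetaCard_stdBrace {i : ℕ × ℕ × ℕ} (hi : i ∈ exponentsM p ∪ exponentsC) :
    SkewBrace.thetaCard (StdBrace hp i) = p :=
  (stdChart hp i).thetaCard_eq (paramOf_ne_zero hi)

/-- `S` is a set of exponents of representatives for the skew braces of Heisenberg type with
`|Θ| = p` and multiplicative group `G`. -/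
structure IsIndexSet (G : Type*) [Group G] (S : Set (ℕ × ℕ × ℕ)) : Prop where
  subset : S ⊆ exponentsM p ∪ exponentsC
  mulEquiv : ∀ i ∈ S, Nonempty (StdBrace hp i ≃* G)
  mem : ∀ i ∈ exponentsM p ∪ exponentsC, Nonempty (StdBrace hp i ≃* G) → i ∈ S

theorem isIndexSet_exponentsM : IsIndexSet hp (Heis p) (exponentsM p) where
  subset := Set.subset_union_left
  mulEquiv _ hi := (stdBrace_of_mem_exponentsM hp hi).1
  mem _ hi := fun ⟨e⟩ => hi.resolve_right fun hC => not_nonempty_heis_mulEquiv_elemAb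
    ((stdBrace_of_mem_exponentsC hp hC).1.map e.symm.trans)

theorem isIndexSet_exponentsC : IsIndexSet hp (ElemAb p) exponentsC where
  subset := Set.subset_union_right
  mulEquiv _ hi := (stdBrace_of_mem_exponentsC hp hi).1
  mem _ hi := fun ⟨e⟩ => hi.resolve_left fun hM => not_nonempty_heis_mulEquiv_elemAb
    ((stdBrace_of_mem_exponentsM hp hM).1.map fun f => f.symm.trans e)

variable {hp} {G : Type*} [Group G] {S : Set (ℕ × ℕ × ℕ)}

theorem IsIndexSet.exists_iso (hS : IsIndexSet hp G S) {B : Type*} [SkewBrace B]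
    (hBG : IsSkewBraceOfType B G (Heis p)) (hB : SkewBrace.thetaCard B = p) :
    ∃ i ∈ S, Nonempty (SkewBraceIso B (StdBrace hp i)) := by
  obtain ⟨i, hi, ⟨f⟩⟩ := exists_stdBrace_iso hp hBG.2 hB
  exact ⟨i, hS.mem i hi (hBG.1.map f.symm.mulEquiv.trans), ⟨f⟩⟩

theorem IsIndexSet.isSkewBraceOfType (hS : IsIndexSet hp G S) {B : Type*} [SkewBrace B]
    {i : ℕ × ℕ × ℕ} (hi : i ∈ S) (f : SkewBraceIso B (StdBrace hp i)) :
    IsSkewBraceOfType B G (Heis p) ∧ SkewBrace.thetaCard B = p :=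
  ⟨⟨(hS.mulEquiv i hi).map f.mulEquiv.trans, ⟨f.addEquiv.trans (stdChart hp i).addEquiv⟩⟩,
    ((stdChart hp i).comp f).thetaCard_eq (paramOf_ne_zero (hS.subset hi))⟩

theorem IsIndexSet.ncard_skewBraceClasses (hS : IsIndexSet hp G S) :
    (skewBraceClasses.{w} G (Heis p) p).ncard = S.ncard := by
  -- The standard skew braces live in the lowest universe and have to be lifted to the one in which
  -- classes are taken.
  let F : ℕ × ℕ × ℕ → Quotient BundledSkewBrace.setoid.{w} := fun i =>
    Quotient.mk _ ⟨ULift.{w} (StdBrace hp i)⟩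
  have hF : skewBraceClasses.{w} G (Heis p) p = F '' S := by
    ext q
    constructor
    · rintro ⟨B, rfl, hBG, hB⟩
      obtain ⟨i, hi, ⟨f⟩⟩ := hS.exists_iso hBG hB
      exact ⟨i, hi, Quotient.sound ⟨(SkewBraceIso.ulift _).trans f.symm⟩⟩
    · rintro ⟨i, hi, rfl⟩
      exact ⟨_, rfl, hS.isSkewBraceOfType hi (SkewBraceIso.ulift _)⟩
  rw [hF]
  refine Set.InjOn.ncard_image ?_
  intro i hi j hj hij
  obtain ⟨f⟩ := Quotient.exact hij
  exact eq_of_stdBrace_iso hp (hS.subset hi) (hS.subset hj)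
    ⟨((SkewBraceIso.ulift _).symm.trans f).trans (SkewBraceIso.ulift _)⟩

/-- The set `exponentsM` as a finite set. -/
def finsetM (p : ℕ) : Finset (ℕ × ℕ × ℕ) :=
  {(1, 0, 0), (0, 1, 0)} ∪ ((Finset.Ico 2 p).image (fun c => (0, 0, c)) ∪
    (Finset.Ico 2 p).image (fun c => (0, 1, c)))

theorem coe_finsetM : (finsetM p : Set (ℕ × ℕ × ℕ)) = exponentsM p := by
  ext i
  simp only [finsetM, exponentsM, Finset.mem_coe, Finset.mem_union, Finset.mem_insert,
    Finset.mem_singleton, Finset.mem_image, Finset.mem_Ico, Set.mem_ofPred_eq]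
  constructor
  · rintro ((h | h) | ⟨c, ⟨h1, h2⟩, rfl⟩ | ⟨c, ⟨h1, h2⟩, rfl⟩)
    · exact Or.inl h
    · exact Or.inr (Or.inl h)
    · exact Or.inr (Or.inr ⟨c, h1, h2, Or.inl rfl⟩)
    · exact Or.inr (Or.inr ⟨c, h1, h2, Or.inr rfl⟩)
  · rintro (h | h | ⟨c, h1, h2, rfl | rfl⟩)
    · exact Or.inl (Or.inl h)
    · exact Or.inl (Or.inr h)
    · exact Or.inr (Or.inl ⟨c, ⟨h1, h2⟩, rfl⟩)
    · exact Or.inr (Or.inr ⟨c, ⟨h1, h2⟩, rfl⟩)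

theorem sum_finsetM (f : ℕ × ℕ × ℕ → ℕ) :
    ∑ i ∈ finsetM p, f i = f (1, 0, 0) + f (0, 1, 0) +
      (∑ c ∈ Finset.Ico 2 p, f (0, 0, c) + ∑ c ∈ Finset.Ico 2 p, f (0, 1, c)) := by
  rw [finsetM, Finset.sum_union, Finset.sum_union, Finset.sum_image, Finset.sum_image,
    Finset.sum_pair]
  · simp
  · rintro c - d - h
    simpa using h
  · rintro c - d - h
    simpa using h
  · rw [Finset.disjoint_left]
    simp only [Finset.mem_image]
    rintro i ⟨c, -, rfl⟩ ⟨d, -, h⟩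
    simp at h
  · rw [Finset.disjoint_left]
    simp only [Finset.mem_insert, Finset.mem_singleton, Finset.mem_union, Finset.mem_image,
      Finset.mem_Ico]
    rintro i (rfl | rfl) (⟨c, hc, h⟩ | ⟨c, hc, h⟩) <;> simp at h <;> omega

theorem ncard_exponentsM (hp : 3 < p) : (exponentsM p).ncard = 2 * (p - 1) := by
  rw [← coe_finsetM, Set.ncard_coe_finset, Finset.card_eq_sum_ones, sum_finsetM]
  simp only [Finset.sum_const, Nat.card_Ico, smul_eq_mul]
  omega

theorem ncard_exponentsC : exponentsC.ncard = 2 :=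
  Set.ncard_pair (by simp)

end Heis

/-! ### Counting regular groups of permutations -/

namespace PermBrace

variable {G : Type*} [Group G]

theorem carrier_add (N : Subgroup (Equiv.Perm G)) (hN : IsRegularPerm N)
    (hl : IsNormalisedByLeft N) (x y : Carrier N hN hl) :
    x + y = (((orbitEquiv N hN).symm x : N) : Equiv.Perm G) y := by
  change (((orbitEquiv N hN).symm x : N) : Equiv.Perm G)
    ((((orbitEquiv N hN).symm y : N) : Equiv.Perm G) 1) = _
  exact congrArg _ ((orbitEquiv N hN).apply_symm_apply y)

theorem carrier_add_eq {N : Subgroup (Equiv.Perm G)} (hN : IsRegularPerm N)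
    (hl : IsNormalisedByLeft N) {n : Equiv.Perm G} (hn : n ∈ N) (x y : Carrier N hN hl)
    (hx : n 1 = x) : x + y = n y := by
  rw [carrier_add]
  have h : (orbitEquiv N hN).symm x = ⟨n, hn⟩ := (orbitEquiv N hN).symm_apply_eq.mpr hx.symm
  exact congrArg (fun m : N => (m : Equiv.Perm G) y) h

/-- The carrier has the multiplication of `G`. -/
def carrierMulEquiv (N : Subgroup (Equiv.Perm G)) (hN : IsRegularPerm N)
    (hl : IsNormalisedByLeft N) : Carrier N hN hl ≃* G :=
  MulEquiv.refl G

/-- The addition of the carrier is that of the group of permutations. -/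
noncomputable def carrierAddEquiv (N : Subgroup (Equiv.Perm G)) (hN : IsRegularPerm N)
    (hl : IsNormalisedByLeft N) : Carrier N hN hl ≃+ Additive N where
  toEquiv := (orbitEquiv N hN).symm.trans Additive.ofMul
  map_add' x y := by
    change Additive.ofMul ((orbitEquiv N hN).symm (orbitEquiv N hN
      ((orbitEquiv N hN).symm x * (orbitEquiv N hN).symm y))) = _
    rw [Equiv.symm_apply_apply]
    rfl

variable {B : Type*} [SkewBrace B]

theorem _root_.SkewBrace.one_eq_zero : (1 : B) = 0 := by
  rw [← SkewBrace.mul_zero_eq (1 : B), one_mul]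

/-- The group of the translations of the addition of `B`, transported along `f`. -/
def pullback (f : G ≃* B) : Subgroup (Equiv.Perm G) where
  carrier := {n | ∃ b : B, ∀ x, f (n x) = b + f x}
  one_mem' := ⟨0, fun x => (zero_add _).symm⟩
  mul_mem' := by
    rintro m n ⟨b, hb⟩ ⟨c, hc⟩
    exact ⟨b + c, fun x => by rw [Equiv.Perm.mul_apply, hb, hc, add_assoc]⟩
  inv_mem' := by
    rintro n ⟨b, hb⟩
    refine ⟨-b, fun x => ?_⟩
    rw [eq_neg_add_iff_add_eq, ← hb, ← Equiv.Perm.mul_apply, mul_inv_cancel, Equiv.Perm.one_apply]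

theorem isRegularPerm_pullback (f : G ≃* B) : IsRegularPerm (pullback f) := by
  intro x y
  refine ⟨(f.toEquiv.trans (Equiv.addLeft (f y - f x))).trans f.toEquiv.symm,
    ⟨⟨f y - f x, fun z => ?_⟩, ?_⟩, ?_⟩
  · exact f.apply_symm_apply _
  · change f.symm (f y - f x + f x) = y
    rw [sub_add_cancel, f.symm_apply_apply]
  · rintro n ⟨⟨b, hb⟩, rfl⟩
    ext z
    change n z = f.symm (f (n x) - f x + f z)
    rw [hb, add_sub_cancel_right, ← hb, f.symm_apply_apply]

/-- By the brace identity, conjugating the translation by `b` with left multiplication by `g` gives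
the translation by `g * b - g`. -/
theorem isNormalisedByLeft_pullback (f : G ≃* B) : IsNormalisedByLeft (pullback f) := by
  rintro g n ⟨b, hb⟩
  refine ⟨f g * b - f g, fun x => ?_⟩
  change f (g * n (g⁻¹ * x)) = _
  rw [map_mul, hb, SkewBrace.brace_property, ← map_mul, mul_inv_cancel_left, sub_eq_add_neg]

/-- A regular group is recovered from its addition, as its element with value `x` at `1` is the
translation by `x`. So `f` is additive exactly when it carries `N` to the translations of `B`. -/
theorem eq_pullback_iff {N : Subgroup (Equiv.Perm G)} (hN : IsRegularPerm N)
    (hl : IsNormalisedByLeft N) (f : G ≃* B) :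
    N = pullback f ↔ ∀ x y : Carrier N hN hl, f (x + y : Carrier N hN hl) = f x + f y := by
  constructor
  · intro h x y
    let n : N := (orbitEquiv N hN).symm x
    have hn : (n : Equiv.Perm G) 1 = x := (orbitEquiv N hN).apply_symm_apply x
    obtain ⟨b, hb⟩ : (n : Equiv.Perm G) ∈ pullback f := h ▸ n.2
    rw [carrier_add]
    change f ((n : Equiv.Perm G) y) = _
    have hbx : f x = b := by
      rw [← hn, hb, map_one, SkewBrace.one_eq_zero, add_zero]
    rw [hbx]
    exact hb y
  · intro h
    have hle : N ≤ pullback f := fun n hn =>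
      ⟨f (n 1), fun y => (congrArg f (carrier_add_eq hN hl hn _ y rfl)).symm.trans (h _ _)⟩
    refine le_antisymm hle fun n hn => ?_
    obtain ⟨m, ⟨hm, hm1⟩, -⟩ := hN 1 (n 1)
    rwa [← (isRegularPerm_pullback f 1 (n 1)).unique ⟨hle hm, hm1⟩ ⟨hn, rfl⟩]

variable (G B) in
/-- The regular groups of permutations of `G`, normalised by the left translations, whose skew
brace is isomorphic to `B`. -/
def permGroups : Set (Subgroup (Equiv.Perm G)) :=
  {N | ∃ (hN : IsRegularPerm N) (hl : IsNormalisedByLeft N),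
    Nonempty (SkewBraceIso (Carrier N hN hl) B)}

/-- Pairs of a group `N` and an isomorphism from its skew brace to `B` are the same as group
isomorphisms `G ≃* B`, since such an isomorphism determines `N` as its pullback. For each `N` there
are `|Aut B|` isomorphisms, and there are `|Aut G|` group isomorphisms in all. -/
theorem card_permGroups_mul (e : G ≃* B) :
    Nat.card (permGroups G B) * Nat.card (SkewBraceIso B B) = Nat.card (MulAut G) := by
  let Φ : (Σ N : permGroups G B, SkewBraceIso (Carrier N.1 N.2.choose N.2.choose_spec.choose) B) →
      (G ≃* B) := fun w => (carrierMulEquiv _ _ _).symm.trans w.2.mulEquiv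
  have hΦ : Function.Bijective Φ := by
    constructor
    · rintro ⟨⟨N, hN⟩, f⟩ ⟨⟨M, hM⟩, g⟩ h
      have hNM : N = M := ((eq_pullback_iff hN.choose hN.choose_spec.choose _).mpr f.map_add').trans
        ((congrArg pullback h).trans
          ((eq_pullback_iff hM.choose hM.choose_spec.choose _).mpr g.map_add').symm)
      subst hNM
      congr 1
      apply SkewBraceIso.toEquiv_injective
      exact congrArg MulEquiv.toEquiv h
    · intro f
      have hN : pullback f ∈ permGroups G B :=
        ⟨isRegularPerm_pullback f, isNormalisedByLeft_pullback f,
          ⟨{ toEquiv := f.toEquiv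
             map_add' := (eq_pullback_iff _ _ f).mp rfl
             map_mul' := f.map_mul' }⟩⟩
      exact ⟨⟨⟨_, hN⟩, { toEquiv := f.toEquiv
                         map_add' := (eq_pullback_iff _ _ f).mp rfl
                         map_mul' := f.map_mul' }⟩, rfl⟩
  let F : ∀ N : permGroups G B,
      SkewBraceIso (Carrier N.1 N.2.choose N.2.choose_spec.choose) B ≃ SkewBraceIso B B := fun N =>
    { toFun := fun f => N.2.choose_spec.choose_spec.some.symm.trans f
      invFun := fun f => N.2.choose_spec.choose_spec.some.trans f
      left_inv := fun f => SkewBraceIso.toEquiv_injective (by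
        ext x
        exact congrArg f.toEquiv (Equiv.symm_apply_apply _ _))
      right_inv := fun f => SkewBraceIso.toEquiv_injective (by
        ext x
        exact congrArg f.toEquiv (Equiv.apply_symm_apply _ _)) }
  rw [← Nat.card_prod, ← Nat.card_congr (Equiv.sigmaEquivProdOfEquiv F),
    Nat.card_congr (Equiv.ofBijective Φ hΦ)]
  exact Nat.card_congr
    { toFun := fun f => f.trans e.symm
      invFun := fun f => f.trans e
      left_inv := fun f => by ext; simp
      right_inv := fun f => by ext; simp }

end PermBrace

namespace Heis

variable {p : ℕ} [Fact p.Prime] {hp : 3 < p}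

open PermBrace

theorem IsIndexSet.permGroups_eq {G : Type*} [Group G] {S : Set (ℕ × ℕ × ℕ)}
    (hS : IsIndexSet hp G S) :
    {N : Subgroup (Equiv.Perm G) | ∃ (hN : IsRegularPerm N) (hl : IsNormalisedByLeft N),
      Nonempty (N ≃* Heis p) ∧ SkewBrace.thetaCard (Carrier N hN hl) = p} =
      ⋃ i ∈ S, permGroups G (StdBrace hp i) := by
  ext N
  simp only [Set.mem_iUnion, Set.mem_ofPred_eq, permGroups, exists_prop]
  constructor
  · rintro ⟨hN, hl, ⟨e⟩, hB⟩
    obtain ⟨i, hi, hf⟩ := hS.exists_iso (B := Carrier N hN hl)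
      ⟨⟨carrierMulEquiv N hN hl⟩, ⟨(carrierAddEquiv N hN hl).trans (MulEquiv.toAdditive e)⟩⟩ hB
    exact ⟨i, hi, hN, hl, hf⟩
  · rintro ⟨i, hi, hN, hl, ⟨f⟩⟩
    obtain ⟨h1, h2⟩ := hS.isSkewBraceOfType hi f
    exact ⟨hN, hl, h1.2.map fun g =>
      MulEquiv.toAdditive.symm ((carrierAddEquiv N hN hl).symm.trans g), h2⟩

theorem IsIndexSet.ncard_eq_sum {G : Type*} [Group G] [Finite G] {S : Finset (ℕ × ℕ × ℕ)}
    (hS : IsIndexSet hp G S) :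
    {N : Subgroup (Equiv.Perm G) | ∃ (hN : IsRegularPerm N) (hl : IsNormalisedByLeft N),
      Nonempty (N ≃* Heis p) ∧ SkewBrace.thetaCard (Carrier N hN hl) = p}.ncard =
      ∑ i ∈ S, Nat.card (permGroups G (StdBrace hp i)) := by
  classical
  have hfin : ∀ T : Set (Subgroup (Equiv.Perm G)), T.Finite := fun T => Set.toFinite T
  have h : {N : Subgroup (Equiv.Perm G) | ∃ (hN : IsRegularPerm N) (hl : IsNormalisedByLeft N),
      Nonempty (N ≃* Heis p) ∧ SkewBrace.thetaCard (Carrier N hN hl) = p} =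
      ((S.biUnion fun i => (hfin (permGroups G (StdBrace hp i))).toFinset :
        Finset (Subgroup (Equiv.Perm G))) : Set (Subgroup (Equiv.Perm G))) := by
    rw [hS.permGroups_eq]
    ext N
    simp
  rw [h, Set.ncard_coe_finset, Finset.card_biUnion]
  · exact Finset.sum_congr rfl fun i _ => (Nat.card_eq_card_finite_toFinset _).symm
  · intro i hi j hj hij
    change Disjoint _ _
    rw [Finset.disjoint_left]
    intro N hN hN'
    rw [Set.Finite.mem_toFinset] at hN hN'
    obtain ⟨_, _, ⟨f⟩⟩ := hN
    obtain ⟨_, _, ⟨g⟩⟩ := hN'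
    exact hij (eq_of_stdBrace_iso hp (hS.subset hi) (hS.subset hj) ⟨f.symm.trans g⟩)

/-- Additive automorphisms are linear over `ZMod p`, so this is the order of `GL₃`. -/
theorem card_mulAut_elemAb :
    Nat.card (MulAut (ElemAb p)) = (p ^ 3 - 1) * (p ^ 3 - p) * (p ^ 3 - p ^ 2) := by
  have e : MulAut (ElemAb p) ≃ GL (Fin 3) (ZMod p) :=
    (AddEquiv.toMultiplicative.symm.trans
      { toFun := fun f => { f.toAddMonoidHom.toZModLinearMap p, f with }
        invFun := fun f => f.toAddEquiv
        left_inv := fun _ => rfl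
        right_inv := fun _ => rfl }).trans
      (Matrix.GeneralLinearGroup.toLin.trans
        (LinearMap.GeneralLinearGroup.generalLinearEquiv (ZMod p) (Fin 3 → ZMod p))).symm.toEquiv
  rw [Nat.card_congr e, Matrix.card_GL_field]
  simp [Fin.prod_univ_succ, ZMod.card, mul_assoc]

end Heis

/-! ### The counts -/

namespace Heis

variable {p : ℕ} [Fact p.Prime] {hp : 3 < p}

open PermBrace

theorem natCast_ne_zero_of_lt {c : ℕ} (h1 : 1 ≤ c) (hc : c < p) : (c : ZMod p) ≠ 0 := by
  intro h
  have := natCast_inj_of_lt hc (by omega) (h.trans Nat.cast_zero.symm)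
  omega

theorem card_aut_stdBrace_r : Nat.card (SkewBraceIso (StdBrace hp (1, 0, 0))
    (StdBrace hp (1, 0, 0))) = (p - 1) * p ^ 3 := by
  rw [(stdChart hp _).card_aut]
  exact card_intertwines_r hp (by simp [paramOf]) (by simp [paramOf]) (by simp [paramOf])

theorem card_aut_stdBrace_s {c : ℕ} (h1 : 1 ≤ c) (hc : c < p) :
    Nat.card (SkewBraceIso (StdBrace hp (0, 0, c)) (StdBrace hp (0, 0, c))) =
      (p - 1) ^ 2 * p ^ 2 := by
  rw [(stdChart hp _).card_aut]
  exact card_intertwines_s hp (by simp [paramOf]) (by simp [paramOf])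
    (natCast_ne_zero_of_lt h1 hc)

theorem card_aut_stdBrace_t (c : ℕ) :
    Nat.card (SkewBraceIso (StdBrace hp (0, 1, c)) (StdBrace hp (0, 1, c))) =
      (p - 1) * p ^ 2 := by
  rw [(stdChart hp _).card_aut]
  exact card_intertwines_t hp (by simp [paramOf]) (by simp [paramOf])

theorem card_permGroups_eq {G : Type*} [Group G] {B : Type*} [SkewBrace B] (e : G ≃* B)
    {a k n : ℕ} (ha : Nat.card (SkewBraceIso B B) = a) (hG : Nat.card (MulAut G) = n)
    (h0 : 0 < a) (hk : k * a = n) : Nat.card (permGroups G B) = k :=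
  Nat.eq_of_mul_eq_mul_right h0 (by rw [← ha, card_permGroups_mul e, hG, ha, hk])

/-- The classes contribute `p² - 1` for `σα₁`, `p(p² - 1)` for each of the `p - 1` classes with `t =
1`, and `p(p + 1)` for each of the `p - 2` classes `σα₃^c`. -/
theorem ncard_regular_heis {G : Type*} [Group G] (e : G ≃* Heis p) (hp : 3 < p) :
    {N : Subgroup (Equiv.Perm G) | ∃ (hN : IsRegularPerm N) (hl : IsNormalisedByLeft N),
      Nonempty (N ≃* Heis p) ∧ SkewBrace.thetaCard (Carrier N hN hl) = p}.ncard =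
      (p ^ 3 - p ^ 2 - 1) * (p + 1) := by
  have : Finite G := Finite.of_equiv _ e.symm.toEquiv
  have h0 := isIndexSet_exponentsM hp
  have hS : IsIndexSet hp G (finsetM p) := by
    rw [coe_finsetM]
    exact ⟨h0.subset, fun i hi => (h0.mulEquiv i hi).map fun f => f.trans e.symm,
      fun i hi hf => h0.mem i hi (hf.map fun f => f.trans e)⟩
  have hiso : ∀ i ∈ exponentsM p, Nonempty (G ≃* StdBrace hp i) := fun i hi =>
    (h0.mulEquiv i hi).map fun f => e.trans f.symm
  rw [hS.ncard_eq_sum, sum_finsetM]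
  -- Turns the truncated differences into polynomials in `q`.
  obtain ⟨q, rfl⟩ : ∃ q, p = q + 4 := ⟨p - 4, by omega⟩
  have hG : Nat.card (MulAut G) = ((q + 3) * (q + 5)) * ((q + 4) * (q + 3)) * (q + 4) ^ 2 := by
    rw [Nat.card_congr (MulAut.congr e).toEquiv, card_mulAut hp]
    congr 2
    · exact Nat.sub_eq_of_eq_add (by ring)
    · exact Nat.sub_eq_of_eq_add (by ring)
  have hr : Nat.card (permGroups G (StdBrace hp (1, 0, 0))) = (q + 3) * (q + 5) :=
    card_permGroups_eq (a := (q + 3) * (q + 4) ^ 3) (hiso _ (Or.inl rfl)).some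
      card_aut_stdBrace_r hG (by positivity) (by ring)
  have ht0 : Nat.card (permGroups G (StdBrace hp (0, 1, 0))) = (q + 4) * (q + 3) * (q + 5) :=
    card_permGroups_eq (a := (q + 3) * (q + 4) ^ 2) (hiso _ (Or.inr (Or.inl rfl))).some
      (card_aut_stdBrace_t 0) hG (by positivity) (by ring)
  have hs : ∀ c ∈ Finset.Ico 2 (q + 4), Nat.card (permGroups G (StdBrace hp (0, 0, c))) =
      (q + 4) * (q + 5) := fun c hc => by
    rw [Finset.mem_Ico] at hc
    exact card_permGroups_eq (a := (q + 3) ^ 2 * (q + 4) ^ 2)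
      (hiso _ (Or.inr (Or.inr ⟨c, hc.1, hc.2, Or.inl rfl⟩))).some
      (card_aut_stdBrace_s (by omega) hc.2) hG (by positivity) (by ring)
  have ht : ∀ c ∈ Finset.Ico 2 (q + 4), Nat.card (permGroups G (StdBrace hp (0, 1, c))) =
      (q + 4) * (q + 3) * (q + 5) := fun c hc => by
    rw [Finset.mem_Ico] at hc
    exact card_permGroups_eq (a := (q + 3) * (q + 4) ^ 2)
      (hiso _ (Or.inr (Or.inr ⟨c, hc.1, hc.2, Or.inr rfl⟩))).some
      (card_aut_stdBrace_t c) hG (by positivity) (by ring)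
  have hsub : (q + 4) ^ 3 - (q + 4) ^ 2 - 1 = q ^ 3 + 11 * q ^ 2 + 40 * q + 47 := by
    rw [Nat.sub_sub]
    exact Nat.sub_eq_of_eq_add (by ring)
  rw [hr, ht0, Finset.sum_congr rfl hs, Finset.sum_congr rfl ht, hsub]
  simp only [Finset.sum_const, Nat.card_Ico, smul_eq_mul]
  rw [show q + 4 - 2 = q + 2 by omega]
  ring

/-- The two classes contribute `(p³ - 1)p(p + 1)` and `(p³ - 1)p(p² - 1)`. -/
theorem ncard_regular_elemAb {G : Type*} [Group G] (e : G ≃* ElemAb p) (hp : 3 < p) :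
    {N : Subgroup (Equiv.Perm G) | ∃ (hN : IsRegularPerm N) (hl : IsNormalisedByLeft N),
      Nonempty (N ≃* Heis p) ∧ SkewBrace.thetaCard (Carrier N hN hl) = p}.ncard =
      (p ^ 3 - 1) * (p + 1) * p ^ 2 := by
  have : Finite G := Finite.of_equiv _ e.symm.toEquiv
  have h0 := isIndexSet_exponentsC hp
  have hS : IsIndexSet hp G (({(0, 0, 1), (0, 1, 1)} : Finset (ℕ × ℕ × ℕ)) :
      Set (ℕ × ℕ × ℕ)) := by
    rw [Finset.coe_pair]
    exact ⟨h0.subset, fun i hi => (h0.mulEquiv i hi).map fun f => f.trans e.symm,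
      fun i hi hf => h0.mem i hi (hf.map fun f => f.trans e)⟩
  have hiso : ∀ i ∈ exponentsC, Nonempty (G ≃* StdBrace hp i) := fun i hi =>
    (h0.mulEquiv i hi).map fun f => e.trans f.symm
  rw [hS.ncard_eq_sum, Finset.sum_pair (by simp)]
  obtain ⟨q, rfl⟩ : ∃ q, p = q + 4 := ⟨p - 4, by omega⟩
  have hG : Nat.card (MulAut G) =
      ((q + 4) ^ 3 - 1) * ((q + 4) * (q + 3) * (q + 5)) * ((q + 4) ^ 2 * (q + 3)) := by
    rw [Nat.card_congr (MulAut.congr e).toEquiv, card_mulAut_elemAb]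
    congr 2
    · exact Nat.sub_eq_of_eq_add (by ring)
    · exact Nat.sub_eq_of_eq_add (by ring)
  have hs : Nat.card (permGroups G (StdBrace hp (0, 0, 1))) =
      ((q + 4) ^ 3 - 1) * (q + 4) * (q + 5) :=
    card_permGroups_eq (a := (q + 3) ^ 2 * (q + 4) ^ 2) (hiso _ (Or.inl rfl)).some
      (card_aut_stdBrace_s le_rfl (by omega)) hG (by positivity) (by ring)
  have ht : Nat.card (permGroups G (StdBrace hp (0, 1, 1))) =
      ((q + 4) ^ 3 - 1) * (q + 4) * (q + 3) * (q + 5) :=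
    card_permGroups_eq (a := (q + 3) * (q + 4) ^ 2) (hiso _ (Or.inr rfl)).some
      (card_aut_stdBrace_t 1) hG (by positivity) (by ring)
  rw [hs, ht]
  ring

end Heis

theorem lemma16 (p : ℕ) [Fact p.Prime] (hp : 3 < p) :
    -- the numbers of isomorphism classes of skew braces
    (skewBraceClasses.{w} (Heis p) (Heis p) p).ncard = 2 * (p - 1) ∧
    (skewBraceClasses.{w} (ElemAb p) (Heis p) p).ncard = 2 ∧
    -- the explicit list of representatives, with their automorphism groups
    (∃ hreg : ∀ i : ℕ × ℕ × ℕ, Hol.IsRegular (Heis.holSubgroup hp i),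
      (∀ i ∈ exponentsM p,
        IsSkewBraceOfType (Hol.Brace _ (hreg i)) (Heis p) (Heis p) ∧
          SkewBrace.thetaCard (Hol.Brace _ (hreg i)) = p) ∧
      (∀ i ∈ exponentsC,
        IsSkewBraceOfType (Hol.Brace _ (hreg i)) (ElemAb p) (Heis p) ∧
          SkewBrace.thetaCard (Hol.Brace _ (hreg i)) = p) ∧
      (∀ i ∈ exponentsM p ∪ exponentsC, ∀ j ∈ exponentsM p ∪ exponentsC,
        Nonempty (SkewBraceIso (Hol.Brace _ (hreg i)) (Hol.Brace _ (hreg j))) → i = j) ∧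
      (∀ (B : Type w) [SkewBrace B], Nonempty (B ≃+ Additive (Heis p)) →
        SkewBrace.thetaCard B = p →
          ∃ i ∈ exponentsM p ∪ exponentsC,
            Nonempty (SkewBraceIso B (Hol.Brace _ (hreg i)))) ∧
      (∀ i : ℕ × ℕ × ℕ, Function.Injective (Hol.Brace.autHom _ (hreg i))) ∧
      Set.range (Hol.Brace.autHom _ (hreg (1, 0, 0))) =
        {α | ∃ (r₁ r₃ b₁ b₃ : ZMod p) (A : GL (Fin 2) (ZMod p)),
          A.val = !![b₁, 0; b₃, b₁] ∧
          α = Heis.alpha1 hp ^ r₁.val * Heis.alpha3 hp ^ r₃.val * Heis.alphaGL hp A} ∧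
      Set.range (Hol.Brace.autHom _ (hreg (0, 1, 0))) =
        {α | ∃ (r₁ b₁ b₃ : ZMod p) (A : GL (Fin 2) (ZMod p)),
          A.val = !![b₁, 0; b₃, b₁ ^ 2] ∧
          α = Heis.alpha1 hp ^ r₁.val * Heis.alpha3 hp ^ (2⁻¹ * (b₁ - 1)).val *
            Heis.alphaGL hp A} ∧
      ∀ c : ℕ, 1 ≤ c → c < p →
        Set.range (Hol.Brace.autHom _ (hreg (0, 0, c))) =
          {α | ∃ (r₁ r₃ b₁ b₄ : ZMod p) (A : GL (Fin 2) (ZMod p)),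
            A.val = !![b₁, 0; 0, b₄] ∧
            α = Heis.alpha1 hp ^ r₁.val * Heis.alpha3 hp ^ r₃.val * Heis.alphaGL hp A} ∧
        Set.range (Hol.Brace.autHom _ (hreg (0, 1, c))) =
          {α | ∃ (r₁ b₁ b₃ : ZMod p) (A : GL (Fin 2) (ZMod p)),
            A.val = !![b₁, 0; b₃, b₁ ^ 2] ∧
            α = Heis.alpha1 hp ^ r₁.val *
              Heis.alpha3 hp ^ ((c : ZMod p) * b₁⁻¹ * b₃ + 2⁻¹ * (b₁ - 1) * (c + 1)).val *
              Heis.alphaGL hp A}) ∧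
    -- the numbers of Hopf-Galois structures
    (∀ (K : Type u) (L : Type v) [Field K] [Field L] [Algebra K L] [FiniteDimensional K L]
      [IsGalois K L],
      (Nonempty ((L ≃ₐ[K] L) ≃* Heis p) →
        (hopfGaloisClasses K L (Heis p) p).ncard = (p ^ 3 - p ^ 2 - 1) * (p + 1)) ∧
      (Nonempty ((L ≃ₐ[K] L) ≃* ElemAb p) →
        (hopfGaloisClasses K L (Heis p) p).ncard = (p ^ 3 - 1) * (p + 1) * p ^ 2)) := by
  have hcast : ∀ {c : ℕ}, 1 ≤ c → c < p → (c : ZMod p) ≠ 0 := Heis.natCast_ne_zero_of_lt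
  refine ⟨?_, ?_, ⟨Heis.isRegular_holSubgroup hp, ?_, ?_, ?_, ?_, ?_, ?_, ?_, ?_⟩, ?_⟩
  · rw [(Heis.isIndexSet_exponentsM hp).ncard_skewBraceClasses, Heis.ncard_exponentsM hp]
  · rw [(Heis.isIndexSet_exponentsC hp).ncard_skewBraceClasses, Heis.ncard_exponentsC]
  · exact fun i hi =>
      ⟨Heis.stdBrace_of_mem_exponentsM hp hi, Heis.thetaCard_stdBrace hp (Or.inl hi)⟩
  · exact fun i hi =>
      ⟨Heis.stdBrace_of_mem_exponentsC hp hi, Heis.thetaCard_stdBrace hp (Or.inr hi)⟩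
  · exact fun i hi j hj => Heis.eq_of_stdBrace_iso hp hi hj
  · exact fun B _ => Heis.exists_stdBrace_iso hp
  · exact fun i => Heis.autHom_injective _ _
  · rw [Heis.range_autHom]
    exact Heis.intertwines_set_r hp (by simp [Heis.paramOf]) (by simp [Heis.paramOf])
      (by simp [Heis.paramOf])
  · rw [Heis.range_autHom, Heis.intertwines_set_t hp (by simp [Heis.paramOf])
      (by simp [Heis.paramOf])]
    simp [Heis.paramOf]
  · intro c hc hcp
    constructor
    · rw [Heis.range_autHom]
      exact Heis.intertwines_set_s hp (by simp [Heis.paramOf]) (by simp [Heis.paramOf])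
        (hcast hc hcp)
    · rw [Heis.range_autHom]
      exact Heis.intertwines_set_t hp (by simp [Heis.paramOf]) (by simp [Heis.paramOf])
  · intro K L _ _ _ _ _
    rw [GaloisDescent.ncard_hopfGaloisClasses]
    exact ⟨fun ⟨e⟩ => Heis.ncard_regular_heis e hp, fun ⟨e⟩ => Heis.ncard_regular_elemAb e hp⟩
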